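/- An antimonotone circuit on the variables $x_1,\dots,x_n$ is a finite directed acyclic graph whose vertices are the $n$ negative literals $\overline{x}_1,\dots,\overline{x}_n$ (of indegree $0$; a literal may have outdegree $0$) and gates of positive indegree, each labelled AND or OR, with a designated output gate of outdegree $0$; it computes a Boolean function of $x_1,\dots,x_n$ in the natural way. For $t\ge 2$ it is a $\Pi_t^-$ circuit if its output gate is an AND-gate, every gate has outdegree at most $1$, no gate is incoming to a gate of the same type, and every directed path from a literal to the output gate has length at most $t$. It is simplified if every gate other than the output gate has outdegree exactly $1$ and indegree at least $2$. The genus of a circuit is the (orientable) genus of its underlying undirected graph after removing the output gate; its size $|C|$ is the number of its vertices plus the number of its edges; the number of occurrences of the literals is the number of edges from literals to gates. A variable $x_i$ is a zero-variable of $C$ if $C$ evaluates to $0$ under every truth assignment with $x_i=1$. Two circuits on the same variables are equivalent if they are satisfied by the same truth assignments. Lemma. There are an absolute constant $c$ and an algorithm, running in time polynomial in $|C|$, such that for all $t\ge 2$ and $n$ the following holds. Given a $\Pi_t^-$ circuit $C$ on $n$ variables that has no zero-variables and has genus at most $n$, the algorithm outputs a simplified $\Pi_t^-$ circuit $C'$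 on the same $n$ variables that is equivalent to $C$, has genus at most that of $C$, and has at most $c\,n$ occurrences of the literals. -/

import Mathlib

/-! ### Genus of a finite graph (orientable, via rotation systems) -/

namespace GraphGenus

variable {V : Type*} (G : SimpleGraph V)

/-- The fixed-point-free involution reversing every dart (directed edge). -/
def dartRev : Equiv.Perm G.Dart :=
  (SimpleGraph.Dart.symm_involutive (G := G)).toPerm

/-- A rotation system: a permutation of the darts whose cycles are exactly the sets of darts
leaving a common vertex, i.e. a cyclic ordering of the edge ends around every vertex. -/
def IsRotation (ρ : Equiv.Perm G.Dart) : Prop :=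
  ∀ d e : G.Dart, ρ.SameCycle d e ↔ d.fst = e.fst

/-- The number of faces of the cellular embedding given by `ρ`: the number of cycles of the
face-tracing permutation, plus one face for every isolated vertex (alone on its own sphere). -/
noncomputable def faceCount (ρ : Equiv.Perm G.Dart) : ℕ :=
  Nat.card (Quotient (Equiv.Perm.SameCycle.setoid (ρ * dartRev G))) +
    Nat.card {v : V // ∀ w, ¬ G.Adj v w}

/-- `G` has a rotation system of total genus at most `g`.  By Euler's formula, summed over the
connected components, the genus `h` of a rotation system satisfies `V - E + F = 2 c - 2 h`, where
`c` is the number of components; the inequality says `h ≤ g`. -/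
def EmbedsInGenus (g : ℕ) : Prop :=
  ∃ ρ : Equiv.Perm G.Dart, IsRotation G ρ ∧
    2 * Nat.card G.ConnectedComponent + Nat.card G.edgeSet ≤ Nat.card V + faceCount G ρ + 2 * g

/-- The (orientable) genus of a finite graph. -/
noncomputable def genus : ℕ := sInf {g : ℕ | EmbedsInGenus G g}

end GraphGenus

/-! ### Antimonotone circuits -/

/-- The two gate types. -/
inductive GateKind
  | and
  | or
  deriving DecidableEq

/-- An antimonotone circuit on the variables `x_i`, `i : Fin n`.  Its vertices are the `n` negative
literals (`Sum.inl i` is the literal `¬ x_i`), which are the vertices of indegree `0`, and the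
gates (`Sum.inr g`).  `edge v g` says that `v` is incoming to the gate `g`.  A literal
need not be incoming to any gate. -/
structure AntiCircuit (n : ℕ) where
  numGates : ℕ
  kind : Fin numGates → GateKind
  edge : Fin n ⊕ Fin numGates → Fin numGates → Bool
  output : Fin numGates
  indegree_pos : ∀ g, ∃ v, edge v g = true
  acyclic : ∀ g, ¬ Relation.TransGen (fun a b => edge (Sum.inr a) b = true) g g
  output_outdegree : ∀ g, edge (Sum.inr output) g = false

namespace AntiCircuit

variable {n : ℕ} (C : AntiCircuit n)

/-- The vertices of the circuit. -/
abbrev Vertex : Type := Fin n ⊕ Fin C.numGates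

/-- `C.Holds τ v`: the vertex `v` has value `1` under the truth assignment `τ`. -/
inductive Holds (τ : Fin n → Bool) : C.Vertex → Prop
  | lit (i : Fin n) : τ i = false → Holds τ (Sum.inl i)
  | andGate (g : Fin C.numGates) : C.kind g = GateKind.and →
      (∀ v, C.edge v g = true → Holds τ v) → Holds τ (Sum.inr g)
  | orGate (g : Fin C.numGates) (v : C.Vertex) : C.kind g = GateKind.or →
      C.edge v g = true → Holds τ v → Holds τ (Sum.inr g)

/-- `τ` satisfies the circuit. -/
def Satisfies (τ : Fin n → Bool) : Prop := C.Holds τ (Sum.inr C.output)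

/-- Two circuits on the same variables are equivalent: they compute the same function. -/
def Equivalent (C C' : AntiCircuit n) : Prop :=
  ∀ τ : Fin n → Bool, C.Satisfies τ ↔ C'.Satisfies τ

/-- `x_i` is a zero-variable: assigning `x_i = 1` makes the circuit evaluate to `0`. -/
def IsZeroVariable (i : Fin n) : Prop :=
  ∀ τ : Fin n → Bool, τ i = true → ¬ C.Satisfies τ

/-- `C.PathToOutput k v`: there is a directed path of length `k` from `v` to the output gate. -/
inductive PathToOutput : ℕ → C.Vertex → Prop
  | output : PathToOutput 0 (Sum.inr C.output)
  | step (k : ℕ) (v : C.Vertex) (g : Fin C.numGates) : C.edge v g = true →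
      PathToOutput k (Sum.inr g) → PathToOutput (k + 1) v

/-- `C` is a `Π_t` circuit (antimonotone, as all circuits here): the output is an AND gate, every
gate has outdegree at most `1`, AND and OR gates alternate, and the depth is at most `t`. -/
structure IsPi (t : ℕ) : Prop where
  output_and : C.kind C.output = GateKind.and
  outdegree_le_one : ∀ g h h', C.edge (Sum.inr g) h = true → C.edge (Sum.inr g) h' = true → h = h'
  alternating : ∀ g h, C.edge (Sum.inr g) h = true → C.kind g ≠ C.kind h
  depth_le : ∀ (i : Fin n) (k : ℕ), C.PathToOutput k (Sum.inl i) → k ≤ t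

/-- `C` is simplified: every gate except the output is incoming to some gate and has
indegree at least `2`.  (That no gate is incoming to one of the same type is part of `IsPi`.) -/
structure IsSimplified : Prop where
  outdegree_pos : ∀ g, g ≠ C.output → ∃ h, C.edge (Sum.inr g) h = true
  two_le_indegree : ∀ g, g ≠ C.output →
    ∃ v w : C.Vertex, v ≠ w ∧ C.edge v g = true ∧ C.edge w g = true

/-- The underlying undirected graph of the circuit. -/
def graph : SimpleGraph C.Vertex :=
  SimpleGraph.fromRel (fun v w => ∃ g, w = Sum.inr g ∧ C.edge v g = true)

/-- The genus of a circuit: the genus of its underlying graph with the output gate removed. -/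
noncomputable def genus : ℕ :=
  GraphGenus.genus (C.graph.induce {v : C.Vertex | v ≠ Sum.inr C.output})

/-- The total number of occurrences of the literals: the edges from literals to gates. -/
def occurrences : ℕ :=
  (Finset.univ.filter (fun p : Fin n × Fin C.numGates => C.edge (Sum.inl p.1) p.2 = true)).card

/-- The size of a circuit: the number of its vertices plus the number of its edges. -/
def size : ℕ :=
  n + C.numGates +
    (Finset.univ.filter (fun p : C.Vertex × Fin C.numGates => C.edge p.1 p.2 = true)).card

/-- A circuit as a list of numbers: the number of variables, the number of gates, the index of the
output gate, the gate types (`0` for AND, `1` for OR), and then, gate by gate, the `0/1` vector of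
its incoming literals followed by the `0/1` vector of its incoming gates. -/
def encode : List ℕ :=
  [n, C.numGates, (C.output : ℕ)] ++
  List.ofFn (fun g => match C.kind g with
    | GateKind.and => 0
    | GateKind.or => 1) ++
  (List.finRange C.numGates).flatMap (fun g =>
    List.ofFn (fun i : Fin n => (C.edge (Sum.inl i) g).toNat) ++
    List.ofFn (fun h : Fin C.numGates => (C.edge (Sum.inr h) g).toNat))

end AntiCircuit

/-! ### Random access machines with a step count -/

namespace RAM

/-- The memory: scalar registers and arrays of natural numbers. -/
structure State where
  reg : ℕ → ℕ
  arr : ℕ → ℕ → ℕ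

/-- Programs of a random access machine with addition and (truncated) subtraction, written with
structured control flow.  Registers and arrays are named by constants of the program, so
a program uses finitely many of them; array cells are addressed by the content of a register. -/
inductive Prog
  /-- `reg r := k` -/
  | const (r k : ℕ)
  /-- `reg r := reg a + reg b` -/
  | add (r a b : ℕ)
  /-- `reg r := reg a - reg b` -/
  | sub (r a b : ℕ)
  /-- `reg r := arr A (reg i)` -/
  | load (r A i : ℕ)
  /-- `arr A (reg i) := reg r` -/
  | store (A i r : ℕ)
  | seq (p q : Prog)
  /-- if `reg r ≠ 0` then `p` else `q` -/
  | ite (r : ℕ) (p q : Prog)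
  /-- while `reg r ≠ 0` do `p` -/
  | while (r : ℕ) (p : Prog)

/-- Assign a value to a register. -/
def State.setReg (s : State) (r v : ℕ) : State :=
  { s with reg := Function.update s.reg r v }

/-- Assign a value to an array cell. -/
def State.setArr (s : State) (A i v : ℕ) : State :=
  { s with arr := Function.update s.arr A (Function.update (s.arr A) i v) }

/-- `Exec p s k s'`: started in `s`, the program `p` halts in state `s'` after exactly `k` steps,
where every elementary instruction and every evaluation of a test is one step. -/
inductive Exec : Prog → State → ℕ → State → Prop
  | const (r k : ℕ) (s : State) : Exec (.const r k) s 1 (s.setReg r k)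
  | add (r a b : ℕ) (s : State) : Exec (.add r a b) s 1 (s.setReg r (s.reg a + s.reg b))
  | sub (r a b : ℕ) (s : State) : Exec (.sub r a b) s 1 (s.setReg r (s.reg a - s.reg b))
  | load (r A i : ℕ) (s : State) : Exec (.load r A i) s 1 (s.setReg r (s.arr A (s.reg i)))
  | store (A i r : ℕ) (s : State) : Exec (.store A i r) s 1 (s.setArr A (s.reg i) (s.reg r))
  | seq (p q : Prog) (s s₁ s₂ : State) (k l : ℕ) :
      Exec p s k s₁ → Exec q s₁ l s₂ → Exec (.seq p q) s (k + l) s₂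
  | ite_true (r : ℕ) (p q : Prog) (s s₁ : State) (k : ℕ) :
      s.reg r ≠ 0 → Exec p s k s₁ → Exec (.ite r p q) s (k + 1) s₁
  | ite_false (r : ℕ) (p q : Prog) (s s₁ : State) (k : ℕ) :
      s.reg r = 0 → Exec q s k s₁ → Exec (.ite r p q) s (k + 1) s₁
  | while_true (r : ℕ) (p : Prog) (s s₁ s₂ : State) (k l : ℕ) :
      s.reg r ≠ 0 → Exec p s k s₁ → Exec (.while r p) s₁ l s₂ →
      Exec (.while r p) s (k + l + 1) s₂
  | while_false (r : ℕ) (p : Prog) (s : State) :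
      s.reg r = 0 → Exec (.while r p) s 1 s

/-- The initial state on input `w`: the word `w` stands in array `0`, all the rest is `0`. -/
def init (w : List ℕ) : State where
  reg := fun _ => 0
  arr := fun A i => if A = 0 then w.getD i 0 else 0

/-- The state `s` has the word `w` as its output: `w` stands at the beginning of array `1`. -/
def HasOutput (s : State) (w : List ℕ) : Prop :=
  ∀ i, i < w.length → s.arr 1 i = w.getD i 0

end RAM

/-! The gates of the circuit form a tree hanging from the output, and only the literals are shared.
An occurrence of a literal is an edge of a graph of bounded genus, so by Euler's formula the
occurrences are linear in `n` once they can be seen as the edges of a bipartite minor with `O(n)`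
vertices. A circuit becomes accessible to this count after exhaustive application of local rules: a
gate with a single input is collapsed (`Collapsible.refines`), edges into dead gates are removed
(`Refines.clear_dead`), of two siblings with equal inputs one is detached
(`Refines.clear_duplicate`), and if a literal feeds a gate, a second appearance of it further below
is removed (`Refines.clear_below`). The last rule is sound because either the literal forces the
value of the upper gate, and then nothing below matters, or it has the neutral value, and then the
removed input is neutral too. In the graph without the output every rule is a sequence of deletions
and contractions, so the genus does not grow (`EmbedsInGenus.minor`).

In a reduced net a literal occurs at most once on a path (`Reduced.literal_unique`). This gives
every gate that has gates as inputs three different literals below it (`Reduced.three_literals`). A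
bipartite graph of bounded genus has roughly at most two edges per vertex, so objects with three
neighbours each are linearly many: this bounds the trees with three literals (`card_wide`) and the
lowest gates that do not feed the output (`card_inner`). The lowest gates that feed the output
directly and have just two literals are edges of a simple graph on the literals (`card_narrow`).
Hence the leaves of the gate forest number `O(n)`. Contracting chains of only children leaves `O(n)`
gates (`card_chainTop`), and no occurrence is lost thereby, because a chain is a path. Euler's
formula for this last minor is `card_occurrences`. Absence of zero-variables means that no literal
feeds the output itself.

The genus is treated by permutations: a map is a vertex permutation `ρ` and an edge involution `α`
on darts, and faces are the cycles of `ρ * α`. Deleting or contracting an edge multiplies by a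
transposition, which joins or splits cycles, and the Euler inequality `MapGenusLE` follows by
counting. Darts of removed edges stay as fixed points of `α`, so the dart set never changes.

For the running time, the rules are written in a language of loops that all run to the bound `n +
m`, where `m` is the number of gates. Its compilation to the machine takes a polynomial number of
steps (`exists_prog`). Each pass over all triples of positions removes an edge unless no rule
applies, hence `(n + m)²` passes suffice (`run_reduceSt`). Finally the gates that still contribute
are renumbered and printed (`run_outputSt`, `Enumerates.encode_circuit`). -/

set_option linter.unusedSectionVars false

/-! ### Cardinalities of quotients -/


namespace GraphGenus

open Equiv Equiv.Perm

section Quotients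

variable {D : Type*} [Finite D]

theorem card_quotient_le_of_le {r s : Setoid D} (h : r ≤ s) :
    Nat.card (Quotient s) ≤ Nat.card (Quotient r) := by
  refine Nat.card_le_card_of_surjective (Quotient.map' id fun x y hxy => h hxy) ?_
  rintro ⟨x⟩
  exact ⟨Quotient.mk _ x, rfl⟩

/-- A surjection between finite sets of equal size would be injective, but the classes of `a` and
`b` have the same image. -/
theorem card_quotient_lt_of_le {r s : Setoid D} (h : r ≤ s) {a b : D} (hs : s a b)
    (hr : ¬ r a b) : Nat.card (Quotient s) + 1 ≤ Nat.card (Quotient r) := by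
  have hsurj : Function.Surjective
      (Quotient.map' id fun x y hxy => h hxy : Quotient r → Quotient s) := by
    rintro ⟨x⟩
    exact ⟨Quotient.mk _ x, rfl⟩
  refine Nat.succ_le_of_lt (lt_of_le_of_ne (Nat.card_le_card_of_surjective _ hsurj) ?_)
  intro heq
  have hbij := (Nat.bijective_iff_surjective_and_card _).2 ⟨hsurj, heq.symm⟩
  have : (Quotient.mk r a) = Quotient.mk r b := hbij.1 (Quotient.sound hs)
  exact hr (Quotient.exact this)

/-- The equivalence relation obtained from `r` by joining the classes of `a` and `b`. -/
def joinClasses (r : Setoid D) (a b : D) : Setoid D where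
  r x y := r x y ∨ ((r x a ∨ r x b) ∧ (r y a ∨ r y b))
  iseqv := by
    refine ⟨fun x => Or.inl (r.refl x), ?_, ?_⟩
    · rintro x y (h | h)
      · exact Or.inl (r.symm h)
      · exact Or.inr h.symm
    · rintro x y z (h | h) (h' | h')
      · exact Or.inl (r.trans h h')
      · refine Or.inr ⟨?_, h'.2⟩
        rcases h'.1 with h1 | h1
        · exact Or.inl (r.trans h h1)
        · exact Or.inr (r.trans h h1)
      · refine Or.inr ⟨h.1, ?_⟩
        rcases h.2 with h1 | h1
        · exact Or.inl (r.trans (r.symm h') h1)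
        · exact Or.inr (r.trans (r.symm h') h1)
      · exact Or.inr ⟨h.1, h'.2⟩

/-- Only the classes of `a` and `b` are identified; sending the class of `a` to `none` restores
injectivity. -/
theorem card_quotient_le_joinClasses (r : Setoid D) (a b : D) :
    Nat.card (Quotient r) ≤ Nat.card (Quotient (joinClasses r a b)) + 1 := by
  classical
  rw [← Finite.card_option]
  have hle : r ≤ joinClasses r a b := fun x y hxy => Or.inl hxy
  let f : Quotient r → Option (Quotient (joinClasses r a b)) := fun c =>
    if c = Quotient.mk r a then none else some (Quotient.map' id (fun x y hxy => hle hxy) c)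
  refine Nat.card_le_card_of_injective f ?_
  rintro ⟨x⟩ ⟨y⟩ hxy
  change f (Quotient.mk r x) = f (Quotient.mk r y) at hxy
  change Quotient.mk r x = Quotient.mk r y
  simp only [f] at hxy
  split_ifs at hxy with h1 h2 h2
  · rw [h1, h2]
  · have h3 : joinClasses r a b x y := Quotient.exact (Option.some.inj hxy)
    rw [Quotient.eq] at h1 h2 ⊢
    rcases h3 with h3 | ⟨h3 | h3, h4 | h4⟩
    · exact h3
    · exact absurd h3 h1
    · exact absurd h3 h1
    · exact absurd h4 h2
    · exact r.trans h3 (r.symm h4)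

theorem card_quotient_le_succ {r s : Setoid D} (a b : D) (h : s ≤ joinClasses r a b) :
    Nat.card (Quotient r) ≤ Nat.card (Quotient s) + 1 :=
  (card_quotient_le_joinClasses r a b).trans (Nat.succ_le_succ (card_quotient_le_of_le h))

/-- If all points outside the range of `e` are singleton classes, they can be split off. -/
theorem card_quotient_split {D' : Type*} [Finite D'] (r : Setoid D) {e : D' → D}
    (h : ∀ x y, x ∉ Set.range e → r x y → x = y) :
    Nat.card (Quotient r) =
      Nat.card (Quotient (r.comap e)) + Nat.card {x // x ∉ Set.range e} := by
  classical
  rw [← Nat.card_sum]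
  refine (Nat.card_congr (Equiv.ofBijective (Sum.elim
    (Quotient.lift (s := r.comap e) (fun x => Quotient.mk r (e x))
      fun x y hxy => Quotient.sound hxy)
    (fun x : {x // x ∉ Set.range e} => Quotient.mk r x.1)) ⟨?_, ?_⟩)).symm
  · rintro (x | x) (y | y) hxy
    · induction x using Quotient.inductionOn
      induction y using Quotient.inductionOn
      rename_i x y
      have : r (e x) (e y) := Quotient.exact hxy
      exact congrArg Sum.inl (Quotient.sound this)
    · induction x using Quotient.inductionOn
      rename_i x
      have : r (e x) y.1 := Quotient.exact hxy
      exact absurd ⟨x, (h _ _ y.2 (r.symm this)).symm⟩ y.2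
    · induction y using Quotient.inductionOn
      rename_i y
      have : r x.1 (e y) := Quotient.exact hxy
      exact absurd ⟨y, (h _ _ x.2 this).symm⟩ x.2
    · have : r x.1 y.1 := Quotient.exact hxy
      exact congrArg Sum.inr (Subtype.ext (h _ _ x.2 this))
  · rintro ⟨x⟩
    by_cases hx : x ∈ Set.range e
    · obtain ⟨y, rfl⟩ := hx
      exact ⟨Sum.inl (Quotient.mk _ y), rfl⟩
    · exact ⟨Sum.inr ⟨x, hx⟩, rfl⟩

end Quotients

/-! ### Cycles of a permutation times a transposition -/

section Cycles

variable {D : Type*}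

/-- Powers are compositions of single steps and their inverses. Inclusions between cycle relations
and orbit relations are reduced to this one-step check. -/
theorem sameCycle_le_of_step {σ : Perm D} (s : Setoid D) (h : ∀ x, s x (σ x)) :
    SameCycle.setoid σ ≤ s := by
  rintro x y ⟨i, rfl⟩
  induction i using Int.induction_on with
  | zero => exact s.refl _
  | succ i ih =>
    rw [add_comm, zpow_add, zpow_one, Perm.mul_apply]
    exact s.trans ih (h _)
  | pred i ih =>
    refine s.trans ih (s.symm ?_)
    have := h ((σ ^ (-(i : ℤ) - 1)) x)
    rwa [← Perm.mul_apply, ← zpow_one_add, add_sub_cancel] at this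

variable [Finite D] [DecidableEq D]

/-- The first return of `b` to the set `{a, b}` decides whether multiplication by `swap a b` joins
or splits: until then, the new orbit of `a` follows the old orbit of `b` (`mul_swap_pow_apply`). -/
theorem exists_first_hit (σ : Perm D) (a b : D) : ∃ k, 0 < k ∧
    ((σ ^ k) b = a ∨ (σ ^ k) b = b) ∧ ∀ i, 0 < i → i < k → (σ ^ i) b ≠ a ∧ (σ ^ i) b ≠ b := by
  have hex : ∃ k, 0 < k ∧ ((σ ^ k) b = a ∨ (σ ^ k) b = b) :=
    ⟨orderOf σ, orderOf_pos σ, Or.inr (by rw [pow_orderOf_eq_one]; rfl)⟩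
  classical
  refine ⟨Nat.find hex, (Nat.find_spec hex).1, (Nat.find_spec hex).2, fun i hi hik => ?_⟩
  have := Nat.find_min hex hik
  push Not at this
  exact this hi

theorem mul_swap_pow_apply {σ : Perm D} {a b : D} {k : ℕ}
    (hk : ∀ i, 0 < i → i < k → (σ ^ i) b ≠ a ∧ (σ ^ i) b ≠ b) :
    ∀ i, 0 < i → i ≤ k → ((σ * swap a b) ^ i) a = (σ ^ i) b := by
  intro i hi
  induction i, hi using Nat.le_induction with
  | base => intro _; simp
  | succ i hi ih =>
    intro hik
    rw [pow_succ', Perm.mul_apply, ih (by omega), Perm.mul_apply,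
      swap_apply_of_ne_of_ne (hk i hi (by omega)).1 (hk i hi (by omega)).2, pow_succ',
      Perm.mul_apply]

theorem not_sameCycle_of_period {σ : Perm D} {b c : D} {k : ℕ} (hk : 0 < k)
    (hb : (σ ^ k) b = b) (h : ∀ i, i < k → (σ ^ i) b ≠ c) : ¬ SameCycle σ b c := by
  intro hs
  obtain ⟨i, hi⟩ := hs.exists_nat_pow_eq
  have hmul : ∀ j, (σ ^ (k * j)) b = b := by
    intro j
    induction j with
    | zero => simp
    | succ j ih => rw [Nat.mul_succ, pow_add, Perm.mul_apply, hb, ih]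
  rw [← Nat.mod_add_div i k, pow_add, Perm.mul_apply, hmul] at hi
  exact h _ (Nat.mod_lt _ hk) hi

/-- If `a` is on another cycle, the orbit of `b` returns to `b` first, and so the new orbit of `a`
reaches `b`. -/
theorem sameCycle_mul_swap {σ : Perm D} {a b : D} (h : ¬ SameCycle σ a b) :
    SameCycle (σ * swap a b) a b := by
  obtain ⟨k, hk, hkk | hkk, hmin⟩ := exists_first_hit σ a b
  · exact absurd (SameCycle.symm ⟨k, by simpa using hkk⟩) h
  · exact ⟨k, by simpa [hkk] using mul_swap_pow_apply hmin k hk le_rfl⟩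

/-- On a common cycle the orbit of `b` meets `a` first, so the new orbit of `a` closes up before it
reaches `b`. -/
theorem not_sameCycle_mul_swap {σ : Perm D} {a b : D} (hab : a ≠ b) (h : SameCycle σ a b) :
    ¬ SameCycle (σ * swap a b) a b := by
  obtain ⟨k, hk, hkk | hkk, hmin⟩ := exists_first_hit σ a b
  · have hp := mul_swap_pow_apply hmin
    refine not_sameCycle_of_period hk ((hp k hk le_rfl).trans hkk) fun i hi => ?_
    rcases Nat.eq_zero_or_pos i with rfl | hi0
    · simpa using hab
    · rw [hp i hi0 hi.le]
      exact (hmin i hi0 hi).2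
  · refine absurd h.symm (not_sameCycle_of_period hk hkk fun i hi => ?_)
    rcases Nat.eq_zero_or_pos i with rfl | hi0
    · simpa using hab.symm
    · exact (hmin i hi0 hi).1

theorem setoid_mul_swap_le_join (σ : Perm D) (a b : D) :
    SameCycle.setoid (σ * swap a b) ≤ joinClasses (SameCycle.setoid σ) a b := by
  refine sameCycle_le_of_step _ fun x => ?_
  by_cases hxa : x = a
  · subst hxa
    refine Or.inr ⟨Or.inl (SameCycle.refl _ _), Or.inr ?_⟩
    rw [Perm.mul_apply, swap_apply_left]
    exact sameCycle_apply_left.2 (SameCycle.refl _ _)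
  by_cases hxb : x = b
  · subst hxb
    refine Or.inr ⟨Or.inr (SameCycle.refl _ _), Or.inl ?_⟩
    rw [Perm.mul_apply, swap_apply_right]
    exact sameCycle_apply_left.2 (SameCycle.refl _ _)
  refine Or.inl ?_
  rw [Perm.mul_apply, swap_apply_of_ne_of_ne hxa hxb]
  exact sameCycle_apply_right.2 (SameCycle.refl _ _)

theorem setoid_mul_swap_le {σ : Perm D} {a b : D} (h : SameCycle σ a b) :
    SameCycle.setoid (σ * swap a b) ≤ SameCycle.setoid σ := by
  intro x y hxy
  rcases setoid_mul_swap_le_join σ a b hxy with h' | ⟨h1 | h1, h2 | h2⟩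
  · exact h'
  · exact SameCycle.trans h1 (SameCycle.symm h2)
  · exact SameCycle.trans h1 (SameCycle.trans h (SameCycle.symm h2))
  · exact SameCycle.trans h1 (SameCycle.trans h.symm (SameCycle.symm h2))
  · exact SameCycle.trans h1 (SameCycle.symm h2)

theorem le_setoid_mul_swap {σ : Perm D} {a b : D} (h : ¬ SameCycle σ a b) :
    SameCycle.setoid σ ≤ SameCycle.setoid (σ * swap a b) := by
  have := setoid_mul_swap_le (sameCycle_mul_swap h)
  rwa [mul_assoc, swap_mul_self, mul_one] at this

/-- The number of cycles of a permutation, fixed points included. -/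
noncomputable def cycleCount (σ : Perm D) : ℕ := Nat.card (Quotient (SameCycle.setoid σ))

theorem cycleCount_le_mul_swap (σ : Perm D) (a b : D) :
    cycleCount σ ≤ cycleCount (σ * swap a b) + 1 :=
  card_quotient_le_succ a b (setoid_mul_swap_le_join σ a b)

theorem cycleCount_lt_mul_swap {σ : Perm D} {a b : D} (hab : a ≠ b) (h : SameCycle σ a b) :
    cycleCount σ + 1 ≤ cycleCount (σ * swap a b) :=
  card_quotient_lt_of_le (setoid_mul_swap_le h) h (not_sameCycle_mul_swap hab h)

theorem swap_mul_eq_mul_swap (σ : Perm D) (a : D) :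
    swap a (σ a) * σ = σ * swap (σ⁻¹ a) a := by
  rw [mul_swap_eq_swap_mul]
  simp

/-- The product bypasses `a`, which becomes a fixed point and thus a cycle of its own. -/
theorem cycleCount_lt_swap_mul {σ : Perm D} {a : D} (h : σ a ≠ a) :
    cycleCount σ + 1 ≤ cycleCount (swap a (σ a) * σ) := by
  rw [swap_mul_eq_mul_swap]
  refine cycleCount_lt_mul_swap ?_ ?_
  · intro h'
    exact h (Perm.inv_eq_iff_eq.1 h').symm
  · exact ⟨1, by simp⟩

end Cycles

end GraphGenus

/-! ### Combinatorial maps with dummy darts -/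

namespace GraphGenus

open Equiv Equiv.Perm

section Maps

variable {D : Type*}

theorem sameCycle_iff_of_semiconj {D' : Type*} {σ : Perm D} {σ' : Perm D'} {e : D' → D}
    (he : Function.Injective e) (h : ∀ x, e (σ' x) = σ (e x)) (x y : D') :
    SameCycle σ' x y ↔ SameCycle σ (e x) (e y) := by
  have hinv : ∀ x, e (σ'⁻¹ x) = σ⁻¹ (e x) := fun x => by
    rw [Perm.eq_inv_iff_eq, ← h]
    simp
  have hz : ∀ (i : ℤ) (x : D'), e ((σ' ^ i) x) = (σ ^ i) (e x) := by
    intro i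
    induction i using Int.induction_on with
    | zero => simp
    | succ i ih => intro x; rw [zpow_add_one, zpow_add_one, Perm.mul_apply, Perm.mul_apply, ih, h]
    | pred i ih =>
      intro x; rw [zpow_sub_one, zpow_sub_one, Perm.mul_apply, Perm.mul_apply, ih, hinv]
  constructor
  · rintro ⟨i, rfl⟩
    exact ⟨i, (hz i x).symm⟩
  · rintro ⟨i, hi⟩
    exact ⟨i, he ((hz i x).trans hi)⟩

/-- The orbits of the group generated by `ρ` and `α`. -/
def orbitSetoid (ρ α : Perm D) : Setoid D := SameCycle.setoid ρ ⊔ SameCycle.setoid α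

theorem orbitSetoid_le {ρ α : Perm D} {s : Setoid D} (h₁ : ∀ x, s x (ρ x))
    (h₂ : ∀ x, s x (α x)) : orbitSetoid ρ α ≤ s :=
  sup_le (sameCycle_le_of_step s h₁) (sameCycle_le_of_step s h₂)

theorem orbitSetoid_left (ρ α : Perm D) (x : D) : orbitSetoid ρ α x (ρ x) :=
  (le_sup_left : SameCycle.setoid ρ ≤ orbitSetoid ρ α) (sameCycle_apply_right.2 (SameCycle.refl _ _))

theorem orbitSetoid_right (ρ α : Perm D) (x : D) : orbitSetoid ρ α x (α x) :=
  (le_sup_right : SameCycle.setoid α ≤ orbitSetoid ρ α)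
    (sameCycle_apply_right.2 (SameCycle.refl _ _))

variable [Fintype D] [DecidableEq D]

/-- The map with vertex permutation `ρ` and edge involution `α` has genus at most `g`.  Fixed points
of `α` are dummy darts, which belong to no edge. -/
def MapGenusLE (ρ α : Perm D) (g : ℕ) : Prop :=
  -- This is twice Euler's inequality `2c + E ≤ V + F + 2g`, as the support of `α` has two darts per
  -- edge. A dummy dart fixed by `ρ` adds 4 to both sides and is therefore harmless.
  4 * Nat.card (Quotient (orbitSetoid ρ α)) + α.support.card ≤
    2 * cycleCount ρ + 2 * cycleCount (ρ * α) + 4 * g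

theorem support_mul_swap_card {α : Perm D} (hα : ∀ x, α (α x) = x) {d : D} (hd : α d ≠ d) :
    (α * swap d (α d)).support.card + 2 = α.support.card := by
  have h : (α * swap d (α d)).support = (α.support.erase d).erase (α d) := by
    ext x
    simp only [mem_support, Finset.mem_erase, Perm.mul_apply]
    by_cases h1 : x = d
    · subst h1; simp [hα]
    by_cases h2 : x = α d
    · subst h2; simp
    rw [swap_apply_of_ne_of_ne h1 h2]
    simp [h1, h2]
  have h1 : d ∈ α.support := mem_support.2 hd
  have h2 : α d ∈ α.support.erase d :=
    Finset.mem_erase.2 ⟨hd, mem_support.2 (by rw [hα]; exact hd.symm)⟩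
  rw [h, ← Finset.card_erase_add_one h1, ← Finset.card_erase_add_one h2]

theorem mul_swap_apply_eq {α : Perm D} {d x : D} (h1 : x ≠ d) (h2 : x ≠ α d) :
    (α * swap d (α d)) x = α x := by
  rw [Perm.mul_apply, swap_apply_of_ne_of_ne h1 h2]

theorem orbitSetoid_le_of_mul_swap {ρ ρ' α : Perm D} (hα : ∀ x, α (α x) = x) {d : D}
    {s : Setoid D} (hs : orbitSetoid ρ' (α * swap d (α d)) ≤ s)
    (hρ : ∀ x, s x (ρ x)) (hd : s d (α d)) : orbitSetoid ρ α ≤ s := by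
  refine orbitSetoid_le hρ fun x => ?_
  by_cases h1 : x = d
  · subst h1; exact hd
  by_cases h2 : x = α d
  · subst h2; rw [hα]; exact s.symm hd
  · have := hs (orbitSetoid_right ρ' (α * swap d (α d)) x)
    rwa [mul_swap_apply_eq h1 h2] at this

/-- Deleting an edge does not increase the genus. -/
theorem MapGenusLE.delete {ρ α : Perm D} {g : ℕ} (h : MapGenusLE ρ α g)
    (hα : ∀ x, α (α x) = x) {d : D} (hd : α d ≠ d) :
    MapGenusLE ρ (α * swap d (α d)) g := by
  have hsupp := support_mul_swap_card hα hd
  unfold MapGenusLE at *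
  rw [← mul_assoc]
  -- If both darts lie on one face, the face splits, which pays for at most one new component.
  -- Otherwise two faces merge, and the merged face still joins the two ends, so no component is
  -- gained.
  by_cases hs : SameCycle (ρ * α) d (α d)
  · have h1 := cycleCount_lt_mul_swap hd.symm hs
    have h2 : Nat.card (Quotient (orbitSetoid ρ (α * swap d (α d)))) ≤
        Nat.card (Quotient (orbitSetoid ρ α)) + 1 := by
      refine card_quotient_le_succ d (α d) ?_
      refine orbitSetoid_le_of_mul_swap (ρ' := ρ) hα (fun x y hxy => Or.inl hxy)
        (fun x => Or.inl (orbitSetoid_left _ _ _)) ?_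
      exact Or.inr ⟨Or.inl (Setoid.refl' _ _), Or.inr (Setoid.refl' _ _)⟩
    omega
  · have h1 := cycleCount_le_mul_swap (ρ * α) d (α d)
    have h2 : Nat.card (Quotient (orbitSetoid ρ (α * swap d (α d)))) ≤
        Nat.card (Quotient (orbitSetoid ρ α)) := by
      refine card_quotient_le_of_le ?_
      refine orbitSetoid_le_of_mul_swap (ρ' := ρ) hα le_rfl (fun x => orbitSetoid_left _ _ _) ?_
      refine sameCycle_le_of_step (σ := ρ * α * swap d (α d)) _ (fun x => ?_)
        (sameCycle_mul_swap hs)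
      rw [mul_assoc, Perm.mul_apply]
      exact Setoid.trans' _ (orbitSetoid_right _ _ x) (orbitSetoid_left _ _ _)
    omega

/-- Contracting an edge that is not a loop does not increase the genus. -/
theorem MapGenusLE.contract {ρ α : Perm D} {g : ℕ} (h : MapGenusLE ρ α g)
    (hα : ∀ x, α (α x) = x) {d : D} (hd : ¬ SameCycle ρ d (α d)) :
    MapGenusLE (ρ * swap d (α d)) (α * swap d (α d)) g := by
  have hd' : α d ≠ d := fun h => hd (by rw [h])
  have hsupp := support_mul_swap_card hα hd'
  -- `α` exchanges `d` and `α d` and hence commutes with the transposition: the faces are unchanged,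
  -- while two vertices merge.
  have hcomm : ρ * swap d (α d) * (α * swap d (α d)) = ρ * α := by
    rw [mul_swap_eq_swap_mul α, hα, swap_comm (α d) d, mul_assoc, ← mul_assoc (swap d (α d)),
      swap_mul_self, one_mul]
  unfold MapGenusLE at *
  rw [hcomm]
  have h1 := cycleCount_le_mul_swap ρ d (α d)
  have h2 : Nat.card (Quotient (orbitSetoid (ρ * swap d (α d)) (α * swap d (α d)))) ≤
      Nat.card (Quotient (orbitSetoid ρ α)) := by
    refine card_quotient_le_of_le ?_
    have hle : SameCycle.setoid (ρ * swap d (α d)) ≤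
      orbitSetoid (ρ * swap d (α d)) (α * swap d (α d)) := le_sup_left
    refine orbitSetoid_le_of_mul_swap (ρ' := ρ * swap d (α d)) hα le_rfl (fun x => ?_) ?_
    · exact hle (le_setoid_mul_swap hd (sameCycle_apply_right.2 (SameCycle.refl _ _)))
    · exact hle (sameCycle_mul_swap hd)
  omega

/-- Cutting `a` out of its cycle yields one more vertex, one more face and at most one more
component, so both sides are balanced. Since `α` fixes `a`, the same transposition cuts `a` out of
its face. -/
theorem MapGenusLE.isolate {ρ α : Perm D} {g : ℕ} (h : MapGenusLE ρ α g) {a : D}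
    (ha : α a = a) (hρ : ρ a ≠ a) : MapGenusLE (swap a (ρ a) * ρ) α g := by
  unfold MapGenusLE at *
  have h1 := cycleCount_lt_swap_mul hρ
  have h2 : cycleCount (ρ * α) + 1 ≤ cycleCount (swap a (ρ a) * ρ * α) := by
    have := cycleCount_lt_swap_mul (σ := ρ * α) (a := a) (by rwa [Perm.mul_apply, ha])
    rwa [Perm.mul_apply, ha, ← mul_assoc] at this
  have h3 : Nat.card (Quotient (orbitSetoid (swap a (ρ a) * ρ) α)) ≤
      Nat.card (Quotient (orbitSetoid ρ α)) + 1 := by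
    refine card_quotient_le_succ a (ρ a) ?_
    refine orbitSetoid_le (fun x => ?_) fun x => Or.inl (orbitSetoid_right _ _ _)
    by_cases hx : x = a
    · subst hx
      exact Or.inr ⟨Or.inl (Setoid.refl' _ _), Or.inr (Setoid.refl' _ _)⟩
    have h4 := orbitSetoid_left (swap a (ρ a) * ρ) α x
    rw [Perm.mul_apply] at h4
    by_cases hxa : ρ x = a
    · rw [hxa, swap_apply_left] at h4
      rw [hxa]
      exact Or.inr ⟨Or.inr h4, Or.inl (Setoid.refl' _ _)⟩
    · rw [swap_apply_of_ne_of_ne hxa (fun h => hx (ρ.injective h))] at h4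
      exact Or.inl h4
  omega

theorem sameCycle_isolate {ρ : Perm D} {a : D} (hρ : ρ a ≠ a) {x y : D} (hx : x ≠ a)
    (hy : y ≠ a) : SameCycle (swap a (ρ a) * ρ) x y ↔ SameCycle ρ x y := by
  constructor
  · rw [swap_mul_eq_mul_swap]
    exact fun h => setoid_mul_swap_le ⟨1, by simp⟩ h
  · intro h
    -- The point `a` is represented by its successor; a step of `ρ` then becomes a step of the new
    -- permutation or no step at all.
    let f : D → D := fun x => if x = a then ρ a else x
    have key : SameCycle.setoid ρ ≤ (SameCycle.setoid (swap a (ρ a) * ρ)).comap f := by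
      refine sameCycle_le_of_step _ fun z => ?_
      change SameCycle _ (f z) (f (ρ z))
      by_cases hz : z = a
      · subst hz; simp only [f, if_pos, if_neg hρ]; exact SameCycle.refl _ _
      by_cases hza : ρ z = a
      · simp only [f, if_neg hz, hza, if_pos]
        refine ⟨1, by simp [hza]⟩
      · simp only [f, if_neg hz, if_neg hza]
        refine ⟨1, ?_⟩
        rw [zpow_one, Perm.mul_apply, swap_apply_of_ne_of_ne hza (fun h => hz (ρ.injective h))]
    have := key h
    change SameCycle _ (f x) (f y) at this
    simpa only [f, if_neg hx, if_neg hy] using this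

/-- All dummy darts can be isolated. -/
theorem MapGenusLE.exists_isolated {ρ α : Perm D} {g : ℕ} (h : MapGenusLE ρ α g) :
    ∃ ρ' : Perm D, MapGenusLE ρ' α g ∧ (∀ a, α a = a → ρ' a = a) ∧
      ∀ x y, α x ≠ x → α y ≠ y → (SameCycle ρ' x y ↔ SameCycle ρ x y) := by
  induction hk : (Finset.univ.filter fun a => α a = a ∧ ρ a ≠ a).card using
    Nat.strong_induction_on generalizing ρ with
  | _ k ih =>
    by_cases hex : ∃ a, α a = a ∧ ρ a ≠ a
    · obtain ⟨a, ha, hρ⟩ := hex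
      have hlt : (Finset.univ.filter fun b => α b = b ∧ (swap a (ρ a) * ρ) b ≠ b).card < k := by
        rw [← hk]
        refine Finset.card_lt_card ⟨fun b hb => ?_, fun hsub => ?_⟩
        · simp only [Finset.mem_filter, Finset.mem_univ, true_and] at hb ⊢
          refine ⟨hb.1, fun hb' => hb.2 ?_⟩
          have hba : b ≠ a := fun h => hρ (h ▸ hb')
          rw [Perm.mul_apply, hb', swap_apply_of_ne_of_ne hba]
          exact fun h => hba (ρ.injective (hb'.trans h))
        · have := hsub (Finset.mem_filter.2 ⟨Finset.mem_univ a, ha, hρ⟩)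
          rw [Finset.mem_filter] at this
          exact this.2.2 (by simp)
      obtain ⟨ρ', h1, h2, h3⟩ := ih _ hlt (h.isolate ha hρ) rfl
      refine ⟨ρ', h1, h2, fun x y hx hy => (h3 x y hx hy).trans (sameCycle_isolate hρ ?_ ?_)⟩
      · exact fun h => hx (h ▸ ha)
      · exact fun h => hy (h ▸ ha)
    · push Not at hex
      exact ⟨ρ, h, hex, fun x y _ _ => Iff.rfl⟩

end Maps

/-! ### Rotation systems as maps -/

section Graphs

variable {V : Type*} [Finite V] {G : SimpleGraph V}

instance : Finite G.Dart :=
  Finite.of_injective (fun d : G.Dart => d.toProd) SimpleGraph.Dart.toProd_injective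

theorem IsRotation.card_vertices {ρ : Perm G.Dart} (h : IsRotation G ρ) :
    Nat.card (Quotient (SameCycle.setoid ρ)) + Nat.card {v : V // ∀ w, ¬ G.Adj v w} =
      Nat.card V := by
  rw [← Nat.card_sum]
  refine Nat.card_congr (Equiv.ofBijective (Sum.elim
    (Quotient.lift (s := SameCycle.setoid ρ) (fun d : G.Dart => d.fst)
      fun d e hde => (h d e).1 hde)
    (fun v => v.1)) ⟨?_, ?_⟩)
  · rintro (x | x) (y | y) hxy
    · induction x using Quotient.inductionOn
      induction y using Quotient.inductionOn
      exact congrArg Sum.inl (Quotient.sound ((h _ _).2 hxy))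
    · induction x using Quotient.inductionOn
      rename_i x
      exact absurd ((show x.fst = y.1 from hxy) ▸ x.adj) (y.2 _)
    · induction y using Quotient.inductionOn
      rename_i y
      exact absurd ((show x.1 = y.fst from hxy) ▸ y.adj) (x.2 _)
    · exact congrArg Sum.inr (Subtype.ext hxy)
  · intro v
    by_cases hv : ∀ w, ¬ G.Adj v w
    · exact ⟨Sum.inr ⟨v, hv⟩, rfl⟩
    · push Not at hv
      obtain ⟨w, hw⟩ := hv
      exact ⟨Sum.inl (Quotient.mk _ ⟨(v, w), hw⟩), rfl⟩

theorem IsRotation.orbit_of_reachable {ρ : Perm G.Dart} (h : IsRotation G ρ) {u v : V}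
    (p : G.Walk u v) : ∀ d e : G.Dart, d.fst = u → e.fst = v →
      orbitSetoid ρ (dartRev G) d e := by
  have hle : SameCycle.setoid ρ ≤ orbitSetoid ρ (dartRev G) := le_sup_left
  induction p with
  | nil =>
    intro d e hd he
    exact hle ((h d e).2 (hd.trans he.symm))
  | cons hadj p ih =>
    rename_i u v w
    intro d e hd he
    let d' : G.Dart := ⟨(u, v), hadj⟩
    have h1 : orbitSetoid ρ (dartRev G) d d' := hle ((h d d').2 hd)
    have h2 : orbitSetoid ρ (dartRev G) d' (dartRev G d') := orbitSetoid_right _ _ _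
    exact Setoid.trans' _ h1 (Setoid.trans' _ h2 (ih _ e rfl he))

theorem IsRotation.card_components {ρ : Perm G.Dart} (h : IsRotation G ρ) :
    Nat.card (Quotient (orbitSetoid ρ (dartRev G))) + Nat.card {v : V // ∀ w, ¬ G.Adj v w} =
      Nat.card G.ConnectedComponent := by
  have hle : orbitSetoid ρ (dartRev G) ≤
      Setoid.ker (fun d : G.Dart => G.connectedComponentMk d.fst) := by
    refine orbitSetoid_le (fun d => ?_) fun d => ?_
    · change G.connectedComponentMk d.fst = G.connectedComponentMk (ρ d).fst
      rw [(h d (ρ d)).1 (sameCycle_apply_right.2 (SameCycle.refl _ _))]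
    · exact SimpleGraph.ConnectedComponent.sound (SimpleGraph.Adj.reachable d.adj)
  have hiso : ∀ {u v : V}, (∀ w, ¬ G.Adj u w) → G.Reachable u v → u = v := by
    rintro u v hu ⟨p⟩
    cases p with
    | nil => rfl
    | cons hadj _ => exact absurd hadj (hu _)
  rw [← Nat.card_sum]
  refine Nat.card_congr (Equiv.ofBijective (Sum.elim
    (Quotient.lift (s := orbitSetoid ρ (dartRev G))
      (fun d : G.Dart => G.connectedComponentMk d.fst) fun d e hde => hle hde)
    (fun v => G.connectedComponentMk v.1)) ⟨?_, ?_⟩)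
  · rintro (x | x) (y | y) hxy
    · induction x using Quotient.inductionOn
      induction y using Quotient.inductionOn
      obtain ⟨p⟩ := SimpleGraph.ConnectedComponent.exact hxy
      exact congrArg Sum.inl (Quotient.sound (h.orbit_of_reachable p _ _ rfl rfl))
    · induction x using Quotient.inductionOn
      rename_i x
      have := hiso y.2 (SimpleGraph.ConnectedComponent.exact hxy).symm
      exact absurd x.adj (this ▸ y.2 _)
    · induction y using Quotient.inductionOn
      rename_i y
      have := hiso x.2 (SimpleGraph.ConnectedComponent.exact hxy)
      exact absurd y.adj (this ▸ x.2 _)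
    · exact congrArg Sum.inr (Subtype.ext (hiso x.2 (SimpleGraph.ConnectedComponent.exact hxy)))
  · intro c
    induction c using SimpleGraph.ConnectedComponent.ind
    rename_i v
    by_cases hv : ∀ w, ¬ G.Adj v w
    · exact ⟨Sum.inr ⟨v, hv⟩, rfl⟩
    · push Not at hv
      obtain ⟨w, hw⟩ := hv
      exact ⟨Sum.inl (Quotient.mk _ ⟨(v, w), hw⟩), rfl⟩

theorem dartRev_ne (d : G.Dart) : dartRev G d ≠ d := SimpleGraph.Dart.symm_ne d

theorem dartRev_dartRev (d : G.Dart) : dartRev G (dartRev G d) = d :=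
  SimpleGraph.Dart.symm_involutive d

theorem card_support_dartRev [Fintype G.Dart] [DecidableEq G.Dart] :
    (dartRev G).support.card = 2 * Nat.card G.edgeSet := by
  classical
  have : Fintype V := Fintype.ofFinite V
  have h1 : (dartRev G).support = Finset.univ := by
    ext d; simp [dartRev_ne]
  have h2 : Nat.card G.Dart = 2 * G.edgeFinset.card :=
    (@Nat.card_eq_fintype_card _ (_)).trans (SimpleGraph.dart_card_eq_twice_card_edges G)
  rw [h1, Finset.card_univ, ← Nat.card_eq_fintype_card, h2, Nat.card_eq_fintype_card,
    ← SimpleGraph.edgeFinset_card]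

/-- Isolated vertices cancel in the Euler characteristic of a rotation system. -/
theorem IsRotation.euler_iff [Fintype G.Dart] [DecidableEq G.Dart] {ρ : Perm G.Dart}
    (h : IsRotation G ρ) (g : ℕ) :
    2 * Nat.card G.ConnectedComponent + Nat.card G.edgeSet ≤
      Nat.card V + faceCount G ρ + 2 * g ↔ MapGenusLE ρ (dartRev G) g := by
  unfold MapGenusLE faceCount cycleCount
  rw [card_support_dartRev, ← h.card_components, ← h.card_vertices]
  omega

end Graphs

end GraphGenus

/-! ### Minors -/

namespace GraphGenus

open Equiv Equiv.Perm

section Minors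

variable {W : Type*} [Finite W] {H : SimpleGraph W}

/-- A map whose edges are the edges of `H` and whose vertices are labelled accordingly gives a
rotation system of `H`. -/
theorem MapGenusLE.embedsInGenus {D : Type*} [Fintype D] [DecidableEq D] {ρ α : Perm D} {g : ℕ}
    (h : MapGenusLE ρ α g) {e : H.Dart → D} (he : Function.Injective e)
    (hα : ∀ d, α (e d) = e d.symm) (hfix : ∀ x, x ∉ Set.range e → α x = x)
    (hρ : ∀ d d', SameCycle ρ (e d) (e d') ↔ d.fst = d'.fst) : EmbedsInGenus H g := by
  classical
  have : Fintype H.Dart := Fintype.ofFinite _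
  -- Once the dummy darts are fixed points, the range of `e` is invariant and a rotation system of
  -- `H` can be read off.
  obtain ⟨ρ', hg, hiso, hsame⟩ := h.exists_isolated
  have hne : ∀ d, α (e d) ≠ e d := fun d hd =>
    SimpleGraph.Dart.symm_ne d (he ((hα d).symm.trans hd))
  have hrange : ∀ d, ρ' (e d) ∈ Set.range e := by
    intro d
    by_contra hd
    have h1 := hiso _ (hfix _ hd)
    exact hd ⟨d, (ρ'.injective h1).symm⟩
  choose f hf using hrange
  have hfinj : Function.Injective f := fun d d' hdd => by
    have := hf d
    rw [hdd, hf d'] at this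
    exact (he (ρ'.injective this)).symm
  let σ : Perm H.Dart := Equiv.ofBijective f (Finite.injective_iff_bijective.1 hfinj)
  have hσ : ∀ d, e (σ d) = ρ' (e d) := hf
  have hrev : ∀ d, e (dartRev H d) = α (e d) := fun d => (hα d).symm
  have hφ : ∀ d, e ((σ * dartRev H) d) = (ρ' * α) (e d) := fun d => by
    rw [Perm.mul_apply, hσ, hrev, Perm.mul_apply]
  -- Every dart outside the range of `e` is one cycle by itself, for `ρ'` as well as for `ρ' * α`;
  -- these contributions cancel against the orbits counted in `c3`.
  have hcount : ∀ {τ : Perm H.Dart} {τ' : Perm D}, (∀ d, e (τ d) = τ' (e d)) →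
      (∀ x, x ∉ Set.range e → τ' x = x) →
      cycleCount τ' = cycleCount τ + Nat.card {x // x ∉ Set.range e} := by
    intro τ τ' h1 h2
    unfold cycleCount
    rw [card_quotient_split (SameCycle.setoid τ') (e := e)]
    · congr 3
      ext d d'
      exact (sameCycle_iff_of_semiconj he h1 d d').symm
    · rintro x y hx ⟨i, rfl⟩
      exact (Perm.zpow_apply_eq_self_of_apply_eq_self (h2 x hx) i).symm
  have hrot : IsRotation H σ := fun d d' => by
    rw [sameCycle_iff_of_semiconj he hσ, hsame _ _ (hne d) (hne d'), hρ]
  refine ⟨σ, hrot, (hrot.euler_iff g).2 ?_⟩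
  have hout : ∀ x, x ∉ Set.range e → ρ' x = x := fun x hx => hiso x (hfix x hx)
  have c1 := hcount hσ hout
  have c2 := hcount hφ fun x hx => by rw [Perm.mul_apply, hfix x hx, hout x hx]
  have c3 : Nat.card (Quotient (orbitSetoid σ (dartRev H))) + Nat.card {x // x ∉ Set.range e} ≤
      Nat.card (Quotient (orbitSetoid ρ' α)) := by
    rw [card_quotient_split (orbitSetoid ρ' α) (e := e)]
    · refine Nat.add_le_add_right (card_quotient_le_of_le ?_) _
      let r : Setoid D :=
        { r := fun x y => x = y ∨ ∃ d d', e d = x ∧ e d' = y ∧ orbitSetoid σ (dartRev H) d d'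
          iseqv := by
            refine ⟨fun x => Or.inl rfl, ?_, ?_⟩
            · rintro x y (rfl | ⟨d, d', rfl, rfl, h⟩)
              · exact Or.inl rfl
              · exact Or.inr ⟨d', d, rfl, rfl, Setoid.symm' _ h⟩
            · rintro x y z (rfl | ⟨d, d', rfl, rfl, h⟩) (rfl | ⟨d1, d1', h1, rfl, h'⟩)
              · exact Or.inl rfl
              · exact Or.inr ⟨d1, d1', h1, rfl, h'⟩
              · exact Or.inr ⟨d, d', rfl, rfl, h⟩
              · have := he h1
                subst this
                exact Or.inr ⟨d, d1', rfl, rfl, Setoid.trans' _ h h'⟩ }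
      have hr : orbitSetoid ρ' α ≤ r := by
        refine orbitSetoid_le (fun x => ?_) fun x => ?_
        · by_cases hx : x ∈ Set.range e
          · obtain ⟨d, rfl⟩ := hx
            exact Or.inr ⟨d, σ d, rfl, hσ d, orbitSetoid_left _ _ _⟩
          · exact Or.inl (hout x hx).symm
        · by_cases hx : x ∈ Set.range e
          · obtain ⟨d, rfl⟩ := hx
            exact Or.inr ⟨d, dartRev H d, rfl, hrev d, orbitSetoid_right _ _ _⟩
          · exact Or.inl (hfix x hx).symm
      intro d d' hdd
      rcases hr hdd with h1 | ⟨d1, d2, h1, h2, h3⟩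
      · rw [he h1]
      · rw [← he h1, ← he h2]
        exact h3
    · intro x y hx hxy
      let r : Setoid D :=
        { r := fun x y => x = y ∨ (x ∈ Set.range e ∧ y ∈ Set.range e)
          iseqv := by
            refine ⟨fun x => Or.inl rfl, ?_, ?_⟩
            · rintro x y (rfl | h)
              · exact Or.inl rfl
              · exact Or.inr h.symm
            · rintro x y z (rfl | h) (rfl | h')
              · exact Or.inl rfl
              · exact Or.inr h'
              · exact Or.inr h
              · exact Or.inr ⟨h.1, h'.2⟩ }
      have hr : orbitSetoid ρ' α ≤ r := by
        refine orbitSetoid_le (fun x => ?_) fun x => ?_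
        · by_cases hx : x ∈ Set.range e
          · obtain ⟨d, rfl⟩ := hx
            exact Or.inr ⟨⟨d, rfl⟩, ⟨σ d, hσ d⟩⟩
          · exact Or.inl (hout x hx).symm
        · by_cases hx : x ∈ Set.range e
          · obtain ⟨d, rfl⟩ := hx
            exact Or.inr ⟨⟨d, rfl⟩, ⟨_, hrev d⟩⟩
          · exact Or.inl (hfix x hx).symm
      rcases hr hxy with h1 | h1
      · exact h1
      · exact absurd h1.1 hx
  have c4 : (dartRev H).support.card ≤ α.support.card := by
    refine Finset.card_le_card_of_injOn e (fun d _ => ?_) he.injOn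
    exact mem_support.2 (hne d)
  unfold MapGenusLE at *
  omega

/-- The inductive step of the minor argument: edges outside the range of `e` are contracted if they
join two vertices of the same label, and deleted otherwise. -/
theorem MapGenusLE.embedsInGenus_of_label {D : Type*} [Fintype D] [DecidableEq D] {g : ℕ}
    {e : H.Dart → D} (he : Function.Injective e) (q : D → Option W)
    (hq : ∀ d, q (e d) = some d.fst) (k : ℕ) : ∀ {ρ α : Perm D}, α.support.card ≤ k →
    MapGenusLE ρ α g → (∀ x, α (α x) = x) → (∀ d, α (e d) = e d.symm) →
    (∀ x, q (ρ x) = q x) →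
    (∀ s : Setoid D, (∀ x, s x (ρ x)) → (∀ x, q x ≠ none → q x = q (α x) → s x (α x)) →
      ∀ x y w, q x = some w → q y = some w → s x y) → EmbedsInGenus H g := by
  induction k with
  | zero =>
    intro ρ α hk h hinv hα hρ hconn
    have hfix : ∀ x, α x = x := by
      intro x
      by_contra hx
      have := Finset.card_pos.2 ⟨x, mem_support.2 hx⟩
      omega
    have hempty : ∀ d : H.Dart, False := fun d =>
      SimpleGraph.Dart.symm_ne d (he ((hα d).symm.trans (hfix _)))
    exact h.embedsInGenus he hα (fun x _ => hfix x) fun d => (hempty d).elim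
  | succ k ih =>
    intro ρ α hk h hinv hα hρ hconn
    by_cases hex : ∃ d, α d ≠ d ∧ d ∉ Set.range e
    · obtain ⟨d, hd, hde⟩ := hex
      have hde' : α d ∉ Set.range e := by
        rintro ⟨c, hc⟩
        refine hde ⟨c.symm, ?_⟩
        rw [← hα, hc, hinv]
      have hsupp := support_mul_swap_card hinv hd
      have hval : ∀ x, x ≠ d → x ≠ α d → (α * swap d (α d)) x = α x := fun x h1 h2 =>
        mul_swap_apply_eq h1 h2
      have hval1 : (α * swap d (α d)) d = d := by simp [hinv]
      have hval2 : (α * swap d (α d)) (α d) = α d := by simp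
      have hinv' : ∀ x, (α * swap d (α d)) ((α * swap d (α d)) x) = x := by
        intro x
        by_cases h1 : x = d
        · subst h1; rw [hval1, hval1]
        by_cases h2 : x = α d
        · subst h2; rw [hval2, hval2]
        rw [hval x h1 h2, hval (α x), hinv]
        · rintro rfl; exact h2 (hinv x).symm
        · exact fun h => h1 (α.injective h)
      have hα' : ∀ c, (α * swap d (α d)) (e c) = e c.symm := by
        intro c
        rw [hval, hα]
        · rintro rfl; exact hde ⟨c, rfl⟩
        · exact fun h => hde' ⟨c, h⟩
      -- Connectivity of the label classes is expressed by all equivalence relations closed under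
      -- `ρ` and under edges inside a label. In this form it passes to the smaller map as soon as
      -- each such relation still joins `d` to `α d` whenever they have the same label.
      have hcond : ∀ s : Setoid D, (q d ≠ none → q d = q (α d) → s d (α d)) →
          (∀ x, q x ≠ none → q x = q ((α * swap d (α d)) x) → s x ((α * swap d (α d)) x)) →
          ∀ x, q x ≠ none → q x = q (α x) → s x (α x) := by
        intro s hs hs' x hx hx'
        by_cases h1 : x = d
        · subst h1; exact hs hx hx'
        by_cases h2 : x = α d
        · subst h2
          rw [hinv] at hx' ⊢
          exact s.symm (hs (hx' ▸ hx) hx'.symm)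
        · have := hs' x hx
          rw [hval x h1 h2] at this
          exact this hx'
      -- Only an edge inside a label that joins different cycles is contracted. An edge between
      -- labels, an unlabelled edge or a loop is irrelevant for connectivity and is deleted.
      by_cases hc : q d ≠ none ∧ q d = q (α d) ∧ ¬ SameCycle ρ d (α d)
      · obtain ⟨-, hc2, hc3⟩ := hc
        refine ih (by omega) (h.contract hinv hc3) hinv' hα' (fun x => ?_) ?_
        · rw [Perm.mul_apply, hρ]
          by_cases h1 : x = d
          · subst h1; rw [swap_apply_left, hc2]
          by_cases h2 : x = α d
          · subst h2; rw [swap_apply_right, hc2]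
          rw [swap_apply_of_ne_of_ne h1 h2]
        · intro s hs1 hs2
          have hle := sameCycle_le_of_step s hs1
          refine hconn s (fun x => hle (le_setoid_mul_swap hc3
            (sameCycle_apply_right.2 (SameCycle.refl _ _)))) (hcond s ?_ hs2)
          exact fun _ _ => hle (sameCycle_mul_swap hc3)
      · refine ih (by omega) (h.delete hinv hd) hinv' hα' hρ ?_
        intro s hs1 hs2
        refine hconn s hs1 (hcond s (fun h1 h2 => ?_) hs2)
        by_contra h3
        exact hc ⟨h1, h2, fun h4 => h3 (sameCycle_le_of_step s hs1 h4)⟩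
    · push Not at hex
      -- Only edges of `H` are left, and their ends carry different labels. Connectivity must
      -- therefore come from `ρ` alone: darts of `H` with the same label lie on one cycle.
      refine h.embedsInGenus he hα (fun x hx => ?_) fun d d' => ⟨fun h1 => ?_, fun h1 => ?_⟩
      · by_contra h1
        exact hx (hex x h1)
      · have : SameCycle.setoid ρ ≤ Setoid.ker q :=
          sameCycle_le_of_step _ fun x => (hρ x).symm
        have h2 : q (e d) = q (e d') := this h1
        rw [hq, hq] at h2
        exact Option.some.inj h2
      · refine hconn (SameCycle.setoid ρ) (fun x => sameCycle_apply_right.2 (SameCycle.refl _ _))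
          (fun x hx hx' => ?_) (e d) (e d') d.fst (hq d) ((hq d').trans (by rw [h1]))
        by_cases h2 : α x = x
        · rw [h2]
        · obtain ⟨c, rfl⟩ := hex x h2
          rw [hα, hq, hq] at hx'
          exact absurd (Option.some.inj hx') c.fst_ne_snd

/-- The genus does not increase under taking minors: `q` maps the vertices of `G` to the vertices
of `H` they are contracted to (or deletes them). -/
theorem EmbedsInGenus.minor {V : Type*} [Finite V] {G : SimpleGraph V} {g : ℕ}
    (h : EmbedsInGenus G g) (q : V → Option W) (ctr : W → V)
    (hconn : ∀ v w, q v = some w →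
      Relation.ReflTransGen (fun a b => G.Adj a b ∧ q a = some w ∧ q b = some w) v (ctr w))
    (hedge : ∀ w w', H.Adj w w' → ∃ u v, G.Adj u v ∧ q u = some w ∧ q v = some w') :
    EmbedsInGenus H g := by
  classical
  have : Fintype G.Dart := Fintype.ofFinite _
  obtain ⟨ρ, hρ, hle⟩ := h
  rw [hρ.euler_iff] at hle
  -- The chosen darts must respect reversal. A total asymmetric relation selects, for each edge of
  -- `H`, the direction in which the dart is chosen freely; the other direction gets its reverse.
  have hlin : ∃ r : W → W → Prop, (∀ a b, a ≠ b → (r a b ∨ r b a)) ∧ ∀ a b, r a b → ¬ r b a := by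
    refine ⟨WellOrderingRel, fun a b hab => ?_, fun a b h1 h2 => ?_⟩
    · rcases trichotomous_of WellOrderingRel a b with h | h | h
      · exact Or.inl h
      · exact absurd h hab
      · exact Or.inr h
    · exact asymm_of WellOrderingRel h1 h2
  obtain ⟨r, hr1, hr2⟩ := hlin
  have hch : ∀ d : H.Dart, ∃ c : G.Dart, q c.fst = some d.fst ∧ q c.snd = some d.snd := by
    intro d
    obtain ⟨u, v, huv, hu, hv⟩ := hedge _ _ d.adj
    exact ⟨⟨(u, v), huv⟩, hu, hv⟩
  choose c hc1 hc2 using hch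
  let e : H.Dart → G.Dart := fun d => if r d.fst d.snd then c d else (c d.symm).symm
  have he1 : ∀ d, q (e d).fst = some d.fst := by
    intro d
    by_cases hd : r d.fst d.snd
    · simp only [e, if_pos hd, hc1]
    · simp only [e, if_neg hd]
      exact hc2 d.symm
  have he2 : ∀ d, q (e d).snd = some d.snd := by
    intro d
    by_cases hd : r d.fst d.snd
    · simp only [e, if_pos hd, hc2]
    · simp only [e, if_neg hd]
      exact hc1 d.symm
  have he : Function.Injective e := by
    intro d d' hdd
    have h1 := he1 d
    have h2 := he2 d
    rw [hdd, he1] at h1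
    rw [hdd, he2] at h2
    exact SimpleGraph.Dart.ext _ _ (Prod.ext (Option.some.inj h1).symm (Option.some.inj h2).symm)
  have hsymm : ∀ d, dartRev G (e d) = e d.symm := by
    intro d
    change (e d).symm = e d.symm
    by_cases hd : r d.fst d.snd
    · have hd' : ¬ r d.symm.fst d.symm.snd := hr2 _ _ hd
      simp only [e, if_pos hd, if_neg hd', SimpleGraph.Dart.symm_symm]
    · have hd' : r d.symm.fst d.symm.snd := (hr1 _ _ d.fst_ne_snd).resolve_left hd
      simp only [e, if_neg hd, if_pos hd', SimpleGraph.Dart.symm_symm]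
  refine MapGenusLE.embedsInGenus_of_label he (fun d => q d.fst) he1 _ le_rfl hle
    dartRev_dartRev hsymm (fun d => ?_) ?_
  · rw [(hρ d (ρ d)).1 (sameCycle_apply_right.2 (SameCycle.refl _ _))]
  · intro s hs1 hs2
    have hfst : ∀ d d' : G.Dart, d.fst = d'.fst → s d d' := fun d d' hdd =>
      sameCycle_le_of_step s hs1 ((hρ d d').2 hdd)
    have hpath : ∀ (u v : V) (w : W), Relation.ReflTransGen
        (fun a b => G.Adj a b ∧ q a = some w ∧ q b = some w) u v →
        ∀ d d' : G.Dart, d.fst = u → d'.fst = v → s d d' := by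
      intro u v w huv
      induction huv using Relation.ReflTransGen.head_induction_on with
      | refl => exact fun d d' hd hd' => hfst d d' (hd.trans hd'.symm)
      | head hab hrest ih =>
        rename_i a b
        intro d d' hd hd'
        obtain ⟨hadj, ha, hb⟩ := hab
        let c : G.Dart := ⟨(a, b), hadj⟩
        have h1 : s d c := hfst d c hd
        have h2 : s c (dartRev G c) := by
          refine hs2 c ?_ ?_
          · change q a ≠ none
            rw [ha]; simp
          · change q a = q b
            rw [ha, hb]
        exact s.trans h1 (s.trans h2 (ih _ d' rfl hd'))
    intro x y w hx hy
    have hxy : Relation.ReflTransGen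
        (fun a b => G.Adj a b ∧ q a = some w ∧ q b = some w) x.fst y.fst := by
      refine (hconn _ _ hx).trans ?_
      refine Relation.ReflTransGen.mono (fun a b hab => ?_) _ _ (hconn _ _ hy).swap
      exact ⟨hab.1.symm, hab.2.2, hab.2.1⟩
    exact hpath _ _ w hxy x y rfl rfl

end Minors

/-! ### Existence of rotation systems -/

/-- The finite set of darts at each vertex carries a cyclic permutation, and these are glued
together. -/
theorem exists_isRotation {V : Type*} [Finite V] (G : SimpleGraph V) :
    ∃ ρ : Perm G.Dart, IsRotation G ρ := by
  classical
  have : Fintype G.Dart := Fintype.ofFinite _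
  have hex := fun v : V => (Finset.univ.filter fun d : G.Dart => d.fst = v).exists_cycleOn
  choose c hc _ using hex
  have hfib : ∀ (d : G.Dart) (v : V), d.fst = v → (c v d).fst = v := by
    intro d v hd
    have := ((hc v).apply_mem_iff (x := d)).2 (by simpa using hd)
    simpa using this
  let f : G.Dart → G.Dart := fun d => c d.fst d
  have hfst : ∀ d, (f d).fst = d.fst := fun d => hfib d _ rfl
  have hinj : Function.Injective f := by
    intro d e hde
    have h1 : d.fst = e.fst := by rw [← hfst d, hde, hfst]
    simp only [f, h1] at hde
    exact (c e.fst).injective hde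
  let ρ : Perm G.Dart := Equiv.ofBijective f (Finite.injective_iff_bijective.1 hinj)
  have hρ : ∀ d, ρ d = c d.fst d := fun d => rfl
  refine ⟨ρ, fun d e => ⟨fun h => ?_, fun h => ?_⟩⟩
  · exact sameCycle_le_of_step (Setoid.ker fun d : G.Dart => d.fst) (fun x => (hfst x).symm) h
  · obtain ⟨i, hi⟩ := ((hc d.fst).2 (x := d) (y := e) (by simp) (by simp [h])).exists_nat_pow_eq
    have hpow : ∀ j : ℕ, (ρ ^ j) d = (c d.fst ^ j) d ∧ ((ρ ^ j) d).fst = d.fst := by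
      intro j
      induction j with
      | zero => simp
      | succ j ih =>
        rw [pow_succ', pow_succ', Perm.mul_apply, Perm.mul_apply, ← ih.1]
        refine ⟨by rw [hρ, ih.2], ?_⟩
        exact (hfst _).trans ih.2
    exact ⟨i, by rw [zpow_natCast, (hpow i).1, hi]⟩

/-- Any rotation system satisfies the inequality for large `g`, so the infimum is over a nonempty
set and is attained. -/
theorem embedsInGenus_genus {V : Type*} [Finite V] (G : SimpleGraph V) :
    EmbedsInGenus G (genus G) := by
  obtain ⟨ρ, hρ⟩ := exists_isRotation G
  have : {g : ℕ | EmbedsInGenus G g}.Nonempty :=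
    ⟨2 * Nat.card G.ConnectedComponent + Nat.card G.edgeSet, ρ, hρ, by omega⟩
  exact Nat.sInf_mem this

/-! ### Edge bounds -/

section EdgeBounds

variable {V : Type*} [Finite V] {G : SimpleGraph V}

/-- If every face that is not the boundary of a single edge has length at least `k`, then the
number of edges is bounded by Euler's formula. -/
theorem edge_bound_of_face_length {k g : ℕ} (hk : 2 ≤ k) (h : EmbedsInGenus G g)
    (hface : ∀ φ : Perm G.Dart, (∀ d, (φ d).fst = d.snd) → ∀ d, φ (φ d) ≠ d →
      ∃ s : Finset G.Dart, s.card = k ∧ ∀ e ∈ s, SameCycle φ d e) :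
    (k - 2) * Nat.card G.edgeSet ≤ k * Nat.card V + 2 * k * g := by
  classical
  have : Fintype G.Dart := Fintype.ofFinite _
  obtain ⟨ρ, hρ, hle⟩ := h
  rw [hρ.euler_iff] at hle
  unfold MapGenusLE at hle
  set φ := ρ * dartRev G with hφdef
  have hρfst : ∀ d, (ρ d).fst = d.fst := fun d =>
    ((hρ d (ρ d)).1 (sameCycle_apply_right.2 (SameCycle.refl _ _))).symm
  have hφ : ∀ d, (φ d).fst = d.snd := fun d => hρfst _
  have hV : cycleCount ρ ≤ Nat.card V := by
    rw [← hρ.card_vertices]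
    exact Nat.le_add_right _ _
  have hE := card_support_dartRev (G := G)
  have hcard : Fintype.card G.Dart = 2 * Nat.card G.edgeSet := by
    rw [← hE, ← Finset.card_univ]
    congr 1
    ext d; simp [dartRev_ne]
  have : Fintype (Quotient (SameCycle.setoid φ)) := Fintype.ofFinite _
  have : Fintype (Quotient (orbitSetoid ρ (dartRev G))) := Fintype.ofFinite _
  -- a face of length two is a component with a single edge
  have hshort : ∀ d, φ (φ d) = d → φ d = dartRev G d := by
    intro d hd
    have h1 : (φ d).snd = d.fst := by rw [← hφ (φ d), hd]
    exact SimpleGraph.Dart.ext _ _ (Prod.ext (hφ d) h1)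
  have hshort1 : ∀ d, φ (φ d) = d → ρ d = d ∧ ρ (dartRev G d) = dartRev G d := by
    intro d hd
    have h1 := hshort d hd
    refine ⟨?_, by rw [← h1]; rw [hφdef, Perm.mul_apply] at h1 ⊢; rw [h1, h1]⟩
    rw [h1, hφdef, Perm.mul_apply, dartRev_dartRev] at hd
    exact hd
  have hshort2 : ∀ d e, φ (φ d) = d → orbitSetoid ρ (dartRev G) d e → e = d ∨ e = dartRev G d := by
    intro d e hd hde
    let r : Setoid G.Dart := Setoid.ker fun x => decide (x = d ∨ x = dartRev G d)
    have hr : orbitSetoid ρ (dartRev G) ≤ r := by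
      refine orbitSetoid_le (fun x => ?_) fun x => ?_
      · change decide _ = decide _
        rw [decide_eq_decide]
        obtain ⟨h1, h2⟩ := hshort1 d hd
        constructor
        · rintro (rfl | rfl)
          · exact Or.inl h1
          · exact Or.inr h2
        · rintro (h | h)
          · exact Or.inl (ρ.injective (h.trans h1.symm))
          · exact Or.inr (ρ.injective (h.trans h2.symm))
      · change decide _ = decide _
        rw [decide_eq_decide]
        constructor
        · rintro (rfl | rfl)
          · exact Or.inr rfl
          · exact Or.inl (dartRev_dartRev d)
        · rintro (h | h)
          · exact Or.inr (by rw [← h, dartRev_dartRev])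
          · exact Or.inl ((dartRev G).injective h)
    have h1 : decide (d = d ∨ d = dartRev G d) = decide (e = d ∨ e = dartRev G d) := hr hde
    rw [decide_eq_decide] at h1
    exact h1.1 (Or.inl rfl)
  -- Faces of length two lie in different components. Their deficit `k - 2` in the sum of the face
  -- lengths is absorbed by the number of components in Euler's inequality.
  let short : Finset (Quotient (SameCycle.setoid φ)) :=
    Finset.univ.filter fun c => ∃ d, Quotient.mk _ d = c ∧ φ (φ d) = d
  have hshortcard : short.card ≤ Nat.card (Quotient (orbitSetoid ρ (dartRev G))) := by
    rw [Nat.card_eq_fintype_card, ← Finset.card_univ]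
    have hle' : SameCycle.setoid φ ≤ orbitSetoid ρ (dartRev G) := by
      refine sameCycle_le_of_step _ fun x => ?_
      rw [hφdef, Perm.mul_apply]
      exact Setoid.trans' _ (orbitSetoid_right _ _ x) (orbitSetoid_left _ _ _)
    refine Finset.card_le_card_of_injOn (Quotient.map' id fun x y hxy => hle' hxy)
      (fun _ _ => Finset.mem_coe.2 (Finset.mem_univ _)) ?_
    intro c hc c' hc' hcc
    obtain ⟨d, rfl, hd⟩ := (Finset.mem_filter.1 hc).2
    obtain ⟨d', rfl, hd'⟩ := (Finset.mem_filter.1 hc').2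
    rcases hshort2 d d' hd (Quotient.exact hcc) with rfl | rfl
    · rfl
    · rw [← hshort d hd]
      exact Quotient.sound (sameCycle_apply_right.2 (SameCycle.refl _ _))
  let fib : Quotient (SameCycle.setoid φ) → Finset G.Dart := fun c =>
    Finset.univ.filter fun d => Quotient.mk _ d = c
  have hsum : ∑ c, (fib c).card = Fintype.card G.Dart := by
    rw [← Finset.card_univ]
    exact (Finset.card_eq_sum_card_fiberwise (f := fun d => Quotient.mk (SameCycle.setoid φ) d)
      (t := Finset.univ) fun _ _ => Finset.mem_coe.2 (Finset.mem_univ _)).symm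
  have hfib : ∀ c, k ≤ (fib c).card + if c ∈ short then k - 2 else 0 := by
    intro c
    obtain ⟨d, rfl⟩ := Quotient.exists_rep c
    by_cases hd : φ (φ d) = d
    · have hmem : Quotient.mk (SameCycle.setoid φ) d ∈ short :=
        Finset.mem_filter.2 ⟨Finset.mem_univ _, d, rfl, hd⟩
      rw [if_pos hmem]
      have h2 : 2 ≤ (fib (Quotient.mk _ d)).card := by
        rw [← Finset.card_pair (dartRev_ne d)]
        refine Finset.card_le_card fun x hx => ?_
        rw [Finset.mem_insert, Finset.mem_singleton] at hx
        refine Finset.mem_filter.2 ⟨Finset.mem_univ _, ?_⟩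
        rcases hx with rfl | rfl
        · rw [← hshort d hd]
          exact Quotient.sound (sameCycle_apply_left.2 (SameCycle.refl _ _))
        · rfl
      omega
    · obtain ⟨s, hs, hsd⟩ := hface φ hφ d hd
      have : k ≤ (fib (Quotient.mk _ d)).card := by
        rw [← hs]
        refine Finset.card_le_card fun x hx => ?_
        exact Finset.mem_filter.2 ⟨Finset.mem_univ _, Quotient.sound (hsd x hx).symm⟩
      omega
  have hF : k * cycleCount φ ≤ 2 * Nat.card G.edgeSet +
      (k - 2) * Nat.card (Quotient (orbitSetoid ρ (dartRev G))) := by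
    have h1 := Finset.sum_le_sum fun c (_ : c ∈ Finset.univ) => hfib c
    rw [Finset.sum_add_distrib, hsum, Finset.sum_const, smul_eq_mul, Finset.card_univ, hcard,
      Finset.sum_ite_mem, Finset.univ_inter, Finset.sum_const, smul_eq_mul] at h1
    have h2 := Nat.mul_le_mul_left (k - 2) hshortcard
    rw [cycleCount, Nat.card_eq_fintype_card, mul_comm k]
    rw [mul_comm (k - 2) short.card] at h2
    omega
  obtain ⟨j, rfl⟩ := Nat.exists_eq_add_of_le hk
  rw [hE] at hle
  rw [Nat.add_sub_cancel_left] at hF ⊢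
  nlinarith [Nat.mul_le_mul_left (2 + j) hle, Nat.mul_le_mul_left (2 + j) hV]

/-- No dart is its own successor on a face, so a face that does not close after two steps has three
different darts. -/
theorem edge_bound {g : ℕ} (h : EmbedsInGenus G g) :
    Nat.card G.edgeSet ≤ 3 * Nat.card V + 6 * g := by
  classical
  have := edge_bound_of_face_length (k := 3) (by norm_num) h ?_
  · simpa using this
  intro φ hφ d hd
  have h1 : ∀ e, φ e ≠ e := fun e he => by
    have := hφ e
    rw [he] at this
    exact e.fst_ne_snd this
  refine ⟨{d, φ d, φ (φ d)}, ?_, ?_⟩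
  · exact Finset.card_eq_three.2 ⟨_, _, _, (h1 d).symm, hd.symm, (h1 _).symm, rfl⟩
  · intro e he
    simp only [Finset.mem_insert, Finset.mem_singleton] at he
    rcases he with rfl | rfl | rfl
    · exact SameCycle.refl _ _
    · exact ⟨1, by simp⟩
    · exact ⟨2, rfl⟩

/-- The colours alternate along a face, which excludes length three; a face that is not of length
two has at least four darts. -/
theorem edge_bound_of_bipartite {g : ℕ} (h : EmbedsInGenus G g) (col : V → Bool)
    (hcol : ∀ u v, G.Adj u v → col u ≠ col v) :
    Nat.card G.edgeSet ≤ 2 * Nat.card V + 4 * g := by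
  classical
  have := edge_bound_of_face_length (k := 4) (by norm_num) h ?_
  · omega
  intro φ hφ d hd
  have hflip : ∀ e, col (φ e).fst = !col e.fst := fun e => by
    rw [hφ]
    have := hcol _ _ e.adj
    revert this
    cases col e.fst <;> cases col e.snd <;> simp
  have h1 : ∀ e, φ e ≠ e := fun e he => by
    have := hflip e
    rw [he] at this
    simp at this
  have h2 : φ (φ (φ d)) ≠ d := fun he => by
    have := hflip (φ (φ d))
    rw [he, hflip, hflip] at this
    simp at this
  have h3 : φ (φ (φ d)) ≠ φ d := fun he => hd (φ.injective he)
  refine ⟨{d, φ d, φ (φ d), φ (φ (φ d))}, ?_, ?_⟩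
  · rw [Finset.card_insert_of_notMem, Finset.card_eq_three.2 ⟨_, _, _, (h1 _).symm, h3.symm,
      (h1 _).symm, rfl⟩]
    simp [h2.symm, hd.symm, (h1 d).symm]
  · intro e he
    simp only [Finset.mem_insert, Finset.mem_singleton] at he
    rcases he with rfl | rfl | rfl | rfl
    · exact SameCycle.refl _ _
    · exact ⟨1, by simp⟩
    · exact ⟨2, rfl⟩
    · exact ⟨3, rfl⟩

/-- The bound for bipartite minors: the incidences of a relation `R` between `A` and `B` that is
realised by contracting connected parts of `G`. -/
theorem card_relation_le {A B : Type*} [Finite A] [Finite B] {g : ℕ} (h : EmbedsInGenus G g)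
    (R : A → B → Prop) (q : V → Option (A ⊕ B)) (ctr : A ⊕ B → V)
    (hconn : ∀ v w, q v = some w →
      Relation.ReflTransGen (fun a b => G.Adj a b ∧ q a = some w ∧ q b = some w) v (ctr w))
    (hedge : ∀ a b, R a b → ∃ u v, G.Adj u v ∧ q u = some (Sum.inl a) ∧ q v = some (Sum.inr b)) :
    Nat.card {p : A × B // R p.1 p.2} ≤ 2 * (Nat.card A + Nat.card B) + 4 * g := by
  classical
  let H : SimpleGraph (A ⊕ B) :=
    { Adj := fun x y => (∃ a b, R a b ∧ x = Sum.inl a ∧ y = Sum.inr b) ∨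
        ∃ a b, R a b ∧ y = Sum.inl a ∧ x = Sum.inr b
      symm := ⟨fun x y hxy => hxy.symm⟩
      loopless := ⟨by rintro x (⟨a, b, -, rfl, h⟩ | ⟨a, b, -, rfl, h⟩) <;> simp at h⟩ }
  have hH : EmbedsInGenus H g := by
    refine h.minor q ctr hconn ?_
    rintro w w' (⟨a, b, hR, rfl, rfl⟩ | ⟨a, b, hR, rfl, rfl⟩)
    · exact hedge a b hR
    · obtain ⟨u, v, huv, hu, hv⟩ := hedge a b hR
      exact ⟨v, u, huv.symm, hv, hu⟩
  have hb := edge_bound_of_bipartite hH Sum.isLeft (by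
    rintro u v (⟨a, b, -, rfl, rfl⟩ | ⟨a, b, -, rfl, rfl⟩) <;> simp)
  rw [Nat.card_sum] at hb
  refine le_trans ?_ hb
  refine Nat.card_le_card_of_injective
    (fun p : {p : A × B // R p.1 p.2} => (⟨s(Sum.inl p.1.1, Sum.inr p.1.2),
      Or.inl ⟨_, _, p.2, rfl, rfl⟩⟩ : H.edgeSet)) ?_
  rintro ⟨⟨a, b⟩, h1⟩ ⟨⟨a', b'⟩, h2⟩ heq
  have h3 : s((Sum.inl a : A ⊕ B), Sum.inr b) = s(Sum.inl a', Sum.inr b') := congrArg Subtype.val heq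
  simpa using h3

end EdgeBounds

end GraphGenus

/-! ### Nets: the circuits as they occur during the reduction -/

/-- A network of gates.  In contrast to a circuit, gates that do not contribute to the output may
have indegree `0`. -/
@[ext] structure Net (L Γ : Type) where
  kind : Γ → GateKind
  edge : L ⊕ Γ → Γ → Bool
  out : Γ

namespace Net

variable {L Γ : Type} (N : Net L Γ)

/-- `g` feeds into the gate `h`. -/
def Child (g h : Γ) : Prop := N.edge (Sum.inr g) h = true

/-- The value of a gate of `N` whose inputs have the values `S`. -/
def GateValue (S : L ⊕ Γ → Prop) (g : Γ) : Prop :=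
  match N.kind g with
  | GateKind.and => ∀ v, N.edge v g = true → S v
  | GateKind.or => ∃ v, N.edge v g = true ∧ S v

/-- The values of the vertices under a truth assignment. -/
inductive Holds (τ : L → Bool) : L ⊕ Γ → Prop
  | lit (i : L) : τ i = false → Holds τ (Sum.inl i)
  | andGate (g : Γ) : N.kind g = GateKind.and →
      (∀ v, N.edge v g = true → Holds τ v) → Holds τ (Sum.inr g)
  | orGate (g : Γ) (v : L ⊕ Γ) : N.kind g = GateKind.or →
      N.edge v g = true → Holds τ v → Holds τ (Sum.inr g)

theorem holds_lit {τ : L → Bool} {i : L} : N.Holds τ (Sum.inl i) ↔ τ i = false :=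
  ⟨fun h => by cases h; assumption, Holds.lit i⟩

theorem holds_gate {τ : L → Bool} {g : Γ} :
    N.Holds τ (Sum.inr g) ↔ N.GateValue (N.Holds τ) g := by
  unfold GateValue
  constructor
  · intro h
    cases h with
    | andGate _ hk h => rw [hk]; exact h
    | orGate _ v hk he h => rw [hk]; exact ⟨v, he, h⟩
  · intro h
    cases hk : N.kind g with
    | and => rw [hk] at h; exact Holds.andGate g hk h
    | or => rw [hk] at h; obtain ⟨v, he, hv⟩ := h; exact Holds.orGate g v hk he hv

/-- There is a directed path of length `k` from `v` to the output. -/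
inductive Path : ℕ → L ⊕ Γ → Prop
  | output : Path 0 (Sum.inr N.out)
  | step (k : ℕ) (v : L ⊕ Γ) (g : Γ) : N.edge v g = true → Path k (Sum.inr g) → Path (k + 1) v

/-- The underlying graph without the edges into the output gate. -/
def graph : SimpleGraph (L ⊕ Γ) :=
  SimpleGraph.fromRel (fun v w => ∃ g, w = Sum.inr g ∧ g ≠ N.out ∧ N.edge v g = true)

/-- The structural conditions that are preserved by the reduction. -/
structure Inv : Prop where
  out_and : N.kind N.out = GateKind.and
  child_unique : ∀ {g h h'}, N.Child g h → N.Child g h' → h = h'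
  alternating : ∀ {g h}, N.Child g h → N.kind g ≠ N.kind h
  acyclic : ∀ g, ¬ Relation.TransGen N.Child g g
  out_top : ∀ g, ¬ N.Child N.out g
  indegree_pos : ∀ g, (g = N.out ∨ ∃ h, N.Child g h) → ∃ v, N.edge v g = true

variable {N}

theorem kind_eq_of_ne {a b c : GateKind} (h₁ : a ≠ b) (h₂ : b ≠ c) : a = c := by
  cases a <;> cases b <;> cases c <;> simp_all

theorem Inv.ne_of_child (hN : N.Inv) {g h : Γ} (hgh : N.Child g h) : g ≠ h := by
  rintro rfl
  exact hN.acyclic _ (Relation.TransGen.single hgh)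

section Finite

variable [Finite Γ]

theorem wellFounded_of_acyclic {r : Γ → Γ → Prop} (h : ∀ g, ¬ Relation.TransGen r g g) :
    WellFounded r := by
  have : IsTrans Γ (Relation.TransGen r) := ⟨fun _ _ _ => Relation.TransGen.trans⟩
  have : Std.Irrefl (Relation.TransGen r) := ⟨h⟩
  exact Subrelation.wf Relation.TransGen.single
    (Finite.wellFounded_of_trans_of_irrefl (Relation.TransGen r))

theorem Inv.wf_child (hN : N.Inv) : WellFounded N.Child := wellFounded_of_acyclic hN.acyclic

theorem Inv.wf_parent (hN : N.Inv) : WellFounded (Function.swap N.Child) :=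
  wellFounded_of_acyclic fun g hg => hN.acyclic g (Relation.transGen_swap.1 hg)

theorem gateValue_congr {M : Net L Γ} {S T : L ⊕ Γ → Prop} {g : Γ} (hk : M.kind g = N.kind g)
    (he : ∀ v, M.edge v g = N.edge v g) (hS : ∀ v, N.edge v g = true → (S v ↔ T v)) :
    M.GateValue S g ↔ N.GateValue T g := by
  unfold GateValue
  rw [hk]
  simp only [he]
  cases N.kind g with
  | and => exact forall_congr' fun v => imp_congr_right fun h => hS v h
  | or => exact exists_congr fun v => and_congr_right fun h => hS v h

/-- The values of a set `R` of vertices closed under taking inputs are determined by the gate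
equations. -/
theorem holds_unique (hN : WellFounded N.Child) {τ : L → Bool} {S R : L ⊕ Γ → Prop}
    (hR : ∀ v g, R (Sum.inr g) → N.edge v g = true → R v)
    (hlit : ∀ i, S (Sum.inl i) ↔ τ i = false)
    (hgate : ∀ g, R (Sum.inr g) → (S (Sum.inr g) ↔ N.GateValue S g)) :
    ∀ v, R v → (S v ↔ N.Holds τ v) := by
  have key : ∀ g, R (Sum.inr g) → (S (Sum.inr g) ↔ N.Holds τ (Sum.inr g)) := by
    intro g
    induction g using hN.induction with
    | _ g ih =>
      intro hg
      rw [hgate g hg, holds_gate]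
      refine gateValue_congr rfl (fun _ => rfl) fun v hv => ?_
      cases v with
      | inl i => rw [hlit, holds_lit]
      | inr a => exact ih a hv (hR _ _ hg hv)
  intro v hv
  cases v with
  | inl i => rw [hlit, holds_lit]
  | inr g => exact key g hv

end Finite

/-! ### The order of reductions -/

section Reduction

variable [Fintype L] [Fintype Γ]

/-- The number of edges. -/
def edgeCount (N : Net L Γ) : ℕ :=
  (Finset.univ.filter fun p : (L ⊕ Γ) × Γ => N.edge p.1 p.2 = true).card

/-- `M` is a valid replacement for `N`. -/
structure Refines (N M : Net L Γ) : Prop where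
  inv : M.Inv
  kind_eq : M.kind = N.kind
  out_eq : M.out = N.out
  equiv : ∀ τ, N.Holds τ (Sum.inr N.out) ↔ M.Holds τ (Sum.inr M.out)
  path : ∀ k v, M.Path k v → ∃ k', k ≤ k' ∧ N.Path k' v
  genus : ∀ g, GraphGenus.EmbedsInGenus N.graph g → GraphGenus.EmbedsInGenus M.graph g
  count : M = N ∨ M.edgeCount < N.edgeCount

theorem Refines.refl (hN : N.Inv) : N.Refines N where
  inv := hN
  kind_eq := rfl
  out_eq := rfl
  equiv _ := Iff.rfl
  path k _ h := ⟨k, le_rfl, h⟩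
  genus _ h := h
  count := Or.inl rfl

theorem Refines.trans {N M K : Net L Γ} (h₁ : N.Refines M) (h₂ : M.Refines K) : N.Refines K where
  inv := h₂.inv
  kind_eq := h₂.kind_eq.trans h₁.kind_eq
  out_eq := h₂.out_eq.trans h₁.out_eq
  equiv τ := (h₁.equiv τ).trans (h₂.equiv τ)
  path k v h := by
    obtain ⟨k', hk', h'⟩ := h₂.path k v h
    obtain ⟨k'', hk'', h''⟩ := h₁.path k' v h'
    exact ⟨k'', hk'.trans hk'', h''⟩
  genus g h := h₂.genus g (h₁.genus g h)
  count := by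
    rcases h₁.count with h | h
    · exact h ▸ h₂.count
    · rcases h₂.count with h' | h'
      · exact Or.inr (h' ▸ h)
      · exact Or.inr (h'.trans h)

theorem Refines.edgeCount_le {N M : Net L Γ} (h : N.Refines M) : M.edgeCount ≤ N.edgeCount := by
  rcases h.count with h | h
  · rw [h]
  · exact h.le

/-- If a composition of two reductions changes nothing, neither does each of them. -/
theorem Refines.eq_of_trans_eq {N M K : Net L Γ} (h₁ : N.Refines M) (h₂ : M.Refines K)
    (h : K = N) : M = N := by
  rcases h₁.count with h' | h'
  · exact h'
  · have := h₂.edgeCount_le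
    rw [h] at this
    omega

/-! ### Removing an edge -/

variable [DecidableEq L] [DecidableEq Γ]

/-- Set the edge from `a` to `b`. -/
def setEdge (N : Net L Γ) (a : L ⊕ Γ) (b : Γ) (x : Bool) : Net L Γ :=
  { N with edge := fun v g => if v = a ∧ g = b then x else N.edge v g }

theorem clear_edge {a v : L ⊕ Γ} {b g : Γ} :
    (N.setEdge a b false).edge v g = true ↔ N.edge v g = true ∧ ¬ (v = a ∧ g = b) := by
  by_cases h : v = a ∧ g = b
  · simp [setEdge, h]
  · simp only [setEdge, h, if_false, not_false_eq_true, and_true]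

theorem clear_edge_of_ne {a v : L ⊕ Γ} {b g : Γ} {x : Bool} (h : ¬ (v = a ∧ g = b)) :
    (N.setEdge a b x).edge v g = N.edge v g := by
  simp [setEdge, h]

theorem gateValue_setEdge {a : L ⊕ Γ} {b g : Γ} {x : Bool} {S T : L ⊕ Γ → Prop} (h : g ≠ b)
    (hS : ∀ v, N.edge v g = true → (S v ↔ T v)) :
    N.GateValue S g ↔ (N.setEdge a b x).GateValue T g := by
  refine Iff.symm (gateValue_congr (N := N) (M := N.setEdge a b x) rfl (fun v => ?_)
    fun v hv => (hS v hv).symm)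
  exact clear_edge_of_ne fun h' => h h'.2

theorem clear_path {a : L ⊕ Γ} {b : Γ} {k : ℕ} {v : L ⊕ Γ}
    (h : (N.setEdge a b false).Path k v) : N.Path k v := by
  induction h with
  | output => exact Path.output
  | step k v g he _ ih => exact Path.step k v g (clear_edge.1 he).1 ih

/-- Apart from equivalence, everything survives the deletion of an edge. The condition `hb` protects
`indegree_pos`: either `b` keeps an input, or `b` is dead and needs none. -/
theorem Refines.clear (hN : N.Inv) {a : L ⊕ Γ} {b : Γ} (hab : N.edge a b = true)
    (hb : (∃ v, v ≠ a ∧ N.edge v b = true) ∨ (b ≠ N.out ∧ ∀ h, ¬ N.Child b h))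
    (hequiv : ∀ τ, N.Holds τ (Sum.inr N.out) ↔
      (N.setEdge a b false).Holds τ (Sum.inr N.out)) :
    N.Refines (N.setEdge a b false) where
  inv :=
    { out_and := hN.out_and
      child_unique := fun h h' => hN.child_unique (clear_edge.1 h).1 (clear_edge.1 h').1
      alternating := fun h => hN.alternating (clear_edge.1 h).1
      acyclic := fun g hg => hN.acyclic g
        (Relation.TransGen.mono (fun _ _ h => (clear_edge.1 h).1) _ _ hg)
      out_top := fun g h => hN.out_top g (clear_edge.1 h).1
      indegree_pos := by
        intro g hg
        have hg' : g = N.out ∨ ∃ h, N.Child g h := by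
          rcases hg with h | ⟨h, hh⟩
          · exact Or.inl h
          · exact Or.inr ⟨h, (clear_edge.1 hh).1⟩
        by_cases hgb : g = b
        · subst hgb
          rcases hb with ⟨v, hva, hv⟩ | ⟨h1, h2⟩
          · exact ⟨v, clear_edge.2 ⟨hv, fun h => hva h.1⟩⟩
          · rcases hg' with h | ⟨h, hh⟩
            · exact absurd h h1
            · exact absurd hh (h2 h)
        · obtain ⟨v, hv⟩ := hN.indegree_pos g hg'
          exact ⟨v, clear_edge.2 ⟨hv, fun h => hgb h.2⟩⟩ }
  kind_eq := rfl
  out_eq := rfl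
  equiv := hequiv
  path k v h := ⟨k, le_rfl, clear_path h⟩
  genus g h := by
    refine h.minor some id (fun v w hv => ?_) fun w w' hww => ⟨w, w', ?_, rfl, rfl⟩
    · rw [Option.some.inj hv]; exact Relation.ReflTransGen.refl
    · simp only [graph, SimpleGraph.fromRel_adj] at hww ⊢
      refine ⟨hww.1, ?_⟩
      rcases hww.2 with ⟨g, h1, h2, h3⟩ | ⟨g, h1, h2, h3⟩
      · exact Or.inl ⟨g, h1, h2, (clear_edge.1 h3).1⟩
      · exact Or.inr ⟨g, h1, h2, (clear_edge.1 h3).1⟩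
  count := by
    refine Or.inr (Finset.card_lt_card ⟨fun p hp => ?_, fun hsub => ?_⟩)
    · simp only [Finset.mem_filter, Finset.mem_univ, true_and] at hp ⊢
      exact (clear_edge.1 hp).1
    · have := hsub (Finset.mem_filter.2 ⟨Finset.mem_univ (a, b), hab⟩)
      rw [Finset.mem_filter] at this
      exact (clear_edge.1 this.2).2 ⟨rfl, rfl⟩

theorem Refines.wf_clear (hN : N.Inv) (a : L ⊕ Γ) (b : Γ) :
    WellFounded (N.setEdge a b false).Child :=
  Subrelation.wf (fun h => (clear_edge.1 h).1) hN.wf_child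

/-- Removing an edge into a dead gate. -/
theorem Refines.clear_dead (hN : N.Inv) {a : L ⊕ Γ} {b : Γ} (hab : N.edge a b = true)
    (hb : b ≠ N.out) (hb' : ∀ h, ¬ N.Child b h) : N.Refines (N.setEdge a b false) := by
  refine Refines.clear hN hab (Or.inr ⟨hb, hb'⟩) fun τ => ?_
  -- Values are compared away from `b`; this set is closed under taking inputs because `b` feeds no
  -- gate.
  refine holds_unique (Refines.wf_clear hN a b) (S := N.Holds τ) (R := fun v => v ≠ Sum.inr b)
    ?_ (fun i => holds_lit N) ?_ _ ?_
  · rintro v g hg hv rfl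
    exact hb' g (clear_edge.1 hv).1
  · intro g hg
    rw [holds_gate]
    exact gateValue_setEdge (fun h => hg (by rw [h])) fun _ _ => Iff.rfl
  · exact fun h => hb (Sum.inr.inj h).symm

/-- Removing an input whose value equals that of another input. -/
theorem Refines.clear_duplicate (hN : N.Inv) {a a' b : Γ} (haa : a ≠ a') (ha : N.Child a b)
    (ha' : N.Child a' b) (hsame : ∀ v, N.edge v a = N.edge v a') :
    N.Refines (N.setEdge (Sum.inr a) b false) := by
  have hk : N.kind a = N.kind a' :=
    kind_eq_of_ne (hN.alternating ha) (hN.alternating ha').symm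
  refine Refines.clear hN ha (Or.inl ⟨Sum.inr a', fun h => haa (Sum.inr.inj h).symm, ha'⟩)
    fun τ => ?_
  have hval : N.Holds τ (Sum.inr a) ↔ N.Holds τ (Sum.inr a') := by
    rw [holds_gate, holds_gate]
    unfold GateValue
    rw [hk]
    simp only [hsame]
  refine holds_unique (Refines.wf_clear hN _ b) (S := N.Holds τ) (R := fun _ => True)
    (fun _ _ _ _ => trivial) (fun i => holds_lit N) (fun g _ => ?_) _ trivial
  rw [holds_gate]
  by_cases hg : g = b
  · subst hg
    unfold GateValue
    change _ ↔ match N.kind g with | GateKind.and => _ | GateKind.or => _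
    have hc : (N.setEdge (Sum.inr a) g false).edge (Sum.inr a') g = true :=
      clear_edge.2 ⟨ha', fun h => haa (Sum.inr.inj h.1).symm⟩
    cases N.kind g with
    | and =>
      refine ⟨fun h v hv => h v (clear_edge.1 hv).1, fun h v hv => ?_⟩
      by_cases hva : v = Sum.inr a
      · subst hva
        exact hval.2 (h _ hc)
      · exact h v (clear_edge.2 ⟨hv, fun h => hva h.1⟩)
    | or =>
      refine ⟨?_, fun ⟨v, hv, h⟩ => ⟨v, (clear_edge.1 hv).1, h⟩⟩
      rintro ⟨v, hv, h⟩
      by_cases hva : v = Sum.inr a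
      · subst hva
        exact ⟨_, hc, hval.1 h⟩
      · exact ⟨v, clear_edge.2 ⟨hv, fun h => hva h.1⟩, h⟩
  · exact gateValue_setEdge hg fun _ _ => Iff.rfl

/-- Removing an edge that becomes constant below a gate `g` with the literal `x` as an input: if `x`
does not already determine the value of `g`, then the input `a` of `b` is neutral. -/
theorem Refines.clear_below (hN : N.Inv) {x : L} {g : Γ} (hx : N.edge (Sum.inl x) g = true)
    {a : L ⊕ Γ} {b : Γ} (hab : N.edge a b = true) (hbg : Relation.ReflTransGen N.Child b g)
    (hk : N.kind b = N.kind g) (hne : ¬ (a = Sum.inl x ∧ b = g))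
    (ha : a = Sum.inl x ∨ ∃ c, a = Sum.inr c ∧ N.edge (Sum.inl x) c = true)
    (hb : ∃ v, v ≠ a ∧ N.edge v b = true) : N.Refines (N.setEdge a b false) := by
  refine Refines.clear hN hab (Or.inl hb) fun τ => ?_
  have hwf := Refines.wf_clear hN a b
  have hx' : (N.setEdge a b false).edge (Sum.inl x) g = true :=
    clear_edge.2 ⟨hx, fun h => hne ⟨h.1.symm, h.2.symm⟩⟩
  -- Here the literal forces the value of `g`. The function `S` takes the new values strictly below
  -- `g` and the old ones elsewhere; it satisfies the gate equation at `g` because the edge from `x`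
  -- to `g` is not the removed one.
  by_cases hctl : (N.kind g = GateKind.or ↔ τ x = false)
  · let below : L ⊕ Γ → Prop := fun v => ∃ c, v = Sum.inr c ∧ Relation.TransGen N.Child c g
    let S : L ⊕ Γ → Prop := fun v =>
      (below v ∧ (N.setEdge a b false).Holds τ v) ∨ (¬ below v ∧ N.Holds τ v)
    have hS1 : ∀ v, below v → (S v ↔ (N.setEdge a b false).Holds τ v) := fun v hv => by
      simp [S, hv]
    have hS2 : ∀ v, ¬ below v → (S v ↔ N.Holds τ v) := fun v hv => by simp [S, hv]
    have hlit : ∀ i, ¬ below (Sum.inl i) := by rintro i ⟨c, hc, -⟩; cases hc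
    have hgg : ¬ below (Sum.inr g) := by
      rintro ⟨c, hc, h⟩
      cases hc
      exact hN.acyclic g h
    have key := holds_unique hwf (τ := τ) (S := S) (R := fun _ => True)
      (fun _ _ _ _ => trivial) (fun i => by rw [hS2 _ (hlit i), holds_lit]) ?_
      (Sum.inr N.out) trivial
    · rw [← key, hS2]
      rintro ⟨c, hc, h⟩
      cases hc
      obtain ⟨c, h1, -⟩ := Relation.TransGen.head'_iff.1 h
      exact hN.out_top _ h1
    intro c _
    by_cases hc : below (Sum.inr c)
    · rw [hS1 _ hc, holds_gate]
      refine gateValue_congr rfl (fun _ => rfl) fun v hv => ?_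
      cases v with
      | inl i => rw [hS2 _ (hlit i), holds_lit, holds_lit]
      | inr d =>
        refine (hS1 _ ⟨d, rfl, ?_⟩).symm
        obtain ⟨c', hc', h⟩ := hc
        cases hc'
        exact Relation.TransGen.head (clear_edge.1 hv).1 h
    · rw [hS2 _ hc]
      by_cases hcg : c = g
      · subst hcg
        rw [holds_gate]
        unfold GateValue
        change _ ↔ match N.kind c with | GateKind.and => _ | GateKind.or => _
        cases hkc : N.kind c with
        | and =>
          have hτ : ¬ τ x = false := fun h => by rw [hctl.2 h] at hkc; cases hkc
          refine ⟨fun h => absurd ((holds_lit N).1 (h _ hx)) hτ, fun h => ?_⟩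
          exact absurd ((holds_lit N).1 ((hS2 _ (hlit x)).1 (h _ hx'))) hτ
        | or =>
          have hτ := hctl.1 hkc
          refine ⟨fun _ => ⟨_, hx', (hS2 _ (hlit x)).2 ((holds_lit N).2 hτ)⟩, fun _ => ?_⟩
          exact ⟨_, hx, (holds_lit N).2 hτ⟩
      · have hcb : c ≠ b := by
          rintro rfl
          rcases Relation.reflTransGen_iff_eq_or_transGen.1 hbg with h | h
          · exact hcg h.symm
          · exact hc ⟨c, rfl, h⟩
        rw [holds_gate]
        refine gateValue_setEdge hcb fun v hv => (hS2 v ?_).symm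
        rintro ⟨d, rfl, hd⟩
        obtain ⟨e, h1, h2⟩ := Relation.TransGen.head'_iff.1 hd
        have := hN.child_unique h1 hv
        subst this
        rcases Relation.reflTransGen_iff_eq_or_transGen.1 h2 with h | h
        · exact hcg h.symm
        · exact hc ⟨e, rfl, h⟩
  -- Otherwise the literal is neutral for gates of the type of `g`, which is also the type of `b`.
  -- If `a` is a gate, it has the opposite type, and the literal forces it to exactly this neutral
  -- value.
  · refine holds_unique hwf (S := N.Holds τ) (R := fun _ => True)
      (fun _ _ _ _ => trivial) (fun i => holds_lit N) (fun c _ => ?_) _ trivial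
    rw [holds_gate]
    by_cases hcb : c = b
    · subst hcb
      unfold GateValue
      change _ ↔ match N.kind c with | GateKind.and => _ | GateKind.or => _
      cases hkc : N.kind c with
      | and =>
        have hτ : τ x = false := by
          rw [← hk, hkc] at hctl; simpa using hctl
        have haval : N.Holds τ a := by
          rcases ha with rfl | ⟨d, rfl, hd⟩
          · exact (holds_lit N).2 hτ
          · have hkd : N.kind d = GateKind.or := by
              have := hN.alternating hab
              rw [hkc] at this
              cases h : N.kind d
              · exact absurd h this
              · rfl
            exact Holds.orGate d _ hkd hd ((holds_lit N).2 hτ)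
        refine ⟨fun h v hv => h v (clear_edge.1 hv).1, fun h v hv => ?_⟩
        by_cases hva : v = a
        · exact hva ▸ haval
        · exact h v (clear_edge.2 ⟨hv, fun h => hva h.1⟩)
      | or =>
        have hτ : ¬ τ x = false := by
          rw [← hk, hkc] at hctl; simpa using hctl
        have haval : ¬ N.Holds τ a := by
          rcases ha with rfl | ⟨d, rfl, hd⟩
          · rwa [holds_lit]
          · have hkd : N.kind d = GateKind.and := by
              have := hN.alternating hab
              rw [hkc] at this
              cases h : N.kind d
              · rfl
              · exact absurd h this
            rw [holds_gate, GateValue, hkd]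
            exact fun h => hτ ((holds_lit N).1 (h _ hd))
        refine ⟨?_, fun ⟨v, hv, h⟩ => ⟨v, (clear_edge.1 hv).1, h⟩⟩
        rintro ⟨v, hv, h⟩
        exact ⟨v, clear_edge.2 ⟨hv, fun h' => haval (h'.1 ▸ h)⟩, h⟩
    · exact gateValue_setEdge hcb fun _ _ => Iff.rfl

end Reduction

end Net

namespace Net

variable {L Γ : Type} [Fintype L] [Fintype Γ] [DecidableEq L] [DecidableEq Γ] {N : Net L Γ}

/-! ### Collapsing a gate with a single input -/

/-- The vertices that take the place of `u` when `u` is merged into a gate of its own type: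
a literal stays, a gate is replaced by its inputs. -/
def expand (N : Net L Γ) (u v : L ⊕ Γ) : Bool :=
  match u with
  | Sum.inl i => decide (v = Sum.inl i)
  | Sum.inr c => N.edge v c

/-- Remove the gate `g` on the path `u → g → h`. -/
def collapse (N : Net L Γ) (u : L ⊕ Γ) (g h : Γ) : Net L Γ :=
  { N with
    edge := fun v w =>
      if w = h then (N.edge v h && !decide (v = Sum.inr g)) || N.expand u v
      else if w = g ∨ Sum.inr w = u then false else N.edge v w }

theorem collapse_edge_top {u v : L ⊕ Γ} {g h : Γ} : (N.collapse u g h).edge v h = true ↔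
    (N.edge v h = true ∧ v ≠ Sum.inr g) ∨ N.expand u v = true := by
  simp [collapse]

theorem collapse_edge {u v : L ⊕ Γ} {g h w : Γ} (hw : w ≠ h) :
    (N.collapse u g h).edge v w = true ↔ w ≠ g ∧ Sum.inr w ≠ u ∧ N.edge v w = true := by
  simp only [collapse, if_neg hw]
  split_ifs with h1
  · simp only [false_iff]
    tauto
  · tauto

/-- The situation in which a gate can be collapsed. -/
structure Collapsible (N : Net L Γ) (u : L ⊕ Γ) (g h : Γ) : Prop where
  inv : N.Inv
  edge : N.edge u g = true
  child : N.Child g h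
  unique : ∀ v, N.edge v g = true → v = u

section Collapse

variable {u : L ⊕ Γ} {g h : Γ}

theorem Collapsible.expand_trans (hc : N.Collapsible u g h) {a : Γ}
    (ha : N.expand u (Sum.inr a) = true) :
    ∃ c, u = Sum.inr c ∧ N.Child a c ∧ N.Child c g := by
  cases u with
  | inl i => simp [expand] at ha
  | inr c => exact ⟨c, rfl, ha, hc.edge⟩

/-- A new edge between gates stands for the path `a → c → g → h`, so the collapsed net inherits
acyclicity. -/
theorem Collapsible.child_trans (hc : N.Collapsible u g h) {a b : Γ}
    (hab : (N.collapse u g h).Child a b) : Relation.TransGen N.Child a b := by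
  unfold Child at hab
  by_cases hb : b = h
  · subst hb
    rcases collapse_edge_top.1 hab with h1 | h1
    · exact Relation.TransGen.single h1.1
    · obtain ⟨c, -, h2, h3⟩ := hc.expand_trans h1
      exact ((Relation.TransGen.single h2).tail h3).tail hc.child
  · exact Relation.TransGen.single ((collapse_edge hb).1 hab).2.2

theorem Collapsible.transGen (hc : N.Collapsible u g h) {a b : Γ}
    (hab : Relation.TransGen (N.collapse u g h).Child a b) : Relation.TransGen N.Child a b := by
  induction hab with
  | single h => exact hc.child_trans h
  | tail _ h ih => exact ih.trans (hc.child_trans h)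

theorem Collapsible.ne (hc : N.Collapsible u g h) : g ≠ h := hc.inv.ne_of_child hc.child

theorem Collapsible.top_ne (hc : N.Collapsible u g h) : Sum.inr h ≠ u := by
  rintro rfl
  exact hc.inv.acyclic g ((Relation.TransGen.single hc.child).tail hc.edge)

theorem Collapsible.mid_ne (hc : N.Collapsible u g h) : Sum.inr g ≠ u := by
  rintro rfl
  exact hc.inv.ne_of_child hc.edge rfl

/-- In the collapsed net, neither `g` nor the gate `u` is an input of a gate. -/
theorem Collapsible.edge_ne (hc : N.Collapsible u g h) {v : L ⊕ Γ} {w : Γ}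
    (hv : (N.collapse u g h).edge v w = true) :
    v ≠ Sum.inr g ∧ ∀ c, u = Sum.inr c → v ≠ u := by
  by_cases hw : w = h
  · subst hw
    rcases collapse_edge_top.1 hv with h1 | h1
    · refine ⟨h1.2, ?_⟩
      rintro c rfl rfl
      exact hc.ne (hc.inv.child_unique hc.edge h1.1)
    · constructor
      · rintro rfl
        obtain ⟨c, rfl, h2, h3⟩ := hc.expand_trans h1
        exact hc.inv.acyclic c ((Relation.TransGen.single h3).tail h2)
      · rintro c rfl rfl
        exact hc.inv.ne_of_child h1 rfl
  · obtain ⟨h1, h2, h3⟩ := (collapse_edge hw).1 hv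
    constructor
    · rintro rfl
      exact hw (hc.inv.child_unique h3 hc.child)
    · rintro c rfl rfl
      exact h1 (hc.inv.child_unique h3 hc.edge)

/-- If `u` is a gate `c`, the types alternate along `c → g → h`, hence `c` and `h` have the same
type and the inputs of `c` may be attached to `h`. -/
theorem Collapsible.inv_collapse (hc : N.Collapsible u g h) : (N.collapse u g h).Inv where
  out_and := hc.inv.out_and
  child_unique := by
    intro a w w' h1 h2
    unfold Child at h1 h2
    have key : ∀ {w}, w ≠ h → (N.collapse u g h).edge (Sum.inr a) w = true →
        (N.collapse u g h).edge (Sum.inr a) h = true → False := by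
      intro w hw h3 h4
      obtain ⟨h5, h6, h7⟩ := (collapse_edge hw).1 h3
      rcases collapse_edge_top.1 h4 with h8 | h8
      · exact hw (hc.inv.child_unique h7 h8.1)
      · obtain ⟨c, rfl, h9, -⟩ := hc.expand_trans h8
        exact h6 (congrArg _ (hc.inv.child_unique h7 h9))
    by_cases hw : w = h
    · by_cases hw' : w' = h
      · rw [hw, hw']
      · exact (key hw' h2 (hw ▸ h1)).elim
    · by_cases hw' : w' = h
      · exact (key hw h1 (hw' ▸ h2)).elim
      · exact hc.inv.child_unique ((collapse_edge hw).1 h1).2.2 ((collapse_edge hw').1 h2).2.2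
  alternating := by
    intro a w haw
    unfold Child at haw
    by_cases hw : w = h
    · subst hw
      rcases collapse_edge_top.1 haw with h1 | h1
      · exact hc.inv.alternating h1.1
      · obtain ⟨c, rfl, h2, h3⟩ := hc.expand_trans h1
        change N.kind a ≠ N.kind w
        rw [← kind_eq_of_ne (hc.inv.alternating h3) (hc.inv.alternating hc.child)]
        exact hc.inv.alternating h2
    · exact hc.inv.alternating ((collapse_edge hw).1 haw).2.2
  acyclic a ha := hc.inv.acyclic a (hc.transGen ha)
  out_top a ha := by
    obtain ⟨c, h1, -⟩ := Relation.TransGen.head'_iff.1 (hc.child_trans ha)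
    exact hc.inv.out_top c h1
  indegree_pos := by
    intro w hw
    by_cases hwh : w = h
    · subst hwh
      cases u with
      | inl i => exact ⟨Sum.inl i, collapse_edge_top.2 (Or.inr (by simp [expand]))⟩
      | inr c =>
        obtain ⟨v, hv⟩ := hc.inv.indegree_pos c (Or.inr ⟨g, hc.edge⟩)
        exact ⟨v, collapse_edge_top.2 (Or.inr hv)⟩
    · have hne : w ≠ g ∧ Sum.inr w ≠ u := by
        rcases hw with rfl | ⟨z, hz⟩
        · refine ⟨?_, ?_⟩
          · rintro h1
            exact hc.inv.out_top h (h1 ▸ hc.child)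
          · intro h1
            exact hc.inv.out_top g (show N.edge (Sum.inr N.out) g = true from h1 ▸ hc.edge)
        · obtain ⟨h1, h2⟩ := hc.edge_ne hz
          exact ⟨fun h3 => h1 (congrArg _ h3), fun h3 => h2 w h3.symm h3⟩
      have hlive : w = N.out ∨ ∃ z, N.Child w z := by
        rcases hw with hw | ⟨z, hz⟩
        · exact Or.inl hw
        · obtain ⟨c, h1, -⟩ := Relation.TransGen.head'_iff.1 (hc.child_trans hz)
          exact Or.inr ⟨c, h1⟩
      obtain ⟨v, hv⟩ := hc.inv.indegree_pos w hlive
      exact ⟨v, (collapse_edge hwh).2 ⟨hne.1, hne.2, hv⟩⟩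

theorem Collapsible.holds_mid (hc : N.Collapsible u g h) (τ : L → Bool) :
    N.Holds τ (Sum.inr g) ↔ N.Holds τ u := by
  rw [holds_gate]
  unfold GateValue
  cases N.kind g with
  | and => exact ⟨fun h => h u hc.edge, fun h v hv => hc.unique v hv ▸ h⟩
  | or => exact ⟨fun ⟨v, hv, h⟩ => hc.unique v hv ▸ h, fun h => ⟨u, hc.edge, h⟩⟩

theorem Collapsible.equiv_collapse (hc : N.Collapsible u g h) (τ : L → Bool) :
    N.Holds τ (Sum.inr N.out) ↔ (N.collapse u g h).Holds τ (Sum.inr N.out) := by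
  -- The collapsed gates have lost their inputs and hence their meaning; all other vertices keep
  -- their values, and by `edge_ne` they only depend on each other.
  refine holds_unique hc.inv_collapse.wf_child (S := N.Holds τ)
    (R := fun v => v ≠ Sum.inr g ∧ ∀ c, u = Sum.inr c → v ≠ u) ?_ (fun i => holds_lit N) ?_ _ ?_
  · intro v w _ hv
    exact hc.edge_ne hv
  · rintro w ⟨hw1, hw2⟩
    by_cases hw : w = h
    · subst hw
      have hmid := hc.holds_mid τ
      rw [holds_gate]
      unfold GateValue
      change _ ↔ match N.kind w with | GateKind.and => _ | GateKind.or => _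
      cases hk : N.kind w with
      | and =>
        have hu : N.Holds τ u ↔ ∀ v, N.expand u v = true → N.Holds τ v := by
          cases u with
          | inl i => simp [expand]
          | inr c =>
            rw [holds_gate, GateValue,
              kind_eq_of_ne (hc.inv.alternating hc.edge) (hc.inv.alternating hc.child), hk]
            rfl
        constructor
        · intro h1 v hv
          rcases collapse_edge_top.1 hv with h2 | h2
          · exact h1 v h2.1
          · exact hu.1 (hmid.1 (h1 _ hc.child)) v h2
        · intro h1 v hv
          by_cases hvg : v = Sum.inr g
          · subst hvg
            exact hmid.2 (hu.2 fun v hv => h1 v (collapse_edge_top.2 (Or.inr hv)))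
          · exact h1 v (collapse_edge_top.2 (Or.inl ⟨hv, hvg⟩))
      | or =>
        have hu : N.Holds τ u ↔ ∃ v, N.expand u v = true ∧ N.Holds τ v := by
          cases u with
          | inl i => simp [expand]
          | inr c =>
            rw [holds_gate, GateValue,
              kind_eq_of_ne (hc.inv.alternating hc.edge) (hc.inv.alternating hc.child), hk]
            rfl
        constructor
        · rintro ⟨v, hv, h1⟩
          by_cases hvg : v = Sum.inr g
          · subst hvg
            obtain ⟨v', h2, h3⟩ := hu.1 (hmid.1 h1)
            exact ⟨v', collapse_edge_top.2 (Or.inr h2), h3⟩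
          · exact ⟨v, collapse_edge_top.2 (Or.inl ⟨hv, hvg⟩), h1⟩
        · rintro ⟨v, hv, h1⟩
          rcases collapse_edge_top.1 hv with h2 | h2
          · exact ⟨v, h2.1, h1⟩
          · exact ⟨_, hc.child, hmid.2 (hu.2 ⟨v, h2, h1⟩)⟩
    · rw [holds_gate]
      refine Iff.symm (gateValue_congr (N := N) (M := N.collapse u g h) rfl (fun v => ?_)
        fun _ _ => Iff.rfl)
      rw [Bool.eq_iff_iff, collapse_edge hw]
      refine ⟨fun h => h.2.2, fun h => ⟨fun h1 => hw1 (congrArg _ h1), fun h1 => ?_, h⟩⟩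
      exact hw2 w h1.symm h1
  · refine ⟨fun h1 => ?_, fun c h1 h2 => ?_⟩
    · exact hc.inv.out_top h (Sum.inr.inj h1 ▸ hc.child)
    · subst h1
      exact hc.inv.out_top g (Sum.inr.inj h2 ▸ hc.edge)

/-- An edge moved to `h` pulls back to a path of two edges (literal) or three edges (gate), so depth
can only decrease. -/
theorem Collapsible.path_collapse (hc : N.Collapsible u g h) {k : ℕ} {v : L ⊕ Γ}
    (hp : (N.collapse u g h).Path k v) : ∃ k', k ≤ k' ∧ N.Path k' v := by
  induction hp with
  | output => exact ⟨0, le_rfl, Path.output⟩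
  | step k v w hv _ ih =>
    obtain ⟨k', hk, hp⟩ := ih
    by_cases hw : w = h
    · subst hw
      rcases collapse_edge_top.1 hv with h1 | h1
      · exact ⟨k' + 1, by omega, Path.step _ _ _ h1.1 hp⟩
      · have hp' := Path.step _ _ _ hc.edge (Path.step _ _ _ hc.child hp)
        cases u with
        | inl i =>
          have : v = Sum.inl i := by simpa [expand] using h1
          subst this
          exact ⟨_, by omega, hp'⟩
        | inr c => exact ⟨_, by omega, Path.step _ _ _ h1 hp'⟩
    · exact ⟨k' + 1, by omega, Path.step _ _ _ ((collapse_edge hw).1 hv).2.2 hp⟩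

theorem graph_adj_of_edge (hN : N.Inv) {v : L ⊕ Γ} {w : Γ} (hw : w ≠ N.out)
    (hv : N.edge v w = true) : N.graph.Adj v (Sum.inr w) := by
  refine (SimpleGraph.fromRel_adj _ _ _).2 ⟨?_, Or.inl ⟨w, rfl, hw, hv⟩⟩
  rintro rfl
  exact hN.ne_of_child hv rfl

/-- Edges into the output do not belong to the graph, so for `h = N.out` the graph only loses edges.
Otherwise `g`, and `u` if it is a gate, are contracted into `h`. As vertices of the new graph they
remain, with nothing contracted to them; they are isolated, so the minor argument permits this. -/
theorem Collapsible.genus_collapse (hc : N.Collapsible u g h) {γ : ℕ}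
    (hγ : GraphGenus.EmbedsInGenus N.graph γ) :
    GraphGenus.EmbedsInGenus (N.collapse u g h).graph γ := by
  have hgout : g ≠ N.out := fun h1 => hc.inv.out_top h (h1 ▸ hc.child)
  have hsymm : ∀ {P : L ⊕ Γ → L ⊕ Γ → Prop} {R : Γ → L ⊕ Γ → Prop},
      (∀ v w, R w v → ∃ a b, N.graph.Adj a b ∧ P a v ∧ P b (Sum.inr w)) →
      ∀ x y, ((∃ w, y = Sum.inr w ∧ R w x) ∨ ∃ w, x = Sum.inr w ∧ R w y) →
      ∃ a b, N.graph.Adj a b ∧ P a x ∧ P b y := by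
    rintro P R h1 x y (⟨w, rfl, h2⟩ | ⟨w, rfl, h2⟩)
    · exact h1 x w h2
    · obtain ⟨a, b, hab, ha, hb⟩ := h1 y w h2
      exact ⟨b, a, hab.symm, hb, ha⟩
  by_cases hout : h = N.out
  · refine hγ.minor some id (fun v w hv => ?_) fun x y hxy => ?_
    · rw [Option.some.inj hv]; exact Relation.ReflTransGen.refl
    · refine hsymm (P := fun a b => some a = some b)
        (R := fun w v => w ≠ N.out ∧ (N.collapse u g h).edge v w = true) ?_ x y hxy.2
      rintro v w ⟨hw, hv⟩
      exact ⟨v, Sum.inr w, graph_adj_of_edge hc.inv hw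
        ((collapse_edge fun h1 => hw (h1.trans hout)).1 hv).2.2, rfl, rfl⟩
  · let q : L ⊕ Γ → Option (L ⊕ Γ) := fun v =>
      if v = Sum.inr g ∨ (v = u ∧ u.isRight) then some (Sum.inr h) else some v
    have hqg : q (Sum.inr g) = some (Sum.inr h) := by simp [q]
    have hqu : ∀ c, u = Sum.inr c → q u = some (Sum.inr h) := by rintro c rfl; simp [q]
    have hqv : ∀ v, v ≠ Sum.inr g → (∀ c, u = Sum.inr c → v ≠ u) → q v = some v := by
      intro v h1 h2
      have : ¬ (v = Sum.inr g ∨ (v = u ∧ u.isRight)) := by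
        rintro (h3 | ⟨h3, h4⟩)
        · exact h1 h3
        · obtain ⟨c, hc⟩ := Sum.isRight_iff.1 h4
          exact h2 c hc h3
      simp only [q, if_neg this]
    have hqh : q (Sum.inr h) = some (Sum.inr h) :=
      hqv _ (fun h1 => hc.ne (Sum.inr.inj h1).symm) fun _ _ => hc.top_ne
    have hgh := graph_adj_of_edge hc.inv hout hc.child
    have hug := graph_adj_of_edge hc.inv hgout hc.edge
    refine hγ.minor q id (fun v w hv => ?_) fun x y hxy => ?_
    · by_cases h1 : v = Sum.inr g
      · subst h1
        obtain rfl := Option.some.inj (hqg.symm.trans hv)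
        exact Relation.ReflTransGen.single ⟨hgh, hqg, hqh⟩
      by_cases h2 : ∃ c, u = Sum.inr c ∧ v = u
      · obtain ⟨c, h2, rfl⟩ := h2
        have h3 := hqu c h2
        obtain rfl := Option.some.inj (h3.symm.trans hv)
        exact (Relation.ReflTransGen.single ⟨hug, h3, hqg⟩).tail ⟨hgh, hqg, hqh⟩
      · push Not at h2
        obtain rfl := Option.some.inj ((hqv v h1 h2).symm.trans hv)
        exact Relation.ReflTransGen.refl
    · refine hsymm (P := fun a b => q a = some b)
        (R := fun w v => w ≠ N.out ∧ (N.collapse u g h).edge v w = true) ?_ x y hxy.2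
      rintro v w ⟨hw, hv⟩
      have hvv := hc.edge_ne hv
      have hv' := hqv v hvv.1 hvv.2
      by_cases hwh : w = h
      · subst hwh
        rcases collapse_edge_top.1 hv with h1 | h1
        · exact ⟨v, _, graph_adj_of_edge hc.inv hw h1.1, hv', hqh⟩
        · cases u with
          | inl i =>
            have : v = Sum.inl i := by simpa [expand] using h1
            subst this
            exact ⟨_, _, hug, hv', hqg⟩
          | inr c =>
            refine ⟨v, _, graph_adj_of_edge hc.inv (fun h2 => ?_) h1, hv', hqu c rfl⟩
            exact hc.inv.out_top g (h2 ▸ hc.edge)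
      · obtain ⟨h1, h2, h3⟩ := (collapse_edge hwh).1 hv
        exact ⟨v, _, graph_adj_of_edge hc.inv hw h3, hv',
          hqv _ (fun h4 => h1 (Sum.inr.inj h4)) fun _ _ => h2⟩

/-- Each new edge into `h` is charged to an edge of `N` into `src`, the gate from which it was
moved. No edge into `src` survives, so the charging is injective, and the edge `g → h` is never
charged. -/
theorem Collapsible.edgeCount_collapse (hc : N.Collapsible u g h) :
    (N.collapse u g h).edgeCount < N.edgeCount := by
  have hmem : ((Sum.inr g : L ⊕ Γ), h) ∈
      Finset.univ.filter fun p : (L ⊕ Γ) × Γ => N.edge p.1 p.2 = true :=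
    Finset.mem_filter.2 ⟨Finset.mem_univ _, hc.child⟩
  refine lt_of_le_of_lt ?_ (Finset.card_erase_lt_of_mem hmem)
  let src : Γ := Sum.elim (fun _ => g) id u
  let f : (L ⊕ Γ) × Γ → (L ⊕ Γ) × Γ := fun p =>
    if p.2 = h ∧ ¬ (N.edge p.1 h = true ∧ p.1 ≠ Sum.inr g) then (p.1, src) else p
  have hsrc : ∀ v w, (N.collapse u g h).edge v w = true → w ≠ h → w ≠ src := by
    rintro v w hv hw rfl
    obtain ⟨h1, h2, -⟩ := (collapse_edge hw).1 hv
    cases u with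
    | inl i => exact h1 rfl
    | inr c => exact h2 rfl
  have hsrch : src ≠ h := by
    have h1 := hc.ne
    have h2 := hc.top_ne
    cases u with
    | inl i => exact h1
    | inr c => exact fun h3 => h2 (congrArg _ h3.symm)
  refine Finset.card_le_card_of_injOn f ?_ ?_
  · rintro ⟨v, w⟩ hp
    have hp' := (Finset.mem_filter.1 (Finset.mem_coe.1 hp)).2
    simp only at hp'
    rw [Finset.mem_coe, Finset.mem_erase, Finset.mem_filter]
    simp only [f]
    split_ifs with hif
    · obtain ⟨rfl, hif⟩ := hif
      refine ⟨fun h1 => hsrch (Prod.ext_iff.1 h1).2, Finset.mem_univ _, ?_⟩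
      have h1 := (collapse_edge_top.1 hp').resolve_left hif
      have he := hc.edge
      cases u with
      | inl i =>
        have : v = Sum.inl i := by simpa [expand] using h1
        subst this
        exact he
      | inr c => exact h1
    · refine ⟨fun h1 => (hc.edge_ne hp').1 (Prod.ext_iff.1 h1).1, Finset.mem_univ _, ?_⟩
      by_cases hw : w = h
      · subst hw
        simp only [true_and, not_not] at hif
        exact hif.1
      · exact ((collapse_edge hw).1 hp').2.2
  · rintro ⟨v, w⟩ hp ⟨v', w'⟩ hp' heq
    have h1 := (Finset.mem_filter.1 (Finset.mem_coe.1 hp)).2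
    have h1' := (Finset.mem_filter.1 (Finset.mem_coe.1 hp')).2
    simp only at h1 h1'
    simp only [f] at heq
    split_ifs at heq with h2 h3 h3
    · exact Prod.ext (Prod.ext_iff.1 heq).1 (h2.1.trans h3.1.symm)
    · obtain ⟨h4, h5⟩ := Prod.ext_iff.1 heq
      simp only at h4 h5
      subst h4
      by_cases hw : w' = h
      · exact absurd (h5.trans hw) hsrch
      · exact absurd h5.symm (hsrc _ _ h1' hw)
    · obtain ⟨h4, h5⟩ := Prod.ext_iff.1 heq
      simp only at h4 h5
      subst h4
      by_cases hw : w = h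
      · exact absurd (h5.symm.trans hw) hsrch
      · exact absurd h5 (hsrc _ _ h1 hw)
    · exact heq

theorem Collapsible.refines (hc : N.Collapsible u g h) : N.Refines (N.collapse u g h) where
  inv := hc.inv_collapse
  kind_eq := rfl
  out_eq := rfl
  equiv := hc.equiv_collapse
  path _ _ hp := hc.path_collapse hp
  genus _ hγ := hc.genus_collapse hγ
  count := Or.inr hc.edgeCount_collapse

end Collapse

end Net

/-! ### Counting the occurrences of the literals in a reduced net -/

namespace Net

open GraphGenus

variable {L Γ : Type} [Fintype L] [Fintype Γ] [DecidableEq L] [DecidableEq Γ] {N : Net L Γ}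

/-- No reduction applies to `N`. -/
structure Reduced (N : Net L Γ) : Prop where
  inv : N.Inv
  two_inputs : ∀ u g h, N.edge u g = true → N.Child g h → ∃ v, v ≠ u ∧ N.edge v g = true
  below : ∀ x g a b, N.edge (Sum.inl x) g = true → N.edge a b = true →
    Relation.ReflTransGen N.Child b g → N.kind b = N.kind g → ¬ (a = Sum.inl x ∧ b = g) →
    (a = Sum.inl x ∨ ∃ c, a = Sum.inr c ∧ N.edge (Sum.inl x) c = true) →
    ¬ ∃ v, v ≠ a ∧ N.edge v b = true
  distinct : ∀ a a' b, a ≠ a' → N.Child a b → N.Child a' b → ∃ v, N.edge v a ≠ N.edge v a'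
  alive : ∀ v g, N.edge v g = true → g = N.out ∨ ∃ h, N.Child g h

/-- `g` is an input of another gate. -/
def Proper (N : Net L Γ) (g : Γ) : Prop := ∃ h, N.Child g h

namespace Reduced

theorem proper (hN : N.Reduced) {v : L ⊕ Γ} {g : Γ} (hv : N.edge v g = true) (hg : g ≠ N.out) :
    N.Proper g := (hN.alive v g hv).resolve_left hg

theorem ne_out (hN : N.Reduced) {g : Γ} (hg : N.Proper g) : g ≠ N.out := by
  rintro rfl
  obtain ⟨h, hh⟩ := hg
  exact hN.inv.out_top h hh

/-- A literal occurs at most once on every path. -/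
theorem literal_unique (hN : N.Reduced) {x : L} {g h : Γ} (hg : N.edge (Sum.inl x) g = true)
    (hh : N.edge (Sum.inl x) h = true) : ¬ Relation.TransGen N.Child h g := by
  intro hhg
  obtain ⟨b, hhb, hbg⟩ := Relation.TransGen.head'_iff.1 hhg
  -- With equal types the lower occurrence itself could be removed. With different types the parent
  -- `b` of `h` has the type of `g`, and the edge from `h` to `b` could be removed.
  by_cases hk : N.kind h = N.kind g
  · refine hN.below x g _ h hg hh hhg.to_reflTransGen hk ?_ (Or.inl rfl)
      (hN.two_inputs _ h b hh hhb)
    rintro ⟨-, rfl⟩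
    exact hN.inv.acyclic h hhg
  · have hk' : N.kind b = N.kind g := kind_eq_of_ne (hN.inv.alternating hhb).symm hk
    refine hN.below x g (Sum.inr h) b hg hhb hbg hk' (fun h1 => by cases h1.1)
      (Or.inr ⟨h, rfl, hh⟩) ?_
    rcases Relation.reflTransGen_iff_eq_or_transGen.1 hbg with rfl | hbg
    · exact ⟨Sum.inl x, by simp, hg⟩
    · obtain ⟨c, hbc, -⟩ := Relation.TransGen.head'_iff.1 hbg
      exact hN.two_inputs _ b c hhb hbc

end Reduced

/-- `f` maps every gate to the first gate above it that satisfies `target`. -/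
structure IsClimb (N : Net L Γ) (target : Γ → Prop) (f : Γ → Γ) : Prop where
  eq_self : ∀ g, target g → f g = g
  eq_parent : ∀ g h, ¬ target g → N.Child g h → f g = f h
  proper : ∀ g, ¬ target g → ∃ h, N.Child g h ∧ h ≠ N.out

/-- Recursion along the well-founded parent relation; since parents are unique, the choice of the
parent does not matter. -/
theorem exists_isClimb (hN : N.Inv) (target : Γ → Prop)
    (htarget : ∀ g, ¬ target g → ∃ h, N.Child g h ∧ h ≠ N.out) : ∃ f, N.IsClimb target f := by
  classical
  let F : (g : Γ) → ((y : Γ) → Function.swap N.Child y g → Γ) → Γ := fun g rec =>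
    if h : target g then g else rec (htarget g h).choose (htarget g h).choose_spec.1
  refine ⟨hN.wf_parent.fix F, fun g hg => ?_, fun g h hg hgh => ?_, htarget⟩
  · rw [WellFounded.fix_eq]
    simp only [F, dif_pos hg]
  · rw [WellFounded.fix_eq]
    simp only [F, dif_neg hg]
    rw [hN.child_unique (htarget g hg).choose_spec.1 hgh]

namespace IsClimb

variable {target : Γ → Prop} {f : Γ → Γ}

theorem target_apply (hf : N.IsClimb target f) (hN : N.Inv) (g : Γ) : target (f g) := by
  induction g using hN.wf_parent.induction with
  | _ g ih =>
    by_cases hg : target g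
    · rwa [hf.eq_self g hg]
    · obtain ⟨h, hgh, -⟩ := hf.proper g hg
      rw [hf.eq_parent g h hg hgh]
      exact ih h hgh

theorem invariant (hf : N.IsClimb target f) (hN : N.Inv) {P : Γ → Prop}
    (hP : ∀ a b, P a → N.Child a b → b ≠ N.out → P b) {g : Γ} (hg : P g) : P (f g) := by
  induction g using hN.wf_parent.induction with
  | _ g ih =>
    by_cases hs : target g
    · rwa [hf.eq_self g hs]
    · obtain ⟨h, hgh, hh⟩ := hf.proper g hs
      rw [hf.eq_parent g h hs hgh]
      exact ih h hgh (hP g h hg hgh hh)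

theorem reflTransGen (hf : N.IsClimb target f) (hN : N.Inv) (g : Γ) :
    Relation.ReflTransGen N.Child g (f g) := by
  induction g using hN.wf_parent.induction with
  | _ g ih =>
    by_cases hs : target g
    · rw [hf.eq_self g hs]
    · obtain ⟨h, hgh, -⟩ := hf.proper g hs
      rw [hf.eq_parent g h hs hgh]
      exact Relation.ReflTransGen.head hgh (ih h hgh)

/-- The gates with a common image under `f` form connected parts of the graph. -/
theorem connected (hf : N.IsClimb target f) (hN : N.Inv) {W : Type} {q : L ⊕ Γ → Option W} {w : W}
    {P : Γ → Prop} (hP : ∀ a b, P a → N.Child a b → b ≠ N.out → P b) {g : Γ} (hg : P g)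
    (hq : ∀ a, P a → f a = f g → q (Sum.inr a) = some w) :
    Relation.ReflTransGen (fun a b => N.graph.Adj a b ∧ q a = some w ∧ q b = some w)
      (Sum.inr g) (Sum.inr (f g)) := by
  induction g using hN.wf_parent.induction with
  | _ g ih =>
    by_cases hs : target g
    · rw [hf.eq_self g hs]
    · obtain ⟨h, hgh, hh⟩ := hf.proper g hs
      have heq := hf.eq_parent g h hs hgh
      rw [heq] at hq ⊢
      have hPh := hP g h hg hgh hh
      exact Relation.ReflTransGen.head
        ⟨graph_adj_of_edge hN hh hgh, hq g hg heq, hq h hPh rfl⟩ (ih h hgh hPh hq)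

end IsClimb

/-- Double counting. With `m = 3` it beats the two edges per vertex allowed by `card_relation_le`,
and so bounds `B` linearly in `A` and the genus. -/
theorem mul_card_le_card_relation {A B : Type*} [Finite A] [Fintype B] {R : A → B → Prop} {m : ℕ}
    (h : ∀ b, ∃ s : Finset A, m ≤ s.card ∧ ∀ a ∈ s, R a b) :
    m * Fintype.card B ≤ Nat.card {p : A × B // R p.1 p.2} := by
  classical
  have : Fintype A := Fintype.ofFinite A
  choose s hs hR using h
  have h1 : ∑ b : B, (s b).card = Nat.card (Σ b, s b) := by
    rw [Nat.card_eq_fintype_card, Fintype.card_sigma]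
    simp
  have h2 : m * Fintype.card B ≤ ∑ b : B, (s b).card := by
    rw [mul_comm, ← smul_eq_mul, ← Finset.card_univ]
    exact Finset.card_nsmul_le_sum _ _ _ fun b _ => hs b
  refine h2.trans (h1.le.trans ?_)
  refine Nat.card_le_card_of_injective
    (fun p : (Σ b, s b) => (⟨(p.2.1, p.1), hR _ _ p.2.2⟩ : {p : A × B // R p.1 p.2})) ?_
  rintro ⟨b, a, ha⟩ ⟨b', a', ha'⟩ heq
  simp only [Subtype.mk.injEq, Prod.mk.injEq] at heq
  obtain ⟨rfl, rfl⟩ := heq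
  rfl

/-- `g` has no gates as inputs. -/
def Bottom (N : Net L Γ) (g : Γ) : Prop := ∀ a, ¬ N.Child a g

namespace Reduced

variable {γ : ℕ}

theorem two_literals (hN : N.Reduced) {g : Γ} (hg : N.Proper g) (hb : N.Bottom g) :
    ∃ x y : L, x ≠ y ∧ N.edge (Sum.inl x) g = true ∧ N.edge (Sum.inl y) g = true := by
  have hlit : ∀ v, N.edge v g = true → ∃ x, v = Sum.inl x := by
    rintro (x | a) hv
    · exact ⟨x, rfl⟩
    · exact absurd hv (hb a)
  obtain ⟨u, hu⟩ := hN.inv.indegree_pos g (Or.inr hg)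
  obtain ⟨h, hgh⟩ := hg
  obtain ⟨v, hvu, hv⟩ := hN.two_inputs u g h hu hgh
  obtain ⟨x, rfl⟩ := hlit u hu
  obtain ⟨y, rfl⟩ := hlit v hv
  exact ⟨x, y, fun h => hvu (by rw [h]), hu, hv⟩

/-- A gate that has other gates as inputs has three literals below it. -/
theorem three_literals (hN : N.Reduced) {r : Γ} (hr : N.Proper r) (hb : ¬ N.Bottom r) :
    ∃ x y z : L, x ≠ y ∧ x ≠ z ∧ y ≠ z ∧ ∀ w, (w = x ∨ w = y ∨ w = z) →
      ∃ g, N.edge (Sum.inl w) g = true ∧ Relation.ReflTransGen N.Child g r := by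
  -- a lowest gate with gates as inputs
  obtain ⟨p, ⟨hpr, hpb⟩, hpmin⟩ := hN.inv.wf_child.has_min
    {p | Relation.ReflTransGen N.Child p r ∧ ¬ N.Bottom p} ⟨r, Relation.ReflTransGen.refl, hb⟩
  have hpp : N.Proper p := by
    rcases Relation.reflTransGen_iff_eq_or_transGen.1 hpr with rfl | h
    · exact hr
    · obtain ⟨c, hc, -⟩ := Relation.TransGen.head'_iff.1 h
      exact ⟨c, hc⟩
  have hbot : ∀ a, N.Child a p → N.Bottom a := by
    intro a ha
    by_contra hab
    exact hpmin a ⟨Relation.ReflTransGen.head ha hpr, hab⟩ ha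
  have hbelow : ∀ a, N.Child a p → Relation.ReflTransGen N.Child a r := fun a ha =>
    Relation.ReflTransGen.head ha hpr
  have hpb' : ∃ a, N.Child a p := by
    by_contra h
    push Not at h
    exact hpb h
  obtain ⟨a, ha⟩ := hpb'
  obtain ⟨q, hpq⟩ := hpp
  obtain ⟨v, hva, hv⟩ := hN.two_inputs (Sum.inr a) p q ha hpq
  -- Two literals of `a'` together with a literal of `a` that does not feed `a'`.
  have key : ∀ a a' : Γ, N.Child a p → N.Child a' p → ∀ i, N.edge (Sum.inl i) a = true →
      N.edge (Sum.inl i) a' = false → ∃ x y z : L, x ≠ y ∧ x ≠ z ∧ y ≠ z ∧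
      ∀ w, (w = x ∨ w = y ∨ w = z) →
      ∃ g, N.edge (Sum.inl w) g = true ∧ Relation.ReflTransGen N.Child g r := by
    intro a a' ha ha' i hi hi'
    obtain ⟨x, y, hxy, hx, hy⟩ := hN.two_literals ⟨p, ha'⟩ (hbot a' ha')
    refine ⟨x, y, i, hxy, ?_, ?_, ?_⟩
    · rintro rfl; rw [hx] at hi'; cases hi'
    · rintro rfl; rw [hy] at hi'; cases hi'
    · rintro w (rfl | rfl | rfl)
      · exact ⟨a', hx, hbelow a' ha'⟩
      · exact ⟨a', hy, hbelow a' ha'⟩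
      · exact ⟨a, hi, hbelow a ha⟩
  -- The other input of `p` is either a literal, which cannot feed `a` because it would then occur
  -- twice on a path, or a gate, whose literals differ from those of `a` by `distinct`.
  cases v with
  | inl i =>
    obtain ⟨x, y, hxy, hx, hy⟩ := hN.two_literals ⟨p, ha⟩ (hbot a ha)
    have hne : ∀ z, N.edge (Sum.inl z) a = true → z ≠ i := by
      rintro z hz rfl
      exact hN.literal_unique hv hz (Relation.TransGen.single ha)
    refine ⟨x, y, i, hxy, hne x hx, hne y hy, ?_⟩
    rintro w (rfl | rfl | rfl)
    · exact ⟨a, hx, hbelow a ha⟩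
    · exact ⟨a, hy, hbelow a ha⟩
    · exact ⟨p, hv, hpr⟩
  | inr a' =>
    have haa : a ≠ a' := fun h => hva (by rw [h])
    obtain ⟨v, hv'⟩ := hN.distinct a a' p haa ha hv
    cases v with
    | inr c =>
      have h1 : N.edge (Sum.inr c) a = false := Bool.eq_false_iff.2 (hbot a ha c)
      have h2 : N.edge (Sum.inr c) a' = false := Bool.eq_false_iff.2 (hbot a' hv c)
      rw [h1, h2] at hv'
      exact absurd rfl hv'
    | inl i =>
      cases h1 : N.edge (Sum.inl i) a
      · refine key a' a hv ha i ?_ h1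
        cases h2 : N.edge (Sum.inl i) a'
        · rw [h1, h2] at hv'; exact absurd rfl hv'
        · rfl
      · refine key a a' ha hv i h1 ?_
        cases h2 : N.edge (Sum.inl i) a'
        · rfl
        · rw [h1, h2] at hv'; exact absurd rfl hv'

/-- The gates `r` below the output whose trees contain at least three literals. -/
def Wide (N : Net L Γ) (r : Γ) : Prop :=
  N.Child r N.out ∧ ∃ x y z : L, x ≠ y ∧ x ≠ z ∧ y ≠ z ∧ ∀ w, (w = x ∨ w = y ∨ w = z) →
      ∃ g, N.edge (Sum.inl w) g = true ∧ Relation.ReflTransGen N.Child g r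

theorem exists_root (hN : N.Reduced) : ∃ f, N.IsClimb (fun g => ¬ ∃ h, N.Child g h ∧ h ≠ N.out) f :=
  exists_isClimb hN.inv _ fun _ h => not_not.1 h

theorem proper_up (hN : N.Reduced) (a b : Γ) (_ : N.Proper a) (hab : N.Child a b)
    (hb : b ≠ N.out) : N.Proper b := hN.proper hab hb

theorem root_child_out (hN : N.Reduced) {f : Γ → Γ}
    (hf : N.IsClimb (fun g => ¬ ∃ h, N.Child g h ∧ h ≠ N.out) f) {g : Γ} (hg : N.Proper g) :
    N.Child (f g) N.out := by
  obtain ⟨h, hh⟩ := hf.invariant hN.inv hN.proper_up hg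
  have := hf.target_apply hN.inv g
  by_cases hout : h = N.out
  · rwa [hout] at hh
  · exact absurd ⟨h, hh, hout⟩ this

theorem root_eq (hN : N.Reduced) {f : Γ → Γ}
    (hf : N.IsClimb (fun g => ¬ ∃ h, N.Child g h ∧ h ≠ N.out) f) {g r : Γ}
    (hr : N.Child r N.out) (hgr : Relation.ReflTransGen N.Child g r) : f g = r := by
  induction hgr using Relation.ReflTransGen.head_induction_on with
  | refl =>
    refine hf.eq_self r ?_
    rintro ⟨h, hh, hne⟩
    exact hne (hN.inv.child_unique hh hr)
  | head hab hrest ih =>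
    rename_i a b
    rw [← ih]
    refine hf.eq_parent a b (not_not.2 ⟨b, hab, ?_⟩) hab
    rintro rfl
    rcases Relation.reflTransGen_iff_eq_or_transGen.1 hrest with h | h
    · exact hN.inv.out_top _ (h ▸ hr)
    · obtain ⟨c, hc, -⟩ := Relation.TransGen.head'_iff.1 h
      exact hN.inv.out_top _ hc

open Classical in
-- The tree of each wide gate is contracted to a vertex with three literals as neighbours. For `w`
-- wide gates and `n` literals, `3w ≤ 2(n + w) + 4γ`.
theorem card_wide (hN : N.Reduced) (hγ : EmbedsInGenus N.graph γ) :
    Fintype.card {r // Wide N r} ≤ 2 * Fintype.card L + 4 * γ := by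
  obtain ⟨f, hf⟩ := hN.exists_root
  let R : L → {r // Wide N r} → Prop := fun x r =>
    ∃ g, N.Proper g ∧ N.edge (Sum.inl x) g = true ∧ f g = r.1
  let q : L ⊕ Γ → Option (L ⊕ {r // Wide N r}) := Sum.elim (fun x => some (Sum.inl x)) fun g =>
    if h : N.Proper g ∧ Wide N (f g) then some (Sum.inr ⟨f g, h.2⟩) else none
  have hqg : ∀ (g : Γ) (r : {r // Wide N r}), N.Proper g → f g = r.1 →
      q (Sum.inr g) = some (Sum.inr r) := by
    rintro g ⟨r, hr⟩ hg hgr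
    dsimp only at hgr
    subst hgr
    simp only [q, Sum.elim_inr]
    rw [dif_pos ⟨hg, hr⟩]
  have hbound := card_relation_le hγ R q (Sum.map id Subtype.val) ?_ ?_
  · have h3 := mul_card_le_card_relation (R := R) (m := 3) ?_
    · simp only [Nat.card_eq_fintype_card] at hbound h3
      omega
    · rintro ⟨r, hr, x, y, z, hxy, hxz, hyz, hw⟩
      refine ⟨{x, y, z}, (Finset.card_eq_three.2 ⟨x, y, z, hxy, hxz, hyz, rfl⟩).ge, ?_⟩
      intro w hw'
      obtain ⟨g, hg, hgr⟩ := hw w (by simpa using hw')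
      refine ⟨g, ?_, hg, hN.root_eq hf hr hgr⟩
      rcases Relation.reflTransGen_iff_eq_or_transGen.1 hgr with rfl | h
      · exact ⟨_, hr⟩
      · obtain ⟨c, hc, -⟩ := Relation.TransGen.head'_iff.1 h
        exact ⟨c, hc⟩
  · rintro (x | g) w hw
    · obtain rfl := Option.some.inj (show some (Sum.inl x) = some w from hw)
      exact Relation.ReflTransGen.refl
    · by_cases h : N.Proper g ∧ Wide N (f g)
      · have h1 := hqg g ⟨f g, h.2⟩ h.1 rfl
        obtain rfl := Option.some.inj (h1.symm.trans hw)
        exact hf.connected hN.inv hN.proper_up h.1 fun a ha hag => hqg a _ ha hag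
      · simp only [q, Sum.elim_inr, dif_neg h] at hw
        cases hw
  · rintro x r ⟨g, hg, hx, hgr⟩
    exact ⟨_, _, graph_adj_of_edge hN.inv (hN.ne_out hg) hx, rfl, hqg g r hg hgr⟩

/-- The gates below the output with exactly two inputs, both of them literals. -/
def Narrow (N : Net L Γ) (r : Γ) : Prop :=
  N.Child r N.out ∧ ∃ x y : L, x ≠ y ∧
    ∀ v, N.edge v r = true ↔ v = Sum.inl x ∨ v = Sum.inl y

open Classical in
-- Contracting each narrow gate into one of its literals leaves a simple graph on the literals
-- alone. Different narrow gates give different edges by `distinct`, and the Euler bound applies.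
theorem card_narrow (hN : N.Reduced) (hγ : EmbedsInGenus N.graph γ) :
    Fintype.card {r // Narrow N r} ≤ 3 * Fintype.card L + 6 * γ := by
  have hch : ∀ r : {r // Narrow N r}, ∃ x y : L, x ≠ y ∧
    ∀ v, N.edge v r.1 = true ↔ v = Sum.inl x ∨ v = Sum.inl y := fun r => r.2.2
  choose x y hxy hedge using hch
  let H : SimpleGraph L := SimpleGraph.fromRel fun a b => ∃ r, x r = a ∧ y r = b
  let q : L ⊕ Γ → Option L := Sum.elim some fun g =>
    if h : Narrow N g then some (x ⟨g, h⟩) else none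
  have hqr : ∀ r : {r // Narrow N r}, q (Sum.inr r.1) = some (x r) := by
    rintro ⟨r, hr⟩
    simp only [q, Sum.elim_inr]
    rw [dif_pos hr]
  have hadj : ∀ (r : {r // Narrow N r}) v, N.edge v r.1 = true → N.graph.Adj v (Sum.inr r.1) :=
    fun r v hv => graph_adj_of_edge hN.inv (hN.ne_out ⟨_, r.2.1⟩) hv
  have hH : EmbedsInGenus H γ := by
    refine hγ.minor q Sum.inl ?_ ?_
    · rintro (a | g) w hw
      · obtain rfl := Option.some.inj (show some a = some w from hw)
        exact Relation.ReflTransGen.refl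
      · by_cases h : Narrow N g
        · have h1 := hqr ⟨g, h⟩
          obtain rfl := Option.some.inj (h1.symm.trans hw)
          refine Relation.ReflTransGen.single ⟨(hadj ⟨g, h⟩ _ ?_).symm, h1, rfl⟩
          exact (hedge _ _).2 (Or.inl rfl)
        · simp only [q, Sum.elim_inr, dif_neg h] at hw
          cases hw
    · have key : ∀ r, ∃ u v, N.graph.Adj u v ∧ q u = some (x r) ∧ q v = some (y r) := fun r =>
        ⟨Sum.inr r.1, Sum.inl (y r), (hadj r _ ((hedge _ _).2 (Or.inr rfl))).symm, hqr r, rfl⟩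
      rintro w w' ⟨-, ⟨r, rfl, rfl⟩ | ⟨r, rfl, rfl⟩⟩
      · exact key r
      · obtain ⟨u, v, huv, hu, hv⟩ := key r
        exact ⟨v, u, huv.symm, hv, hu⟩
  have hb := edge_bound hH
  rw [Nat.card_eq_fintype_card (α := L)] at hb
  refine le_trans ?_ hb
  rw [← Nat.card_eq_fintype_card]
  refine Nat.card_le_card_of_injective
    (fun r => (⟨s(x r, y r), show H.Adj (x r) (y r) from ⟨hxy r, Or.inl ⟨r, rfl, rfl⟩⟩⟩ :
      H.edgeSet)) ?_
  intro r r' heq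
  have heq' : s(x r, y r) = s(x r', y r') := congrArg Subtype.val heq
  by_contra hne
  obtain ⟨v, hv⟩ := hN.distinct r.1 r'.1 N.out (fun h => hne (Subtype.ext h)) r.2.1 r'.2.1
  refine hv (Bool.eq_iff_iff.2 ?_)
  rw [hedge, hedge]
  rcases Sym2.eq_iff.1 heq' with ⟨h1, h2⟩ | ⟨h1, h2⟩
  · rw [h1, h2]
  · rw [h1, h2, or_comm]

theorem wide_or_narrow (hN : N.Reduced) {r : Γ} (hr : N.Child r N.out) (hb : N.Bottom r) :
    Wide N r ∨ Narrow N r := by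
  obtain ⟨x, y, hxy, hx, hy⟩ := hN.two_literals ⟨_, hr⟩ hb
  by_cases h : ∃ z, z ≠ x ∧ z ≠ y ∧ N.edge (Sum.inl z) r = true
  · obtain ⟨z, hzx, hzy, hz⟩ := h
    refine Or.inl ⟨hr, x, y, z, hxy, hzx.symm, hzy.symm, ?_⟩
    rintro w (rfl | rfl | rfl)
    · exact ⟨r, hx, Relation.ReflTransGen.refl⟩
    · exact ⟨r, hy, Relation.ReflTransGen.refl⟩
    · exact ⟨r, hz, Relation.ReflTransGen.refl⟩
  · push Not at h
    refine Or.inr ⟨hr, x, y, hxy, fun v => ⟨fun hv => ?_, ?_⟩⟩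
    · cases v with
      | inr a => exact absurd hv (hb a)
      | inl z =>
        by_cases h1 : z = x
        · exact Or.inl (by rw [h1])
        by_cases h2 : z = y
        · exact Or.inr (by rw [h2])
        · exact absurd hv (h z h1 h2)
    · rintro (rfl | rfl)
      · exact hx
      · exact hy

/-- The gates with literals only as inputs that are not inputs of the output. -/
def Inner (N : Net L Γ) (g : Γ) : Prop := N.Proper g ∧ N.Bottom g ∧ ¬ N.Child g N.out

open Classical in
-- The gates that have gate inputs are contracted to one vertex per tree; by `three_literals` these
-- trees are wide. An inner gate is then adjacent to two literals and to the tree above it, so `3i ≤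
-- 2(n + w + i) + 4γ` for `i` inner gates and `w` wide trees.
theorem card_inner (hN : N.Reduced) (hγ : EmbedsInGenus N.graph γ) :
    Fintype.card {g // Inner N g} ≤
      2 * Fintype.card L + 2 * Fintype.card {r // Wide N r} + 4 * γ := by
  obtain ⟨f, hf⟩ := hN.exists_root
  let P : Γ → Prop := fun g => N.Proper g ∧ ¬ N.Bottom g
  have hup : ∀ a b, N.Child a b → b ≠ N.out → P b := fun a b hab hb =>
    ⟨hN.proper hab hb, fun h => h a hab⟩
  have hP : ∀ a b, P a → N.Child a b → b ≠ N.out → P b := fun a b _ => hup a b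
  have hwide : ∀ g, P g → Wide N (f g) := by
    intro g hg
    have h1 := hf.invariant hN.inv hP hg
    exact ⟨hN.root_child_out hf hg.1, hN.three_literals h1.1 h1.2⟩
  let R : (L ⊕ {r // Wide N r}) → {g // Inner N g} → Prop := fun w g =>
    Sum.elim (fun x => N.edge (Sum.inl x) g.1 = true)
      (fun r => ∃ h, N.Child g.1 h ∧ h ≠ N.out ∧ f h = r.1) w
  let q : L ⊕ Γ → Option ((L ⊕ {r // Wide N r}) ⊕ {g // Inner N g}) :=
    Sum.elim (fun x => some (Sum.inl (Sum.inl x))) fun g =>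
      if h : P g then some (Sum.inl (Sum.inr ⟨f g, hwide g h⟩))
      else if h : Inner N g then some (Sum.inr ⟨g, h⟩) else none
  have hqP : ∀ (g : Γ) (r : {r // Wide N r}), P g → f g = r.1 →
      q (Sum.inr g) = some (Sum.inl (Sum.inr r)) := by
    rintro g ⟨r, hr⟩ hg hgr
    dsimp only at hgr
    subst hgr
    simp only [q, Sum.elim_inr]
    rw [dif_pos hg]
  have hqI : ∀ g : {g // Inner N g}, q (Sum.inr g.1) = some (Sum.inr g) := by
    rintro ⟨g, hg⟩
    have h1 : ¬ P g := fun h => h.2 hg.2.1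
    simp only [q, Sum.elim_inr]
    rw [dif_neg h1, dif_pos hg]
  have hbound := card_relation_le hγ R q
    (Sum.elim (Sum.map id Subtype.val) fun g => Sum.inr g.1) ?_ ?_
  · have h3 := mul_card_le_card_relation (R := R) (m := 3) ?_
    · simp only [Nat.card_eq_fintype_card, Fintype.card_sum] at hbound h3
      omega
    · rintro ⟨g, ⟨h, hgh⟩, hb, ho⟩
      obtain ⟨x, y, hxy, hx, hy⟩ := hN.two_literals ⟨h, hgh⟩ hb
      have hh : h ≠ N.out := fun h1 => ho (h1 ▸ hgh)
      refine ⟨{Sum.inl x, Sum.inl y, Sum.inr ⟨f h, hwide h (hup g h hgh hh)⟩}, ?_, ?_⟩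
      · refine (Finset.card_eq_three.2 ⟨_, _, _, ?_, ?_, ?_, rfl⟩).ge
        · simpa using hxy
        · simp
        · simp
      · intro w hw
        simp only [Finset.mem_insert, Finset.mem_singleton] at hw
        rcases hw with rfl | rfl | rfl
        · exact hx
        · exact hy
        · exact ⟨h, hgh, hh, rfl⟩
  · rintro (x | g) w hw
    · obtain rfl := Option.some.inj (show some (Sum.inl (Sum.inl x)) = some w from hw)
      exact Relation.ReflTransGen.refl
    · by_cases h : P g
      · have h1 := hqP g ⟨f g, hwide g h⟩ h rfl
        obtain rfl := Option.some.inj (h1.symm.trans hw)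
        exact hf.connected hN.inv hP h fun a ha hag => hqP a _ ha hag
      · by_cases h' : Inner N g
        · obtain rfl := Option.some.inj ((hqI ⟨g, h'⟩).symm.trans hw)
          exact Relation.ReflTransGen.refl
        · simp only [q, Sum.elim_inr, dif_neg h, dif_neg h'] at hw
          cases hw
  · rintro (x | r) g hR
    · exact ⟨_, _, graph_adj_of_edge hN.inv (hN.ne_out g.2.1) hR, rfl, hqI g⟩
    · obtain ⟨h, hgh, hh, hr⟩ := hR
      exact ⟨Sum.inr h, Sum.inr g.1, (graph_adj_of_edge hN.inv hh hgh).symm,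
        hqP h r (hup _ _ hgh hh) hr, hqI g⟩

open Classical in
-- The sum of the bounds for inner, wide and narrow gates: `(6n + 12γ) + (2n + 4γ) + (3n + 6γ)`, the
-- first after inserting the bound for wide gates.
theorem card_bottom (hN : N.Reduced) (hγ : EmbedsInGenus N.graph γ) :
    Fintype.card {g // N.Proper g ∧ N.Bottom g} ≤ 11 * Fintype.card L + 22 * γ := by
  have h1 := hN.card_wide hγ
  have h2 := hN.card_narrow hγ
  have h3 := hN.card_inner hγ
  rw [Fintype.card_subtype] at h1 h2 h3 ⊢
  rw [Fintype.card_subtype] at h3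
  have h4 : Finset.univ.filter (fun g => N.Proper g ∧ N.Bottom g) ⊆
      (({x | Inner N x} : Finset Γ) ∪ ({x | Wide N x} : Finset Γ)) ∪ ({x | Narrow N x} : Finset Γ) := by
    intro g hg
    obtain ⟨hp, hb⟩ := (Finset.mem_filter.1 hg).2
    simp only [Finset.mem_union, Finset.mem_filter, Finset.mem_univ, true_and]
    by_cases ho : N.Child g N.out
    · rcases hN.wide_or_narrow ho hb with h | h
      · exact Or.inl (Or.inr h)
      · exact Or.inr h
    · exact Or.inl (Or.inl ⟨hp, hb, ho⟩)
  have h5 := Finset.card_le_card h4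
  have h6 := Finset.card_union_le (({x | Inner N x} : Finset Γ) ∪ ({x | Wide N x} : Finset Γ))
    ({x | Narrow N x} : Finset Γ)
  have h7 := Finset.card_union_le ({x | Inner N x} : Finset Γ) {x | Wide N x}
  omega

/-- The gates at which a chain of only children ends. -/
def ChainTop (N : Net L Γ) (g : Γ) : Prop :=
  ¬ ∃ h, N.Child g h ∧ h ≠ N.out ∧ ∀ c, N.Child c h → c = g

/-- A chain is a path: by induction the parent `p` of `g` is comparable with `g'`, and if `g'` lies
properly below `p`, then it lies at or below `g`, the only child of `p`. -/
theorem chain_comparable (hN : N.Reduced) {f : Γ → Γ} (hf : N.IsClimb (ChainTop N) f) {g g' : Γ}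
    (h : f g = f g') :
    Relation.ReflTransGen N.Child g g' ∨ Relation.ReflTransGen N.Child g' g := by
  induction g using hN.inv.wf_parent.induction with
  | _ g ih =>
    by_cases hs : ChainTop N g
    · rw [hf.eq_self g hs] at h
      rw [h]
      exact Or.inr (hf.reflTransGen hN.inv g')
    · obtain ⟨p, hgp, hp, honly⟩ := not_not.1 hs
      rcases ih p hgp ((hf.eq_parent g p hs hgp).symm.trans h) with h1 | h1
      · exact Or.inl (Relation.ReflTransGen.head hgp h1)
      · rcases Relation.ReflTransGen.cases_tail h1 with h2 | ⟨c, hc, hcp⟩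
        · exact Or.inl (h2 ▸ Relation.ReflTransGen.single hgp)
        · exact Or.inr (honly c hcp ▸ hc)

open Classical in
-- In a forest the number of vertices is at most twice the number of leaves plus the number of
-- vertices with one child. The latter inject into the vertices that are not chain tops, by passing
-- to the only child.
theorem card_chainTop (hN : N.Reduced) :
    Fintype.card {g // N.Proper g ∧ ChainTop N g} ≤
      2 * Fintype.card {g // N.Proper g ∧ N.Bottom g} := by
  let P : Finset Γ := Finset.univ.filter N.Proper
  let ch : Γ → ℕ := fun g => (Finset.univ.filter fun c => N.Child c g).card
  have hsum : ∑ g ∈ P, ch g ≤ P.card := by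
    have h1 := Finset.sum_card_bipartiteAbove_eq_sum_card_bipartiteBelow
      (s := P) (t := Finset.univ) (fun g c => N.Child c g)
    have h2 : ∑ c : Γ, (P.bipartiteBelow (fun g c => N.Child c g) c).card ≤
        ∑ c : Γ, if c ∈ P then 1 else 0 := by
      refine Finset.sum_le_sum fun c _ => ?_
      split_ifs with hc
      · refine Finset.card_le_one.2 fun a ha b hb => ?_
        exact hN.inv.child_unique (Finset.mem_filter.1 ha).2 (Finset.mem_filter.1 hb).2
      · refine Nat.le_of_eq (Finset.card_eq_zero.2 (Finset.filter_eq_empty_iff.2 ?_))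
        intro a _ ha
        exact hc (Finset.mem_filter.2 ⟨Finset.mem_univ _, a, ha⟩)
    rw [Finset.sum_ite_mem, Finset.univ_inter, Finset.sum_const, smul_eq_mul, mul_one] at h2
    exact h1.le.trans h2
  -- Pointwise, a gate with no child lacks two children and a gate with one child lacks one. The sum
  -- of all numbers of children is at most `P.card` by `hsum`.
  have hpt : ∑ g ∈ P, 2 ≤
      ∑ g ∈ P, (ch g + ((if ch g = 0 then 2 else 0) + if ch g = 1 then 1 else 0)) := by
    refine Finset.sum_le_sum fun g _ => ?_
    split_ifs <;> omega
  rw [Finset.sum_add_distrib, Finset.sum_add_distrib, ← Finset.sum_filter, ← Finset.sum_filter,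
    Finset.sum_const, Finset.sum_const, Finset.sum_const, smul_eq_mul, smul_eq_mul,
    smul_eq_mul] at hpt
  have hB : (P.filter fun g => ch g = 0).card ≤ Fintype.card {g // N.Proper g ∧ N.Bottom g} := by
    rw [Fintype.card_subtype]
    refine Finset.card_le_card fun g hg => ?_
    obtain ⟨h1, h2⟩ := Finset.mem_filter.1 hg
    refine Finset.mem_filter.2 ⟨Finset.mem_univ _, (Finset.mem_filter.1 h1).2, fun a ha => ?_⟩
    have := Finset.card_eq_zero.1 h2
    exact Finset.notMem_empty a (this ▸ Finset.mem_filter.2 ⟨Finset.mem_univ _, ha⟩)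
  have hA : (P.filter fun g => ch g = 1).card ≤ (P.filter fun g => ¬ ChainTop N g).card := by
    have hch : ∀ g, g ∈ P.filter (fun g => ch g = 1) →
        ∃ c, N.Child c g ∧ ∀ c', N.Child c' g → c' = c := by
      intro g hg
      obtain ⟨c, hc⟩ := Finset.card_eq_one.1 (Finset.mem_filter.1 hg).2
      have hmem : ∀ c', N.Child c' g ↔ c' = c := fun c' => by
        rw [← Finset.mem_singleton, ← hc]; simp
      exact ⟨c, (hmem c).2 rfl, fun c' => (hmem c').1⟩
    choose! u hu1 hu2 using hch
    refine Finset.card_le_card_of_injOn u (fun g hg => ?_) fun g hg g' hg' heq => ?_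
    · have h1 := hu1 g hg
      refine Finset.mem_coe.2 (Finset.mem_filter.2
        ⟨Finset.mem_filter.2 ⟨Finset.mem_univ _, g, h1⟩, not_not.2 ⟨g, h1, ?_, hu2 g hg⟩⟩)
      exact hN.ne_out (Finset.mem_filter.1 (Finset.mem_filter.1 hg).1).2
    · have h1 := hu1 g hg
      rw [heq] at h1
      exact hN.inv.child_unique h1 (hu1 g' hg')
  have hS : Fintype.card {g // N.Proper g ∧ ChainTop N g} = (P.filter (ChainTop N)).card := by
    rw [Fintype.card_subtype, Finset.filter_filter]
  have hsplit := Finset.card_filter_add_card_filter_not (s := P) (ChainTop N)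
  rw [hS]
  omega

open Classical in
/-- A reduced net has linearly many occurrences of literals. -/
theorem card_occurrences (hN : N.Reduced) (hout : ∀ x, N.edge (Sum.inl x) N.out = false)
    (hγ : EmbedsInGenus N.graph γ) (hle : γ ≤ Fintype.card L) :
    Fintype.card {p : L × Γ // N.edge (Sum.inl p.1) p.2 = true} ≤ 138 * Fintype.card L := by
  have hb := hN.card_bottom hγ
  have ht := hN.card_chainTop
  obtain ⟨f, hf⟩ := exists_isClimb hN.inv (ChainTop N) fun g hg => by
    obtain ⟨h, h1, h2, -⟩ := not_not.1 hg
    exact ⟨h, h1, h2⟩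
  have hfT : ∀ g, N.Proper g → N.Proper (f g) ∧ ChainTop N (f g) := fun g hg =>
    ⟨hf.invariant hN.inv hN.proper_up hg, hf.target_apply hN.inv g⟩
  let T := {g // N.Proper g ∧ ChainTop N g}
  let R : L → T → Prop := fun x s => ∃ g, N.edge (Sum.inl x) g = true ∧ N.Proper g ∧ f g = s.1
  let q : L ⊕ Γ → Option (L ⊕ T) := Sum.elim (fun x => some (Sum.inl x)) fun g =>
    if h : N.Proper g then some (Sum.inr ⟨f g, hfT g h⟩) else none
  have hqg : ∀ (g : Γ) (s : T), N.Proper g → f g = s.1 → q (Sum.inr g) = some (Sum.inr s) := by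
    rintro g ⟨s, hs⟩ hg hgs
    dsimp only at hgs
    subst hgs
    simp only [q, Sum.elim_inr]
    rw [dif_pos hg]
  have hbound := card_relation_le hγ R q (Sum.map id Subtype.val) ?_ ?_
  -- Contracting the chains loses no occurrence: two gates of a chain lie on a path, so a literal
  -- feeds at most one of them.
  · have hinj : Fintype.card {p : L × Γ // N.edge (Sum.inl p.1) p.2 = true} ≤
        Nat.card {p : L × T // R p.1 p.2} := by
      rw [← Nat.card_eq_fintype_card]
      have hprop : ∀ p : {p : L × Γ // N.edge (Sum.inl p.1) p.2 = true}, N.Proper p.1.2 := by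
        rintro ⟨⟨x, g⟩, hp⟩
        refine hN.proper hp ?_
        rintro rfl
        rw [hout] at hp
        cases hp
      refine Nat.card_le_card_of_injective (fun p => (⟨(p.1.1, ⟨f p.1.2, hfT _ (hprop p)⟩),
        p.1.2, p.2, hprop p, rfl⟩ : {p : L × T // R p.1 p.2})) ?_
      rintro ⟨⟨x, g⟩, hp⟩ ⟨⟨x', g'⟩, hp'⟩ heq
      simp only [Subtype.mk.injEq, Prod.mk.injEq] at heq
      obtain ⟨rfl, heq⟩ := heq
      have : g = g' := by
        rcases hN.chain_comparable hf (congrArg Subtype.val heq) with h | h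
        · rcases Relation.reflTransGen_iff_eq_or_transGen.1 h with h | h
          · exact h.symm
          · exact absurd h (hN.literal_unique hp' hp)
        · rcases Relation.reflTransGen_iff_eq_or_transGen.1 h with h | h
          · exact h
          · exact absurd h (hN.literal_unique hp hp')
      subst this
      rfl
    rw [Nat.card_eq_fintype_card (α := L), Nat.card_eq_fintype_card (α := T)] at hbound
    -- The constant: `2(n + 2(11n + 22γ)) + 4γ = 46n + 92γ`, which is at most `138n` as `γ ≤ n`.
    have : Fintype.card T ≤ 2 * Fintype.card {g // N.Proper g ∧ N.Bottom g} := ht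
    omega
  · rintro (x | g) w hw
    · obtain rfl := Option.some.inj (show some (Sum.inl x) = some w from hw)
      exact Relation.ReflTransGen.refl
    · by_cases h : N.Proper g
      · have h1 := hqg g ⟨f g, hfT g h⟩ h rfl
        obtain rfl := Option.some.inj (h1.symm.trans hw)
        exact hf.connected hN.inv hN.proper_up h fun a ha hag => hqg a _ ha hag
      · simp only [q, Sum.elim_inr, dif_neg h] at hw
        cases hw
  · rintro x s ⟨g, hx, hg, hgs⟩
    exact ⟨_, _, graph_adj_of_edge hN.inv (hN.ne_out hg) hx, rfl, hqg g s hg hgs⟩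

end Reduced

end Net

/-! ### A language of bounded loops for random access machines -/

namespace RAM

/-- Expressions.  `bound` is the common bound of all loops. -/
inductive Ex
  | const (k : ℕ)
  | reg (r : ℕ)
  | bound
  | add (a b : Ex)
  | sub (a b : Ex)
  | load (A : ℕ) (i : Ex)

/-- Statements.  `loop r p` executes `p` with `0, 1, …, bound - 1` in the register `r`. -/
inductive St
  | skip
  | assign (r : ℕ) (e : Ex)
  | store (A : ℕ) (i e : Ex)
  | seq (p q : St)
  | ite (e : Ex) (p q : St)
  | loop (r : ℕ) (p : St)

/-- The value of an expression. -/
def Ex.eval (N : ℕ) (s : State) : Ex → ℕ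
  | const k => k
  | reg r => s.reg r
  | bound => N
  | add a b => a.eval N s + b.eval N s
  | sub a b => a.eval N s - b.eval N s
  | load A i => s.arr A (i.eval N s)

/-- Iterate `f 0`, `f 1`, …, `f (k - 1)`. -/
def iter (f : ℕ → State → State) : ℕ → State → State
  | 0, s => s
  | k + 1, s => f k (iter f k s)

/-- The effect of a statement. -/
def St.run (N : ℕ) : St → State → State
  | skip, s => s
  | assign r e, s => s.setReg r (e.eval N s)
  | store A i e, s => s.setArr A (i.eval N s) (e.eval N s)
  | seq p q, s => q.run N (p.run N s)
  | ite e p q, s => if e.eval N s ≠ 0 then p.run N s else q.run N s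
  | loop r p, s => iter (fun j t => p.run N (t.setReg r j)) N s

/-- The number of steps of a compiled expression. -/
def Ex.cost : Ex → ℕ
  | const _ => 1
  | reg _ => 2
  | bound => 2
  | add a b => a.cost + b.cost + 1
  | sub a b => a.cost + b.cost + 1
  | load _ i => i.cost + 1

open Polynomial in
/-- A bound for the number of steps of a compiled statement. -/
noncomputable def St.cost : St → Polynomial ℕ
  | skip => 1
  | assign _ e => C (e.cost + 2)
  | store _ i e => C (i.cost + e.cost + 1)
  | seq p q => p.cost + q.cost
  | ite e p q => C (e.cost + 1) + (p.cost + q.cost)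
  | loop _ p => X * (p.cost + 4) + 3

/-- The nesting depth of the loops. -/
def St.height : St → ℕ
  | skip => 0
  | assign _ _ => 0
  | store _ _ _ => 0
  | seq p q => max p.height q.height
  | ite _ p q => max p.height q.height
  | loop _ p => p.height + 1

/-- The registers `3 * r` hold the variables, `3 * k + 1` are temporary, the register `2` holds the
bound and `3 * h + 5` counts a loop of height `h + 1`.  The value is left in `3 * k + 1`. -/
def Ex.compile : Ex → ℕ → Prog
  | const c, k => .const (3 * k + 1) c
  | reg r, k => .seq (.const (3 * k + 4) 0) (.add (3 * k + 1) (3 * r) (3 * k + 4))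
  | bound, k => .seq (.const (3 * k + 4) 0) (.add (3 * k + 1) 2 (3 * k + 4))
  | add a b, k => .seq (.seq (a.compile k) (b.compile (k + 1)))
      (.add (3 * k + 1) (3 * k + 1) (3 * k + 4))
  | sub a b, k => .seq (.seq (a.compile k) (b.compile (k + 1)))
      (.sub (3 * k + 1) (3 * k + 1) (3 * k + 4))
  | load A i, k => .seq (i.compile k) (.load (3 * k + 1) A (3 * k + 1))

/-- The body of a compiled loop with counter `c`. -/
def loopBody (r c : ℕ) (p : Prog) : Prog :=
  .seq (.sub (3 * r) 2 c) (.seq p (.seq (.const 1 1) (.sub c c 1)))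

/-- Compilation of statements. -/
def St.compile : St → Prog
  | skip => .const 1 0
  | assign r e => .seq (e.compile 0) (.seq (.const 4 0) (.add (3 * r) 1 4))
  | store A i e => .seq (.seq (i.compile 0) (e.compile 1)) (.store A 1 4)
  | seq p q => .seq p.compile q.compile
  | ite e p q => .seq (e.compile 0) (.ite 1 p.compile q.compile)
  | loop r p => .seq (.seq (.const 1 0) (.add (3 * p.height + 5) 2 1))
      (.while (3 * p.height + 5) (loopBody r (3 * p.height + 5) p.compile))

/-- The machine state `σ` represents the state `s`. -/
structure Sim (N : ℕ) (s σ : State) : Prop where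
  bound : σ.reg 2 = N
  reg : ∀ r, σ.reg (3 * r) = s.reg r
  arr : σ.arr = s.arr

@[simp] theorem setReg_reg (s : State) (r v x : ℕ) :
    (s.setReg r v).reg x = if x = r then v else s.reg x := by
  simp [State.setReg, Function.update_apply]

@[simp] theorem setReg_arr (s : State) (r v : ℕ) : (s.setReg r v).arr = s.arr := rfl

@[simp] theorem setArr_reg (s : State) (A i v : ℕ) : (s.setArr A i v).reg = s.reg := rfl

theorem setArr_arr (s : State) (A i v B j : ℕ) :
    (s.setArr A i v).arr B j = if B = A ∧ j = i then v else s.arr B j := by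
  by_cases hB : B = A
  · subst hB
    simp [State.setArr, Function.update_apply]
  · simp [State.setArr, hB]

/-- Temporaries occupy the registers congruent to 1 modulo 3, which the represented state does not
see. -/
theorem Sim.of_eq {N : ℕ} {s σ σ' : State} (h : Sim N s σ) (harr : σ'.arr = σ.arr)
    (hreg : ∀ x, x % 3 ≠ 1 → σ'.reg x = σ.reg x) : Sim N s σ' where
  bound := (hreg 2 (by norm_num)).trans h.bound
  reg r := (hreg _ (by omega)).trans (h.reg r)
  arr := harr.trans h.arr

/-- An expression compiled at level `k` overwrites only temporaries from `3 * k + 1` on. The second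
operand, compiled at level `k + 1`, thus leaves the value of the first intact. -/
theorem Ex.exec_compile {N : ℕ} {s : State} (e : Ex) : ∀ {σ : State} (k : ℕ), Sim N s σ →
    ∃ σ', Exec (e.compile k) σ e.cost σ' ∧ σ'.reg (3 * k + 1) = e.eval N s ∧ σ'.arr = σ.arr ∧
      ∀ x, (x % 3 ≠ 1 ∨ x < 3 * k + 1) → σ'.reg x = σ.reg x := by
  have hbin : ∀ (a b : Ex), (∀ {σ : State} (k : ℕ), Sim N s σ →
      ∃ σ', Exec (a.compile k) σ a.cost σ' ∧ σ'.reg (3 * k + 1) = a.eval N s ∧ σ'.arr = σ.arr ∧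
      ∀ x, (x % 3 ≠ 1 ∨ x < 3 * k + 1) → σ'.reg x = σ.reg x) →
      (∀ {σ : State} (k : ℕ), Sim N s σ →
      ∃ σ', Exec (b.compile k) σ b.cost σ' ∧ σ'.reg (3 * k + 1) = b.eval N s ∧ σ'.arr = σ.arr ∧
      ∀ x, (x % 3 ≠ 1 ∨ x < 3 * k + 1) → σ'.reg x = σ.reg x) →
      ∀ {σ : State} (k : ℕ), Sim N s σ →
      ∃ σ', Exec (.seq (a.compile k) (b.compile (k + 1))) σ (a.cost + b.cost) σ' ∧
      σ'.reg (3 * k + 1) = a.eval N s ∧ σ'.reg (3 * k + 4) = b.eval N s ∧ σ'.arr = σ.arr ∧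
      ∀ x, (x % 3 ≠ 1 ∨ x < 3 * k + 1) → σ'.reg x = σ.reg x := by
    intro a b iha ihb σ k h
    obtain ⟨σ₁, h1, h2, h3, h4⟩ := iha k h
    obtain ⟨σ₂, h5, h6, h7, h8⟩ := ihb (k + 1) (h.of_eq h3 fun x hx => h4 x (Or.inl hx))
    refine ⟨σ₂, Exec.seq _ _ _ _ _ _ _ h1 h5, ?_, h6, h7.trans h3, fun x hx => ?_⟩
    · rw [h8 _ (by omega), h2]
    · rw [h8 x (by omega), h4 x hx]
  induction e with
  | const c =>
    intro σ k h
    refine ⟨_, Exec.const _ _ _, by simp [eval], rfl, fun x hx => ?_⟩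
    rw [setReg_reg, if_neg (by omega)]
  | reg r =>
    intro σ k h
    refine ⟨_, Exec.seq _ _ _ _ _ _ _ (Exec.const _ _ _) (Exec.add _ _ _ _), ?_, rfl,
      fun x hx => ?_⟩
    · simp only [setReg_reg, if_true, eval]
      rw [if_neg (by omega), h.reg, add_zero]
    · rw [setReg_reg, if_neg (by omega), setReg_reg, if_neg (by omega)]
  | bound =>
    intro σ k h
    refine ⟨_, Exec.seq _ _ _ _ _ _ _ (Exec.const _ _ _) (Exec.add _ _ _ _), ?_, rfl,
      fun x hx => ?_⟩
    · simp only [setReg_reg, if_true, eval]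
      rw [if_neg (by omega), h.bound, add_zero]
    · rw [setReg_reg, if_neg (by omega), setReg_reg, if_neg (by omega)]
  | add a b iha ihb =>
    intro σ k h
    obtain ⟨σ', h1, h2, h3, h4, h5⟩ := hbin a b iha ihb k h
    refine ⟨_, Exec.seq _ _ _ _ _ _ _ h1 (Exec.add _ _ _ _), ?_, h4, fun x hx => ?_⟩
    · rw [setReg_reg, if_pos rfl, h2, h3, eval]
    · rw [setReg_reg, if_neg (by omega), h5 x hx]
  | sub a b iha ihb =>
    intro σ k h
    obtain ⟨σ', h1, h2, h3, h4, h5⟩ := hbin a b iha ihb k h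
    refine ⟨_, Exec.seq _ _ _ _ _ _ _ h1 (Exec.sub _ _ _ _), ?_, h4, fun x hx => ?_⟩
    · rw [setReg_reg, if_pos rfl, h2, h3, eval]
    · rw [setReg_reg, if_neg (by omega), h5 x hx]
  | load A i ih =>
    intro σ k h
    obtain ⟨σ', h1, h2, h3, h4⟩ := ih k h
    refine ⟨_, Exec.seq _ _ _ _ _ _ _ h1 (Exec.load _ _ _ _), ?_, h3, fun x hx => ?_⟩
    · rw [setReg_reg, if_pos rfl, h2, h3, h.arr, eval]
    · rw [setReg_reg, if_neg (by omega), h4 x hx]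

/-- The counter runs down to zero while the loop variable, recomputed as bound minus counter, runs
up. The body must respect the counter `c` and those of all enclosing loops, which are larger. -/
theorem exec_loop {N r c m : ℕ} {p : Prog} {f : State → State} {s₀ : State} (hc : c % 3 = 2)
    (hc' : 5 ≤ c)
    (hp : ∀ s σ, Sim N s σ → ∃ k σ', Exec p σ k σ' ∧ k ≤ m ∧ Sim N (f s) σ' ∧
      ∀ h, c ≤ 3 * h + 5 → σ'.reg (3 * h + 5) = σ.reg (3 * h + 5)) :
    ∀ i, i ≤ N → ∀ σ, Sim N (iter (fun j t => f (t.setReg r j)) (N - i) s₀) σ → σ.reg c = i →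
      ∃ k σ', Exec (.while c (loopBody r c p)) σ k σ' ∧ k ≤ i * (m + 4) + 1 ∧
        Sim N (iter (fun j t => f (t.setReg r j)) N s₀) σ' ∧
        ∀ h, c < 3 * h + 5 → σ'.reg (3 * h + 5) = σ.reg (3 * h + 5) := by
  intro i
  induction i with
  | zero =>
    intro _ σ hσ hcnt
    exact ⟨1, σ, Exec.while_false _ _ _ hcnt, by omega, hσ, fun _ _ => rfl⟩
  | succ i ih =>
    intro hi σ hσ hcnt
    have hsim : Sim N ((iter (fun j t => f (t.setReg r j)) (N - (i + 1)) s₀).setReg r (N - (i + 1)))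
        (σ.setReg (3 * r) (σ.reg 2 - σ.reg c)) := by
      refine ⟨?_, fun x => ?_, hσ.arr⟩
      · rw [setReg_reg, if_neg (by omega), hσ.bound]
      · rw [setReg_reg, setReg_reg, hσ.bound, hcnt, hσ.reg]
        by_cases hx : x = r
        · rw [if_pos (by omega), if_pos hx]
        · rw [if_neg (by omega), if_neg hx]
    obtain ⟨k, σ₁, h1, h2, h3, h4⟩ := hp _ _ hsim
    obtain ⟨h, rfl⟩ : ∃ h, c = 3 * h + 5 := ⟨(c - 5) / 3, by omega⟩
    let σ₂ := (σ₁.setReg 1 1).setReg (3 * h + 5) ((σ₁.setReg 1 1).reg (3 * h + 5) -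
      (σ₁.setReg 1 1).reg 1)
    have hstep : iter (fun j t => f (t.setReg r j)) (N - i) s₀ =
        f ((iter (fun j t => f (t.setReg r j)) (N - (i + 1)) s₀).setReg r (N - (i + 1))) := by
      rw [show N - i = (N - (i + 1)) + 1 by omega]
      rfl
    have hσ₂ : Sim N (iter (fun j t => f (t.setReg r j)) (N - i) s₀) σ₂ := by
      rw [hstep]
      refine ⟨?_, fun x => ?_, h3.arr⟩
      · simp only [σ₂, setReg_reg]
        rw [if_neg (by omega), if_neg (by omega), h3.bound]
      · simp only [σ₂, setReg_reg]
        rw [if_neg (by omega), if_neg (by omega), h3.reg]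
    have hcnt₂ : σ₂.reg (3 * h + 5) = i := by
      simp only [σ₂, setReg_reg, if_true]
      rw [if_neg (by omega), h4 h le_rfl, setReg_reg, if_neg (by omega), hcnt]
      omega
    obtain ⟨k', σ₃, h5, h6, h7, h8⟩ := ih (by omega) σ₂ hσ₂ hcnt₂
    refine ⟨1 + (k + (1 + 1)) + k' + 1, σ₃, Exec.while_true _ _ _ _ _ _ _ (by omega) ?_ h5, ?_, h7,
      fun h' hh' => ?_⟩
    · exact Exec.seq _ _ _ _ _ _ _ (Exec.sub _ _ _ _) (Exec.seq _ _ _ _ _ _ _ h1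
        (Exec.seq _ _ _ _ _ _ _ (Exec.const _ _ _) (Exec.sub _ _ _ _)))
    · rw [Nat.succ_mul]
      omega
    · rw [h8 h' hh']
      simp only [σ₂, setReg_reg]
      rw [if_neg (by omega), if_neg (by omega), h4 h' hh'.le, setReg_reg, if_neg (by omega)]

/-- The last clause carries the induction at loops: a loop around `p` uses the counter numbered by
the height of `p`, and `p` only touches counters of smaller number. -/
theorem St.exec_compile {N : ℕ} (p : St) : ∀ s σ, Sim N s σ →
    ∃ k σ', Exec p.compile σ k σ' ∧ k ≤ p.cost.eval N ∧ Sim N (p.run N s) σ' ∧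
      ∀ h, p.height ≤ h → σ'.reg (3 * h + 5) = σ.reg (3 * h + 5) := by
  induction p with
  | skip =>
    intro s σ hσ
    refine ⟨1, _, Exec.const _ _ _, by simp [cost], hσ.of_eq rfl fun x hx => ?_, fun h _ => ?_⟩
    · rw [setReg_reg, if_neg (by omega)]
    · rw [setReg_reg, if_neg (by omega)]
  | assign r e =>
    intro s σ hσ
    obtain ⟨σ₁, h1, h2, h3, h4⟩ := e.exec_compile 0 hσ
    refine ⟨_, _, Exec.seq _ _ _ _ _ _ _ h1 (Exec.seq _ _ _ _ _ _ _ (Exec.const _ _ _)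
      (Exec.add _ _ _ _)), by simp [cost], ⟨?_, fun x => ?_, h3.trans hσ.arr⟩, fun h _ => ?_⟩
    · simp only [setReg_reg]
      rw [if_neg (by omega), if_neg (by omega), h4 _ (by omega), hσ.bound]
    · simp only [setReg_reg, run]
      by_cases hx : x = r
      · rw [if_pos (by omega), if_pos hx, if_neg (by omega), if_pos trivial, add_zero]
        exact h2
      · rw [if_neg (by omega), if_neg (by omega), if_neg hx, h4 _ (by omega), hσ.reg]
    · simp only [setReg_reg]
      rw [if_neg (by omega), if_neg (by omega), h4 _ (by omega)]
  | store A i e =>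
    intro s σ hσ
    obtain ⟨σ₁, h1, h2, h3, h4⟩ := i.exec_compile 0 hσ
    obtain ⟨σ₂, h5, h6, h7, h8⟩ := e.exec_compile 1 (hσ.of_eq h3 fun x hx => h4 x (Or.inl hx))
    have hreg : ∀ x, x % 3 ≠ 1 → σ₂.reg x = σ.reg x := fun x hx => by
      rw [h8 x (Or.inl hx), h4 x (Or.inl hx)]
    refine ⟨_, _, Exec.seq _ _ _ _ _ _ _ (Exec.seq _ _ _ _ _ _ _ h1 h5) (Exec.store _ _ _ _),
      by simp [cost], ⟨?_, fun x => ?_, ?_⟩, fun h _ => ?_⟩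
    · exact (hreg 2 (by norm_num)).trans hσ.bound
    · exact (hreg _ (by omega)).trans (hσ.reg x)
    · have e1 : σ₂.reg 1 = i.eval N s := (h8 1 (by omega)).trans h2
      have e2 : σ₂.reg 4 = e.eval N s := h6
      simp only [State.setArr, run, e1, e2]
      rw [h7, h3, hσ.arr]
    · exact hreg _ (by omega)
  | seq p q ihp ihq =>
    intro s σ hσ
    obtain ⟨k, σ₁, h1, h2, h3, h4⟩ := ihp s σ hσ
    obtain ⟨k', σ₂, h5, h6, h7, h8⟩ := ihq _ σ₁ h3
    refine ⟨_, σ₂, Exec.seq _ _ _ _ _ _ _ h1 h5, ?_, h7, fun h hh => ?_⟩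
    · rw [cost, Polynomial.eval_add]
      omega
    · rw [height] at hh
      rw [h8 h (by omega), h4 h (by omega)]
  | ite e p q ihp ihq =>
    intro s σ hσ
    obtain ⟨σ₁, h1, h2, h3, h4⟩ := e.exec_compile 0 hσ
    have hσ₁ := hσ.of_eq h3 fun x hx => h4 x (Or.inl hx)
    have hcost : ((ite e p q).cost).eval N = e.cost + 1 + (p.cost.eval N + q.cost.eval N) := by
      simp [cost]
    have hr : σ₁.reg 1 = e.eval N s := h2
    by_cases he : e.eval N s = 0
    · obtain ⟨k, σ₂, h5, h6, h7, h8⟩ := ihq s σ₁ hσ₁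
      refine ⟨_, σ₂, Exec.seq _ _ _ _ _ _ _ h1 (Exec.ite_false _ _ _ _ _ _ (hr.trans he) h5), ?_,
        ?_, fun h hh => ?_⟩
      · omega
      · simpa [run, he] using h7
      · rw [height] at hh
        rw [h8 h (by omega), h4 _ (by omega)]
    · obtain ⟨k, σ₂, h5, h6, h7, h8⟩ := ihp s σ₁ hσ₁
      refine ⟨_, σ₂, Exec.seq _ _ _ _ _ _ _ h1
        (Exec.ite_true _ _ _ _ _ _ (by rw [hr]; exact he) h5), ?_, ?_, fun h hh => ?_⟩
      · omega
      · simpa [run, he] using h7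
      · rw [height] at hh
        rw [h8 h (by omega), h4 _ (by omega)]
  | loop r p ih =>
    intro s σ hσ
    let σ₁ := (σ.setReg 1 0).setReg (3 * p.height + 5)
      ((σ.setReg 1 0).reg 2 + (σ.setReg 1 0).reg 1)
    have hσ₁ : Sim N s σ₁ := by
      refine ⟨?_, fun x => ?_, hσ.arr⟩
      · simp only [σ₁, setReg_reg]
        rw [if_neg (by omega), if_neg (by omega), hσ.bound]
      · simp only [σ₁, setReg_reg]
        rw [if_neg (by omega), if_neg (by omega), hσ.reg]
    have hcnt : σ₁.reg (3 * p.height + 5) = N := by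
      simp only [σ₁, setReg_reg, if_true]
      rw [if_neg (by omega), hσ.bound, add_zero]
    obtain ⟨k, σ₂, h1, h2, h3, h4⟩ := exec_loop (N := N) (r := r) (c := 3 * p.height + 5)
      (m := p.cost.eval N) (p := p.compile) (f := p.run N) (s₀ := s) (by omega) (by omega)
      (fun s σ hσ => by
        obtain ⟨k, σ', h1, h2, h3, h4⟩ := ih s σ hσ
        exact ⟨k, σ', h1, h2, h3, fun h hh => h4 h (by omega)⟩)
      N le_rfl σ₁ (by simpa [iter] using hσ₁) hcnt
    refine ⟨_, σ₂, Exec.seq _ _ _ _ _ _ _ (Exec.seq _ _ _ _ _ _ _ (Exec.const _ _ _)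
      (Exec.add _ _ _ _)) h1, ?_, h3, fun h hh => ?_⟩
    · have : ((loop r p).cost).eval N = N * (p.cost.eval N + 4) + 3 := by simp [cost]
      omega
    · rw [height] at hh
      rw [h4 h (by omega)]
      simp only [σ₁, setReg_reg]
      rw [if_neg (by omega), if_neg (by omega)]

/-- Every statement is realised by a program that takes the sum of the first two numbers of the
input as the bound. -/
theorem exists_prog (p : St) : ∃ (P : Prog) (c : Polynomial ℕ), ∀ w : List ℕ, ∃ k σ,
    Exec P (init w) k σ ∧ k ≤ c.eval (w.getD 0 0 + w.getD 1 0) ∧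
      σ.arr = (p.run (w.getD 0 0 + w.getD 1 0) (init w)).arr := by
  refine ⟨.seq (.seq (.const 1 0) (.seq (.load 4 0 1) (.seq (.const 1 1) (.seq (.load 7 0 1)
    (.add 2 4 7))))) p.compile, 5 + p.cost, fun w => ?_⟩
  obtain ⟨σ₀, hpre, hσ₀⟩ : ∃ σ₀, Exec (.seq (.const 1 0) (.seq (.load 4 0 1) (.seq (.const 1 1)
      (.seq (.load 7 0 1) (.add 2 4 7))))) (init w) (1 + (1 + (1 + (1 + 1)))) σ₀ ∧
      Sim (w.getD 0 0 + w.getD 1 0) (init w) σ₀ := by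
    refine ⟨_, Exec.seq _ _ _ _ _ _ _ (Exec.const 1 0 (init w)) (Exec.seq _ _ _ _ _ _ _
      (Exec.load 4 0 1 _) (Exec.seq _ _ _ _ _ _ _ (Exec.const 1 1 _) (Exec.seq _ _ _ _ _ _ _
      (Exec.load 7 0 1 _) (Exec.add 2 4 7 _)))), ⟨?_, fun r => ?_, rfl⟩⟩
    · simp [init]
    · simp only [setReg_reg]
      rw [if_neg (by omega), if_neg (by omega), if_neg (by omega), if_neg (by omega),
        if_neg (by omega)]
      rfl
  obtain ⟨k, σ, h1, h2, h3, -⟩ := p.exec_compile (init w) σ₀ hσ₀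
  refine ⟨_, σ, Exec.seq _ _ _ _ _ _ _ hpre h1, ?_, h3.arr⟩
  rw [Polynomial.eval_add]
  have : Polynomial.eval (w.getD 0 0 + w.getD 1 0) (5 : Polynomial ℕ) = 5 := by simp
  omega

end RAM

/-! ### Reasoning about statements -/

namespace RAM

/-- The statement does not assign the register `r`. -/
def St.Keeps (r : ℕ) : St → Prop
  | skip => True
  | assign r' _ => r ≠ r'
  | store _ _ _ => True
  | seq p q => p.Keeps r ∧ q.Keeps r
  | ite _ p q => p.Keeps r ∧ q.Keeps r
  | loop r' p => r ≠ r' ∧ p.Keeps r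

/-- The statement does not write to the array `A`. -/
def St.KeepsArr (A : ℕ) : St → Prop
  | skip => True
  | assign _ _ => True
  | store A' _ _ => A ≠ A'
  | seq p q => p.KeepsArr A ∧ q.KeepsArr A
  | ite _ p q => p.KeepsArr A ∧ q.KeepsArr A
  | loop _ p => p.KeepsArr A

/-- The loop-invariant rule; every loop of the algorithm is verified through it. -/
theorem iter_induction {f : ℕ → State → State} {s : State} {k : ℕ} {P : ℕ → State → Prop}
    (h₀ : P 0 s) (h : ∀ j t, j < k → P j t → P (j + 1) (f j t)) : P k (iter f k s) := by
  have : ∀ j, j ≤ k → P j (iter f j s) := by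
    intro j
    induction j with
    | zero => exact fun _ => h₀
    | succ j ih => exact fun hj => h j _ (by omega) (ih (by omega))
  exact this k le_rfl

variable {K : ℕ}

theorem St.run_reg {r : ℕ} (p : St) (h : p.Keeps r) (s : State) : (p.run K s).reg r = s.reg r := by
  induction p generalizing s with
  | skip => rfl
  | assign r' e => rw [run, setReg_reg, if_neg h]
  | store A i e => rfl
  | seq p q ihp ihq => rw [run, ihq h.2, ihp h.1]
  | ite e p q ihp ihq =>
    rw [run]
    split_ifs
    · exact ihp h.1 s
    · exact ihq h.2 s
  | loop r' p ih =>
    refine iter_induction (P := fun _ t => t.reg r = s.reg r) rfl fun j t _ ht => ?_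
    rw [ih h.2, setReg_reg, if_neg h.1, ht]

theorem St.run_arr {A : ℕ} (p : St) (h : p.KeepsArr A) (s : State) :
    (p.run K s).arr A = s.arr A := by
  induction p generalizing s with
  | skip => rfl
  | assign r' e => rfl
  | store A' i e =>
    funext j
    rw [run, setArr_arr, if_neg fun h' => h h'.1]
  | seq p q ihp ihq => rw [run, ihq h.2, ihp h.1]
  | ite e p q ihp ihq =>
    rw [run]
    split_ifs
    · exact ihp h.1 s
    · exact ihq h.2 s
  | loop r' p ih =>
    refine iter_induction (P := fun _ t => t.arr A = s.arr A) rfl fun j t _ ht => ?_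
    rw [ih h, setReg_arr, ht]

/-- Conditional execution. -/
def St.cond (e : Ex) (p : St) : St := .ite e p .skip

theorem St.run_cond_pos {e : Ex} {p : St} {s : State} (h : e.eval K s ≠ 0) :
    (St.cond e p).run K s = p.run K s := by
  simp [cond, run, h]

theorem St.run_cond_neg {e : Ex} {p : St} {s : State} (h : e.eval K s = 0) :
    (St.cond e p).run K s = s := by
  simp [cond, run, h]

/-- Equality test. -/
def Ex.eq (a b : Ex) : Ex := .sub (.const 1) (.add (.sub a b) (.sub b a))

/-- Inequality test. -/
def Ex.ne (a b : Ex) : Ex := .add (.sub a b) (.sub b a)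

theorem Ex.eval_eq {a b : Ex} {s : State} :
    (Ex.eq a b).eval K s ≠ 0 ↔ a.eval K s = b.eval K s := by
  simp only [Ex.eq, eval]
  omega

theorem Ex.eval_ne {a b : Ex} {s : State} :
    (Ex.ne a b).eval K s ≠ 0 ↔ a.eval K s ≠ b.eval K s := by
  simp only [Ex.ne, eval]
  omega

/-- Sum the values of `e` for all values of the register `4` in the register `3`. -/
def sumLoop (e : Ex) : St :=
  .seq (.assign 3 (.const 0)) (.loop 4 (.assign 3 (.add (.reg 3) e)))

theorem run_sumLoop {e : Ex} {s : State} {F : ℕ → ℕ}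
    (h : ∀ j t, j < K → t.arr = s.arr → t.reg 4 = j →
      (∀ r, r ≠ 3 → r ≠ 4 → t.reg r = s.reg r) → e.eval K t = F j) :
    ((sumLoop e).run K s).arr = s.arr ∧
      ((sumLoop e).run K s).reg 3 = ∑ j ∈ Finset.range K, F j ∧
      ∀ r, r ≠ 3 → r ≠ 4 → ((sumLoop e).run K s).reg r = s.reg r := by
  refine iter_induction (P := fun j t => t.arr = s.arr ∧ t.reg 3 = ∑ i ∈ Finset.range j, F i ∧
    ∀ r, r ≠ 3 → r ≠ 4 → t.reg r = s.reg r) ⟨rfl, ?_, fun r h3 h4 => ?_⟩ ?_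
  · simp [St.run, Ex.eval]
  · rw [St.run, setReg_reg, if_neg h3]
  · rintro j t hj ⟨h1, h2, h3⟩
    refine ⟨h1, ?_, fun r h4 h5 => ?_⟩
    · rw [St.run, setReg_reg, if_pos rfl, Finset.sum_range_succ, Ex.eval, Ex.eval, setReg_reg,
        if_neg (by norm_num), h2, h j _ hj]
      · exact h1
      · simp
      · intro r h4 h5
        rw [setReg_reg, if_neg h5, h3 r h4 h5]
    · rw [St.run, setReg_reg, if_neg h4, setReg_reg, if_neg h5, h3 r h4 h5]

end RAM

/-! ### Nets in the memory of the machine -/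

namespace Net

open RAM

variable {n m : ℕ}

/-- The number of a vertex. -/
def code : Fin n ⊕ Fin m → ℕ := Sum.elim (fun i => i.val) fun g => n + g.val

theorem code_injective : Function.Injective (code : Fin n ⊕ Fin m → ℕ) := by
  rintro (i | g) (j | h) hij
  · exact congrArg _ (Fin.ext hij)
  · have : i.val = n + h.val := hij
    omega
  · have : n + g.val = j.val := hij
    omega
  · have : n + g.val = n + h.val := hij
    exact congrArg _ (Fin.ext (by omega))

theorem code_lt (v : Fin n ⊕ Fin m) : code v < n + m := by
  rcases v with i | g
  · have := i.2
    simp only [code, Sum.elim_inl]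
    omega
  · have := g.2
    simp only [code, Sum.elim_inr]
    omega

theorem exists_code {a : ℕ} (h : a < n + m) : ∃ v : Fin n ⊕ Fin m, code v = a := by
  by_cases ha : a < n
  · exact ⟨Sum.inl ⟨a, ha⟩, rfl⟩
  · exact ⟨Sum.inr ⟨a - n, by omega⟩, by simp only [code, Sum.elim_inr]; omega⟩

open Classical in
/-- The entry of the adjacency matrix, given by numbers. -/
noncomputable def bit (N : Net (Fin n) (Fin m)) (a b : ℕ) : ℕ :=
  if ∃ v g, code v = a ∧ g.val = b ∧ N.edge v g = true then 1 else 0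

theorem bit_ne_zero {N : Net (Fin n) (Fin m)} {a b : ℕ} :
    N.bit a b ≠ 0 ↔ ∃ v g, code v = a ∧ g.val = b ∧ N.edge v g = true := by
  unfold bit
  split_ifs with h
  · exact ⟨fun _ => h, fun _ => one_ne_zero⟩
  · exact ⟨fun h' => absurd rfl h', fun h' => absurd h' h⟩

theorem bit_code (N : Net (Fin n) (Fin m)) (v : Fin n ⊕ Fin m) (g : Fin m) :
    N.bit (code v) g = (N.edge v g).toNat := by
  unfold bit
  cases h : N.edge v g
  · rw [if_neg]
    · rfl
    · rintro ⟨v', g', h1, h2, h3⟩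
      rw [code_injective h1, Fin.ext h2, h] at h3
      cases h3
  · exact if_pos ⟨v, g, rfl, rfl, h⟩

theorem bit_code_ne_zero {N : Net (Fin n) (Fin m)} {v : Fin n ⊕ Fin m} {g : Fin m} :
    N.bit (code v) g ≠ 0 ↔ N.edge v g = true := by
  rw [bit_code]
  cases N.edge v g <;> simp

/-- The number of a gate type. -/
def kindCode : GateKind → ℕ
  | GateKind.and => 0
  | GateKind.or => 1

theorem kindCode_injective : Function.Injective kindCode := by
  intro a b h
  cases a <;> cases b <;> simp_all [kindCode]

/-- The net is stored in the arrays `0` and `2`. -/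
structure Rep (a : ℕ → ℕ → ℕ) (N : Net (Fin n) (Fin m)) : Prop where
  vars : a 0 0 = n
  gates : a 0 1 = m
  out : a 0 2 = N.out
  kind : ∀ g : Fin m, a 0 (3 + g) = kindCode (N.kind g)
  -- The machine cannot multiply, so the row addresses are tabulated. Indices `j ≥ m` denote no
  -- gate; for them `edge` demands zeros, which allows every loop to run to the common bound.
  row : ∀ j, j < n + m → a 2 j = 3 + m + j * (n + m)
  edge : ∀ i j, i < n + m → j < n + m → a 0 (3 + m + j * (n + m) + i) = N.bit i j

theorem Rep.congr {a a' : ℕ → ℕ → ℕ} {N : Net (Fin n) (Fin m)} (h : N.Rep a)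
    (h₀ : a' 0 = a 0) (h₂ : a' 2 = a 2) : N.Rep a' where
  vars := by rw [h₀, h.vars]
  gates := by rw [h₀, h.gates]
  out := by rw [h₀, h.out]
  kind g := by rw [h₀, h.kind]
  row j hj := by rw [h₂, h.row j hj]
  edge i j hi hj := by rw [h₀, h.edge i j hi hj]

/-- The number of variables. -/
def nEx : Ex := .load 0 (.const 0)
/-- The number of gates. -/
def mEx : Ex := .load 0 (.const 1)
/-- The output gate. -/
def outEx : Ex := .load 0 (.const 2)
/-- The type of the gate `g`. -/
def kindEx (g : Ex) : Ex := .load 0 (.add (.const 3) g)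
/-- The entry of the adjacency matrix at `v`, `g`. -/
def edgeEx (v g : Ex) : Ex := .load 0 (.add (.load 2 g) v)
/-- Set the entry of the adjacency matrix at `v`, `g`. -/
def setSt (v g : Ex) (x : ℕ) : St := .store 0 (.add (.load 2 g) v) (.const x)

section Eval

variable {N : Net (Fin n) (Fin m)} {s : State}

theorem Rep.eval_n (h : N.Rep s.arr) : nEx.eval (n + m) s = n := h.vars
theorem Rep.eval_m (h : N.Rep s.arr) : mEx.eval (n + m) s = m := h.gates
theorem Rep.eval_out (h : N.Rep s.arr) : outEx.eval (n + m) s = N.out := h.out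

theorem Rep.eval_kind (h : N.Rep s.arr) {e : Ex} {g : Fin m} (he : e.eval (n + m) s = g) :
    (kindEx e).eval (n + m) s = kindCode (N.kind g) := by
  simp only [kindEx, Ex.eval, he, h.kind]

theorem Rep.eval_edge (h : N.Rep s.arr) {v g : Ex} {i j : ℕ} (hi : i < n + m) (hj : j < n + m)
    (hv : v.eval (n + m) s = i) (hg : g.eval (n + m) s = j) :
    (edgeEx v g).eval (n + m) s = N.bit i j := by
  simp only [edgeEx, Ex.eval, hv, hg, h.row j hj, h.edge i j hi hj]

/-- Uniqueness of division with remainder: writing one matrix entry does not disturb another. -/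
theorem address_injective {K i j i' j' : ℕ} (hi : i < K) (hi' : i' < K)
    (h : j * K + i = j' * K + i') : j = j' ∧ i = i' := by
  rcases lt_trichotomy j j' with hj | rfl | hj
  · have := Nat.mul_le_mul_right K (Nat.succ_le_of_lt hj)
    rw [Nat.succ_mul] at this
    omega
  · exact ⟨rfl, by omega⟩
  · have := Nat.mul_le_mul_right K (Nat.succ_le_of_lt hj)
    rw [Nat.succ_mul] at this
    omega

theorem bit_setEdge (N : Net (Fin n) (Fin m)) (v : Fin n ⊕ Fin m) (g : Fin m) (x : Bool) (i j : ℕ) :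
    (N.setEdge v g x).bit i j = if i = code v ∧ j = g then x.toNat else N.bit i j := by
  split_ifs with h
  · rw [h.1, h.2, bit_code]
    simp [setEdge]
  · have : ∀ v' g', code v' = i → g'.val = j → (N.setEdge v g x).edge v' g' = N.edge v' g' := by
      rintro v' g' rfl rfl
      refine clear_edge_of_ne fun h' => h ?_
      rw [h'.1, h'.2]
      exact ⟨rfl, rfl⟩
    unfold bit
    congr 1
    refine propext (exists_congr fun v' => exists_congr fun g' => and_congr_right fun h1 =>
      and_congr_right fun h2 => ?_)
    rw [this v' g' h1 h2]

theorem Rep.setEdge (h : N.Rep s.arr) {ev eg : Ex} {v : Fin n ⊕ Fin m} {g : Fin m} (x : Bool)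
    (hv : ev.eval (n + m) s = code v) (hg : eg.eval (n + m) s = g) :
    (N.setEdge v g x).Rep ((setSt ev eg x.toNat).run (n + m) s).arr := by
  have hg' : g.val < n + m := by have := g.2; omega
  have harr : ∀ B j, ((setSt ev eg x.toNat).run (n + m) s).arr B j =
      if B = 0 ∧ j = 3 + m + g * (n + m) + code v then x.toNat else s.arr B j := by
    intro B j
    simp only [setSt, St.run, setArr_arr, Ex.eval, hv, hg, h.row g hg']
  -- The header with the sizes, the output and the gate types ends before the matrix and is not
  -- overwritten.
  have hsmall : ∀ j, j < 3 + m → ((setSt ev eg x.toNat).run (n + m) s).arr 0 j = s.arr 0 j := by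
    intro j hj
    rw [harr, if_neg]
    intro h'
    have := h'.2
    omega
  refine ⟨?_, ?_, ?_, fun c => ?_, fun j hj => ?_, fun i j hi hj => ?_⟩
  · rw [hsmall 0 (by omega), h.vars]
  · rw [hsmall 1 (by omega), h.gates]
  · rw [hsmall 2 (by have := g.2; omega), h.out]; rfl
  · rw [hsmall _ (by have := c.2; omega), h.kind]; rfl
  · rw [harr, if_neg (by simp), h.row j hj]
  · rw [harr, bit_setEdge, h.edge i j hi hj]
    by_cases hij : i = code v ∧ j = g
    · rw [if_pos hij, if_pos]
      rw [hij.1, hij.2]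
      exact ⟨rfl, rfl⟩
    · rw [if_neg hij, if_neg]
      rintro ⟨-, h'⟩
      obtain ⟨h1, h2⟩ := address_injective (j := j) (j' := g) hi (code_lt v) (by omega)
      exact hij ⟨h2, h1⟩

end Eval

end Net

/-! ### The reduction rules as statements -/

namespace Net

open RAM

variable {n m : ℕ}

/-- Started in `s` with the net `N` in memory, the statement `p` replaces `N` by a valid
reduction, which differs from `N` if and only if `G` holds. -/
def Step (p : St) (s : State) (N : Net (Fin n) (Fin m)) (G : Prop) : Prop :=
  ∃ M : Net (Fin n) (Fin m), M.Rep (p.run (n + m) s).arr ∧ N.Refines M ∧ (M = N ↔ ¬ G)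

section Step

variable {s : State} {N : Net (Fin n) (Fin m)} {G : Prop}

theorem Rep.of_eq {a : ℕ → ℕ → ℕ} {M : Net (Fin n) (Fin m)} (h : M.Rep a) (hMN : N = M) :
    N.Rep a :=
  hMN ▸ h

theorem step_idle {p : St} (h : N.Rep (p.run (n + m) s).arr) (hN : N.Inv) (hG : ¬ G) :
    Step p s N G :=
  ⟨N, h, Refines.refl hN, fun _ => hG, fun _ => rfl⟩

/-- A rule is a nest of tests. A test that fails must refute the guard; if it succeeds, the body
answers for the guard. -/
theorem step_cond {e : Ex} {p : St} (h : N.Rep s.arr) (hN : N.Inv)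
    (hpos : e.eval (n + m) s ≠ 0 → Step p s N G) (hneg : e.eval (n + m) s = 0 → ¬ G) :
    Step (.cond e p) s N G := by
  by_cases he : e.eval (n + m) s = 0
  · exact step_idle (by rwa [St.run_cond_neg he]) hN (hneg he)
  · obtain ⟨M, h1, h2⟩ := hpos he
    exact ⟨M, by rwa [St.run_cond_pos he], h2⟩

theorem step_clear {ev eg : Ex} {v : Fin n ⊕ Fin m} {g : Fin m} (h : N.Rep s.arr)
    (hv : ev.eval (n + m) s = code v) (hg : eg.eval (n + m) s = g) (hvg : N.edge v g = true)
    (href : N.Refines (N.setEdge v g false)) (hG : G) : Step (setSt ev eg 0) s N G := by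
  refine ⟨_, h.setEdge false hv hg, href, fun heq => ?_, fun h => absurd hG h⟩
  have := (clear_edge (N := N) (a := v) (v := v) (b := g) (g := g)).1
    ((congrArg (fun M => M.edge v g) heq).trans hvg)
  exact absurd ⟨rfl, rfl⟩ this.2

/-- The second guard concerns the intermediate net. If the composite changes nothing, neither part
does, by counting edges, so the guards can all be stated for the original `N`. -/
theorem step_seq {p q : St} {G G' : Net (Fin n) (Fin m) → Prop} (hp : Step p s N (G N))
    (hq : ∀ M : Net (Fin n) (Fin m), M.Rep (p.run (n + m) s).arr → M.Inv →
      Step q (p.run (n + m) s) M (G' M)) : Step (.seq p q) s N (G N ∨ G' N) := by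
  obtain ⟨M, h1, h2, h3⟩ := hp
  obtain ⟨M', h4, h5, h6⟩ := hq M h1 h2.inv
  refine ⟨M', h4, h2.trans h5, fun heq => ?_, fun hG => ?_⟩
  · have hM := h2.eq_of_trans_eq h5 heq
    have hG' := h6.1 (heq.trans hM.symm)
    rw [hM] at hG'
    exact not_or.2 ⟨h3.1 hM, hG'⟩
  · rw [not_or] at hG
    have hM := h3.2 hG.1
    rw [← hM]
    exact h6.2 (hM ▸ hG.2)

/-- As for `step_seq`, an unchanged net was unchanged in every round. The predicate `Q` carries the
registers of the enclosing loops through the body. -/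
theorem step_loop {r : ℕ} {p : St} {Q : State → Prop} {G : ℕ → Net (Fin n) (Fin m) → Prop}
    (hset : ∀ t j, Q t → Q (t.setReg r j)) (hrun : ∀ t, Q t → Q (p.run (n + m) t))
    (hp : ∀ t (M : Net (Fin n) (Fin m)), t.reg r < n + m → Q t → M.Rep t.arr → M.Inv →
      Step p t M (G (t.reg r) M))
    (hQ : Q s) (h : N.Rep s.arr) (hN : N.Inv) :
    Step (.loop r p) s N (∃ j, j < n + m ∧ G j N) := by
  have key := iter_induction (f := fun j t => p.run (n + m) (t.setReg r j)) (s := s) (k := n + m)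
    (P := fun j t => Q t ∧ ∃ M : Net (Fin n) (Fin m), M.Rep t.arr ∧ N.Refines M ∧
      (M = N ↔ ¬ ∃ i, i < j ∧ G i N)) ⟨hQ, N, h, Refines.refl hN, by simp⟩ ?_
  · exact key.2
  · rintro j t hj ⟨hQt, M, h1, h2, h3⟩
    have hreg : (t.setReg r j).reg r = j := by simp
    refine ⟨hrun _ (hset t j hQt), ?_⟩
    obtain ⟨M', h4, h5, h6⟩ := hp (t.setReg r j) M (by rwa [hreg]) (hset t j hQt) h1 h2.inv
    rw [hreg] at h6
    refine ⟨M', h4, h2.trans h5, fun heq => ?_, fun hG => ?_⟩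
    · have hM := h2.eq_of_trans_eq h5 heq
      rintro ⟨i, hi, hGi⟩
      rcases Nat.lt_succ_iff_lt_or_eq.1 hi with hi | rfl
      · exact h3.1 hM ⟨i, hi, hGi⟩
      · exact h6.1 (heq.trans hM.symm) (hM ▸ hGi)
    · have hM := h3.2 fun ⟨i, hi, hGi⟩ => hG ⟨i, by omega, hGi⟩
      rw [← hM]
      refine h6.2 fun hGj => hG ⟨j, by omega, hM ▸ hGj⟩

end Step

/-! #### Indegrees -/

/-- Compute the indegree of the gate in the register `r`. -/
def indegSt (r : ℕ) : St := sumLoop (edgeEx (.reg 4) (.reg r))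

section Sums

variable {N : Net (Fin n) (Fin m)}

theorem run_indegSt {s : State} {r : ℕ} (hr3 : r ≠ 3) (hr4 : r ≠ 4) (h : N.Rep s.arr)
    (hr : s.reg r < n + m) : ((indegSt r).run (n + m) s).arr = s.arr ∧
      ((indegSt r).run (n + m) s).reg 3 = ∑ j ∈ Finset.range (n + m), N.bit j (s.reg r) ∧
      ∀ r', r' ≠ 3 → r' ≠ 4 → ((indegSt r).run (n + m) s).reg r' = s.reg r' := by
  refine run_sumLoop fun j t hj ht htj htr => ?_
  exact Rep.eval_edge (by rwa [ht]) hj hr htj (htr r hr3 hr4)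

theorem bit_le_one (N : Net (Fin n) (Fin m)) (a b : ℕ) : N.bit a b ≤ 1 := by
  unfold bit
  split_ifs <;> simp

theorem sum_bit_lt_two {u : Fin n ⊕ Fin m} {g : Fin m} (hu : N.edge u g = true) :
    ∑ j ∈ Finset.range (n + m), N.bit j g < 2 ↔ ∀ v, N.edge v g = true → v = u := by
  constructor
  · intro h v hv
    by_contra hvu
    have hsub : ({code u, code v} : Finset ℕ) ⊆ Finset.range (n + m) := by
      intro x hx
      rw [Finset.mem_insert, Finset.mem_singleton] at hx
      rcases hx with rfl | rfl
      · exact Finset.mem_range.2 (code_lt u)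
      · exact Finset.mem_range.2 (code_lt v)
    have := Finset.sum_le_sum_of_subset (f := fun j => N.bit j g) hsub
    rw [Finset.sum_pair fun h => hvu (code_injective h).symm, bit_code, bit_code, hu, hv] at this
    simp only [Bool.toNat_true] at this
    omega
  · intro h
    rw [Finset.sum_eq_single (code u)]
    · have := N.bit_le_one (code u) g
      omega
    · intro b _ hb
      by_contra hne
      obtain ⟨v, g', rfl, hg, hv⟩ := bit_ne_zero.1 hne
      rw [Fin.ext hg] at hv
      exact hb (by rw [h v hv])
    · exact fun h' => absurd (Finset.mem_range.2 (code_lt u)) h'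

end Sums

/-! #### Collapsing -/

/-- The loop that moves the inputs of the gate number `reg 2 - n` to the gate `reg 1`. -/
def moveSt : St :=
  .loop 4 (.cond (edgeEx (.reg 4) (.sub (.reg 2) nEx))
    (.seq (setSt (.reg 4) (.reg 1) 1) (setSt (.reg 4) (.sub (.reg 2) nEx) 0)))

/-- Collapse the path `reg 2 → reg 0 → reg 1`. -/
def collapseSt : St :=
  .seq (.seq (setSt (.reg 2) (.reg 0) 0) (setSt (.add nEx (.reg 0)) (.reg 1) 0))
    (.ite (.sub nEx (.reg 2)) (setSt (.reg 2) (.reg 1) 1) moveSt)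

/-- Collapse the path `reg 2 → reg 0 → reg 1` if possible. -/
def collapseRule : St :=
  .cond (edgeEx (.reg 2) (.reg 0)) (.cond (edgeEx (.add nEx (.reg 0)) (.reg 1))
    (.seq (indegSt 0) (.cond (.sub (.const 2) (.reg 3)) collapseSt)))

/-- The path with the numbers `k → i → j` can be collapsed. -/
def CollapseGuard (i j k : ℕ) (N : Net (Fin n) (Fin m)) : Prop :=
  ∃ u g h, g.val = i ∧ h.val = j ∧ code u = k ∧ N.edge u g = true ∧ N.Child g h ∧
    ∀ v, N.edge v g = true → v = u

section Collapse

variable {N : Net (Fin n) (Fin m)} {s : State}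

theorem run_moveSt (hrep : N.Rep s.arr) {h c : Fin m} (hch : c ≠ h) (h1 : s.reg 1 = h)
    (h2 : s.reg 2 = code (Sum.inr c : Fin n ⊕ Fin m)) :
    Rep (moveSt.run (n + m) s).arr { N with
      edge := fun v w => if w = h then N.edge v h || N.edge v c
        else if w = c then false else N.edge v w } := by
  -- The net after the inputs of `c` with number below `j` have been moved to `h`.
  let Mj : ℕ → Net (Fin n) (Fin m) := fun j => { N with
      edge := fun v w => if w = h then N.edge v h || (N.edge v c && decide (code v < j))
        else if w = c then N.edge v c && !decide (code v < j) else N.edge v w }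
  have key := iter_induction (k := n + m) (s := s) (f := fun j t => (St.cond
      (edgeEx (.reg 4) (.sub (.reg 2) nEx)) (.seq (setSt (.reg 4) (.reg 1) 1)
        (setSt (.reg 4) (.sub (.reg 2) nEx) 0))).run (n + m) (t.setReg 4 j))
    (P := fun j t => t.reg 1 = h ∧ t.reg 2 = code (Sum.inr c : Fin n ⊕ Fin m) ∧ (Mj j).Rep t.arr)
    ⟨h1, h2, ?_⟩ ?_
  · have hfin : Mj (n + m) = { N with
        edge := fun v w => if w = h then N.edge v h || N.edge v c
          else if w = c then false else N.edge v w } := by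
      refine Net.ext rfl ?_ rfl
      funext v w
      simp [Mj, code_lt]
    rw [← hfin]
    exact key.2.2
  · have h0 : Mj 0 = N := by
      refine Net.ext rfl ?_ rfl
      funext v w
      simp only [Mj, Nat.not_lt_zero, decide_false, Bool.and_false, Bool.or_false, Bool.not_false,
        Bool.and_true]
      split_ifs with h1 h2
      · rw [h1]
      · rw [h2]
      · rfl
    rwa [h0]
  · rintro j t hj ⟨e1, e2, hM⟩
    obtain ⟨v, hv⟩ := exists_code hj
    have hM' : (Mj j).Rep (t.setReg 4 j).arr := hM
    have hc : (Ex.sub (.reg 2) nEx).eval (n + m) (t.setReg 4 j) = c := by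
      have := hM'.eval_n
      simp only [Ex.eval, this, setReg_reg]
      rw [if_neg (by norm_num), e2]
      simp [code]
    have hr4 : (Ex.reg 4).eval (n + m) (t.setReg 4 j) = code v := by simp [Ex.eval, hv]
    have hcm : c.val < n + m := by have := c.2; omega
    have hbit := hM'.eval_edge (code_lt v) hcm hr4 hc
    rw [bit_code] at hbit
    have hcur : (Mj j).edge v c = N.edge v c := by
      simp [Mj, hch, hv]
    rw [hcur] at hbit
    have hsucc : ∀ w, code w < j + 1 ↔ code w < j ∨ w = v := by
      intro w
      rw [Nat.lt_succ_iff_lt_or_eq, ← hv, code_injective.eq_iff]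
    cases hvc : N.edge v c with
    | false =>
      rw [hvc] at hbit
      rw [St.run_cond_neg hbit]
      refine ⟨by simpa using e1, by simpa using e2, ?_⟩
      have : Mj (j + 1) = Mj j := by
        refine Net.ext rfl ?_ rfl
        funext w z
        by_cases hw : w = v
        · subst hw
          simp only [Mj, hvc, Bool.false_and]
        · simp only [Mj, hsucc, hw, or_false]
      rw [this]
      exact hM
    | true =>
      rw [hvc] at hbit
      rw [St.run_cond_pos (by rw [hbit]; simp)]
      refine ⟨by simpa [St.run, setSt] using e1, by simpa [St.run, setSt] using e2, ?_⟩
      have s1 := hM'.setEdge (ev := .reg 4) (eg := .reg 1) (g := h) true hr4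
        (by simp [Ex.eval, e1])
      have s2 := s1.setEdge (ev := .reg 4) (eg := .sub (.reg 2) nEx) (v := v) (g := c) false
        (by simp [Ex.eval, St.run, setSt, hv]) ?_
      · have : Mj (j + 1) = ((Mj j).setEdge v h true).setEdge v c false := by
          refine Net.ext rfl ?_ rfl
          funext w z
          by_cases hw : w = v
          · subst hw
            by_cases hz : z = h
            · subst hz
              have : ¬ z = c := fun h => hch h.symm
              simp [Mj, Net.setEdge, hvc, hsucc, this]
            · by_cases hz' : z = c
              · subst hz'
                simp [Mj, Net.setEdge, hch, hsucc]
              · simp [Mj, Net.setEdge, hz, hz']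
          · simp only [Mj, Net.setEdge, hsucc, hw, or_false, false_and, if_false]
        rw [this]
        exact s2
      · have := s1.eval_n
        rw [Ex.eval, this]
        simpa [Ex.eval, St.run, setSt, hM'.eval_n] using hc

theorem run_collapseSt (hrep : N.Rep s.arr) {u : Fin n ⊕ Fin m} {g h : Fin m}
    (hc : N.Collapsible u g h) (h0 : s.reg 0 = g) (h1 : s.reg 1 = h) (h2 : s.reg 2 = code u) :
    (N.collapse u g h).Rep (collapseSt.run (n + m) s).arr := by
  have r1 := hrep.setEdge (ev := .reg 2) (eg := .reg 0) false h2 h0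
  have r2 := r1.setEdge (ev := .add nEx (.reg 0)) (eg := .reg 1) (v := Sum.inr g) (g := h) false
    (by
      have := r1.eval_n
      rw [Ex.eval, this]
      simp [Ex.eval, setSt, St.run, h0, code])
    (by simpa [Ex.eval, setSt, St.run] using h1)
  set t := (setSt (.add nEx (.reg 0)) (.reg 1) false.toNat).run (n + m)
    ((setSt (.reg 2) (.reg 0) false.toNat).run (n + m) s) with ht
  have ht1 : t.reg 1 = h := by simpa [ht, setSt, St.run] using h1
  have ht2 : t.reg 2 = code u := by simpa [ht, setSt, St.run] using h2
  change Rep (St.run (n + m) (.ite (.sub nEx (.reg 2)) (setSt (.reg 2) (.reg 1) 1) moveSt) t).arr _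
  -- The truncated difference is positive exactly for literals, whose numbers are below `n`; this
  -- distinguishes the two cases of `expand`.
  have heval : (Ex.sub nEx (.reg 2)).eval (n + m) t = n - code u := by
    have := r2.eval_n
    rw [Ex.eval, this, Ex.eval, ht2]
  have hgh := hc.ne
  cases u with
  | inl i =>
    have hne : (Ex.sub nEx (.reg 2)).eval (n + m) t ≠ 0 := by
      have := i.2
      rw [heval]
      simp only [code, Sum.elim_inl]
      omega
    rw [St.run, if_pos hne]
    have r3 := r2.setEdge (ev := .reg 2) (eg := .reg 1) true ht2 ht1
    refine r3.of_eq (Net.ext rfl ?_ rfl)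
    funext v w
    rw [Bool.eq_iff_iff]
    by_cases hw : w = h
    · subst hw
      rw [collapse_edge_top]
      by_cases hv : v = Sum.inl i
      · subst hv
        simp [Net.setEdge, expand]
      · simp only [Net.setEdge, hv, false_and, if_false, and_true, expand, decide_false,
          Bool.false_eq_true, or_false]
        by_cases hv' : v = Sum.inr g <;> simp [hv']
    · rw [collapse_edge hw]
      simp only [Net.setEdge, hw, and_false, if_false]
      by_cases hv : v = Sum.inl i ∧ w = g
      · simp [hv]
      · rw [if_neg hv]
        refine ⟨fun h => h.2.2, fun h => ⟨?_, by simp, h⟩⟩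
        rintro rfl
        exact hv ⟨hc.unique v h, rfl⟩
  | inr c =>
    have hne : (Ex.sub nEx (.reg 2)).eval (n + m) t = 0 := by
      rw [heval]
      simp only [code, Sum.elim_inr]
      omega
    rw [St.run, if_neg (not_not.2 hne)]
    have hch : c ≠ h := fun h' => hc.top_ne (congrArg _ h'.symm)
    have hcg : c ≠ g := fun h' => hc.mid_ne (congrArg _ h'.symm)
    have r3 := run_moveSt r2 hch ht1 ht2
    refine r3.of_eq (Net.ext rfl ?_ rfl)
    funext v w
    rw [Bool.eq_iff_iff]
    by_cases hw : w = h
    · subst hw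
      rw [collapse_edge_top]
      simp only [Net.setEdge, hch, and_false, if_false, hgh.symm, if_true, Bool.or_eq_true, expand,
        and_true, hcg]
      by_cases hv : v = Sum.inr g <;> simp [hv]
    · rw [collapse_edge hw]
      simp only [Net.setEdge, hw, and_false, if_false]
      by_cases hwc : w = c
      · simp [hwc]
      · rw [if_neg hwc]
        by_cases hv : v = Sum.inr c ∧ w = g
        · simp [hv]
        · rw [if_neg hv]
          refine ⟨fun h => h.2.2, fun h => ⟨?_, fun h' => hwc (Sum.inr.inj h'), h⟩⟩
          rintro rfl
          exact hv ⟨hc.unique v h, rfl⟩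

theorem step_collapseRule (hrep : N.Rep s.arr) (hN : N.Inv) (h0 : s.reg 0 < n + m)
    (h1 : s.reg 1 < n + m) (h2 : s.reg 2 < n + m) :
    Step collapseRule s N (CollapseGuard (s.reg 0) (s.reg 1) (s.reg 2) N) := by
  have e1 : (edgeEx (.reg 2) (.reg 0)).eval (n + m) s = N.bit (s.reg 2) (s.reg 0) :=
    hrep.eval_edge h2 h0 rfl rfl
  refine step_cond hrep hN (fun he => ?_) fun he => ?_
  · rw [e1] at he
    obtain ⟨u, g, hu, hg, hug⟩ := bit_ne_zero.1 he
    have e2 : (edgeEx (.add nEx (.reg 0)) (.reg 1)).eval (n + m) s =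
        N.bit (code (Sum.inr g : Fin n ⊕ Fin m)) (s.reg 1) := by
      refine hrep.eval_edge (code_lt _) h1 ?_ rfl
      have := hrep.eval_n
      rw [Ex.eval, this]
      simp [Ex.eval, code, hg]
    refine step_cond hrep hN (fun he2 => ?_) fun he2 => ?_
    · rw [e2] at he2
      obtain ⟨g', h, hg', hh, hgh⟩ := bit_ne_zero.1 he2
      rw [code_injective hg'] at hgh
      obtain ⟨r1, r2, r3⟩ := run_indegSt (r := 0) (by norm_num) (by norm_num) hrep h0
      rw [← hg] at r2
      set t := (indegSt 0).run (n + m) s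
      have hcnt : ∀ P : Prop, ((Ex.sub (.const 2) (.reg 3)).eval (n + m) t ≠ 0 ↔ P) ↔
          ((∀ v, N.edge v g = true → v = u) ↔ P) := by
        intro P
        rw [← sum_bit_lt_two hug, Ex.eval, Ex.eval, Ex.eval, r2]
        refine iff_congr ?_ Iff.rfl
        omega
      have hcnt' := (hcnt _).2 Iff.rfl
      refine step_cond (s := t) (by rwa [r1]) hN (fun he3 => ?_) fun he3 => ?_
      · have hun := hcnt'.1 he3
        have hc : N.Collapsible u g h := ⟨hN, hug, hgh, hun⟩
        refine ⟨N.collapse u g h, run_collapseSt (by rwa [r1]) hc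
          ((r3 0 (by norm_num) (by norm_num)).trans hg.symm)
          ((r3 1 (by norm_num) (by norm_num)).trans hh.symm)
          ((r3 2 (by norm_num) (by norm_num)).trans hu.symm), hc.refines, fun heq => ?_,
          fun hG => absurd ⟨u, g, h, hg, hh, hu, hug, hgh, hun⟩ hG⟩
        have h3 : (N.collapse u g h).edge (Sum.inr g) h = true := by rw [heq]; exact hgh
        exact absurd rfl (hc.edge_ne h3).1
      · rintro ⟨u', g', h', hg', -, hu', -, -, hun⟩
        obtain rfl := code_injective (hu.trans hu'.symm)
        obtain rfl := Fin.ext (hg.trans hg'.symm)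
        exact hcnt'.2 hun he3
    · rintro ⟨u', g', h', hg', hh', -, -, hgh, -⟩
      rw [e2] at he2
      obtain rfl := Fin.ext (hg.trans hg'.symm)
      rw [← hh'] at he2
      exact bit_code_ne_zero.2 hgh he2
  · rintro ⟨u, g, h, hg, -, hu, hug, -⟩
    rw [e1, ← hg, ← hu] at he
    exact bit_code_ne_zero.2 hug he

end Collapse

end Net

namespace Net

open RAM

variable {n m : ℕ} {N : Net (Fin n) (Fin m)} {s : State}

theorem Rep.eval_gate (h : N.Rep s.arr) {e : Ex} {g : Fin m} (he : e.eval (n + m) s = g) :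
    (Ex.add nEx e).eval (n + m) s = code (Sum.inr g : Fin n ⊕ Fin m) := by
  have := h.eval_n
  rw [Ex.eval, this, he]
  rfl

theorem gate_lt (g : Fin m) : g.val < n + m := by
  have := g.2
  omega

/-! #### Dead gates -/

/-- Remove the edge `reg 0 → reg 1` if its end is not the output and has no outgoing edge. -/
def deadRule : St :=
  .cond (edgeEx (.reg 0) (.reg 1)) (.cond (.ne (.reg 1) outEx)
    (.seq (sumLoop (edgeEx (.add nEx (.reg 1)) (.reg 4)))
      (.cond (.sub (.const 1) (.reg 3)) (setSt (.reg 0) (.reg 1) 0))))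

/-- The edge with the numbers `i → j` leads to a dead gate. -/
def DeadGuard (i j : ℕ) (N : Net (Fin n) (Fin m)) : Prop :=
  ∃ v g, code v = i ∧ g.val = j ∧ N.edge v g = true ∧ g ≠ N.out ∧ ∀ h, ¬ N.Child g h

theorem sum_bit_eq_zero {g : Fin m} :
    ∑ j ∈ Finset.range (n + m), N.bit (code (Sum.inr g : Fin n ⊕ Fin m)) j = 0 ↔
      ∀ h, ¬ N.Child g h := by
  rw [Finset.sum_eq_zero_iff]
  refine ⟨fun h c hc => bit_code_ne_zero.2 hc (h _ (Finset.mem_range.2 (gate_lt c))),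
    fun h j _ => ?_⟩
  by_contra hne
  obtain ⟨v, c, hv, -, hvc⟩ := bit_ne_zero.1 hne
  rw [code_injective hv] at hvc
  exact h c hvc

theorem run_outdegree {g : Fin m} {r : ℕ} (hr3 : r ≠ 3) (hr4 : r ≠ 4) (h : N.Rep s.arr)
    (hr : s.reg r = g) : ((sumLoop (edgeEx (.add nEx (.reg r)) (.reg 4))).run (n + m) s).arr = s.arr ∧
      ((sumLoop (edgeEx (.add nEx (.reg r)) (.reg 4))).run (n + m) s).reg 3 =
        ∑ j ∈ Finset.range (n + m), N.bit (code (Sum.inr g : Fin n ⊕ Fin m)) j ∧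
      ∀ r', r' ≠ 3 → r' ≠ 4 →
        ((sumLoop (edgeEx (.add nEx (.reg r)) (.reg 4))).run (n + m) s).reg r' = s.reg r' := by
  refine run_sumLoop fun j t hj ht htj htr => ?_
  have h' : N.Rep t.arr := by rwa [ht]
  exact h'.eval_edge (code_lt _) hj (h'.eval_gate ((htr r hr3 hr4).trans hr)) htj

theorem step_deadRule (hrep : N.Rep s.arr) (hN : N.Inv) (h0 : s.reg 0 < n + m)
    (h1 : s.reg 1 < n + m) : Step deadRule s N (DeadGuard (s.reg 0) (s.reg 1) N) := by
  have e1 : (edgeEx (.reg 0) (.reg 1)).eval (n + m) s = N.bit (s.reg 0) (s.reg 1) :=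
    hrep.eval_edge h0 h1 rfl rfl
  refine step_cond hrep hN (fun he => ?_) fun he => ?_
  · rw [e1] at he
    obtain ⟨v, g, hv, hg, hvg⟩ := bit_ne_zero.1 he
    have e2 : (Ex.ne (.reg 1) outEx).eval (n + m) s ≠ 0 ↔ g ≠ N.out := by
      rw [Ex.eval_ne, hrep.eval_out, Ex.eval, ← hg]
      exact not_congr Fin.ext_iff.symm
    have hcongr : ∀ {v' g'}, code v' = s.reg 0 → g'.val = s.reg 1 → v' = v ∧ g' = g :=
      fun hv' hg' => ⟨code_injective (hv'.trans hv.symm), Fin.ext (hg'.trans hg.symm)⟩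
    refine step_cond hrep hN (fun he2 => ?_) fun he2 => ?_
    · obtain ⟨r1, r2, r3⟩ := run_outdegree (r := 1) (by norm_num) (by norm_num) hrep hg.symm
      set t := (sumLoop (edgeEx (.add nEx (.reg 1)) (.reg 4))).run (n + m) s
      have e3 : (Ex.sub (.const 1) (.reg 3)).eval (n + m) t ≠ 0 ↔ ∀ h, ¬ N.Child g h := by
        rw [← sum_bit_eq_zero, Ex.eval, Ex.eval, Ex.eval, r2]
        omega
      have ht : N.Rep t.arr := by rwa [r1]
      refine step_cond (s := t) ht hN (fun he3 => ?_) fun he3 => ?_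
      · exact step_clear ht ((r3 0 (by norm_num) (by norm_num)).trans hv.symm)
          ((r3 1 (by norm_num) (by norm_num)).trans hg.symm) hvg
          (Refines.clear_dead hN hvg (e2.1 he2) (e3.1 he3))
          ⟨v, g, hv, hg, hvg, e2.1 he2, e3.1 he3⟩
      · rintro ⟨v', g', hv', hg', -, -, hd⟩
        rw [(hcongr hv' hg').2] at hd
        exact e3.2 hd he3
    · rintro ⟨v', g', hv', hg', -, hne, -⟩
      rw [(hcongr hv' hg').2] at hne
      exact e2.2 hne he2
  · rintro ⟨v, g, hv, hg, hvg, -⟩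
    rw [e1, ← hg, ← hv] at he
    exact bit_code_ne_zero.2 hvg he

/-! #### Duplicate gates -/

/-- Remove the edge from the gate `reg 0` to `reg 2` if the gate `reg 1` is also incoming to `reg 2`
and has the same inputs. -/
def duplicateRule : St :=
  .cond (.sub mEx (.reg 0)) (.cond (.sub mEx (.reg 1)) (.cond (.ne (.reg 0) (.reg 1))
    (.cond (edgeEx (.add nEx (.reg 0)) (.reg 2)) (.cond (edgeEx (.add nEx (.reg 1)) (.reg 2))
      (.seq (sumLoop (.ne (edgeEx (.reg 4) (.reg 0)) (edgeEx (.reg 4) (.reg 1))))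
        (.cond (.sub (.const 1) (.reg 3)) (setSt (.add nEx (.reg 0)) (.reg 2) 0)))))))

/-- The gates `i` and `j` are incoming to `k` and have the same inputs. -/
def DuplicateGuard (i j k : ℕ) (N : Net (Fin n) (Fin m)) : Prop :=
  ∃ a a' b, a.val = i ∧ a'.val = j ∧ b.val = k ∧ a ≠ a' ∧ N.Child a b ∧ N.Child a' b ∧
    ∀ v, N.edge v a = N.edge v a'

theorem step_duplicateRule (hrep : N.Rep s.arr) (hN : N.Inv) (h2 : s.reg 2 < n + m) :
    Step duplicateRule s N (DuplicateGuard (s.reg 0) (s.reg 1) (s.reg 2) N) := by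
  have em : ∀ r, (Ex.sub mEx (.reg r)).eval (n + m) s = m - s.reg r := by
    intro r
    have := hrep.eval_m
    rw [Ex.eval, this, Ex.eval]
  refine step_cond hrep hN (fun he => ?_) fun he => ?_
  rotate_left
  · rintro ⟨a, -, -, ha, -⟩
    rw [em, ← ha] at he
    omega
  obtain ⟨a, ha⟩ : ∃ a : Fin m, s.reg 0 = a := ⟨⟨s.reg 0, by rw [em] at he; omega⟩, rfl⟩
  refine step_cond hrep hN (fun he' => ?_) fun he' => ?_
  rotate_left
  · rintro ⟨-, a', -, -, ha', -⟩
    rw [em, ← ha'] at he'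
    omega
  obtain ⟨a', ha'⟩ : ∃ a : Fin m, s.reg 1 = a := ⟨⟨s.reg 1, by rw [em] at he'; omega⟩, rfl⟩
  have e1 : (Ex.ne (.reg 0) (.reg 1)).eval (n + m) s ≠ 0 ↔ a ≠ a' := by
    rw [Ex.eval_ne, Ex.eval, Ex.eval, ha, ha']
    exact not_congr Fin.ext_iff.symm
  have e2 : (edgeEx (.add nEx (.reg 0)) (.reg 2)).eval (n + m) s =
      N.bit (code (Sum.inr a : Fin n ⊕ Fin m)) (s.reg 2) :=
    hrep.eval_edge (code_lt _) h2 (hrep.eval_gate ha) rfl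
  have e3 : (edgeEx (.add nEx (.reg 1)) (.reg 2)).eval (n + m) s =
      N.bit (code (Sum.inr a' : Fin n ⊕ Fin m)) (s.reg 2) :=
    hrep.eval_edge (code_lt _) h2 (hrep.eval_gate ha') rfl
  have hguard : DuplicateGuard (s.reg 0) (s.reg 1) (s.reg 2) N ↔ ∃ b : Fin m, b.val = s.reg 2 ∧
      a ≠ a' ∧ N.Child a b ∧ N.Child a' b ∧ ∀ v, N.edge v a = N.edge v a' := by
    constructor
    · rintro ⟨c, c', b, hc, hc', hb, h⟩
      obtain rfl := Fin.ext (hc.trans ha)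
      obtain rfl := Fin.ext (hc'.trans ha')
      exact ⟨b, hb, h⟩
    · rintro ⟨b, hb, h⟩
      exact ⟨a, a', b, ha.symm, ha'.symm, hb, h⟩
  rw [hguard]
  refine step_cond hrep hN (fun hne => ?_) fun hne => ?_
  rotate_left
  · rintro ⟨b, -, h, -⟩
    exact e1.2 h hne
  refine step_cond hrep hN (fun hab => ?_) fun hab => ?_
  rotate_left
  · rintro ⟨b, hb, -, h, -⟩
    rw [e2, ← hb] at hab
    exact bit_code_ne_zero.2 h hab
  rw [e2] at hab
  obtain ⟨v, b, hv, hb, hvb⟩ := bit_ne_zero.1 hab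
  rw [code_injective hv] at hvb
  rw [← hb] at e3
  refine step_cond hrep hN (fun hab' => ?_) fun hab' => ?_
  rotate_left
  · rintro ⟨b', hb', -, -, h, -⟩
    rw [Fin.ext (hb'.trans hb.symm)] at h
    rw [e3] at hab'
    exact bit_code_ne_zero.2 h hab'
  rw [e3, bit_code_ne_zero] at hab'
  -- The sum of the absolute differences of two columns, written with truncated subtraction; it
  -- vanishes exactly if the inputs agree.
  obtain ⟨r1, r2, r3⟩ := run_sumLoop (K := n + m) (s := s)
    (e := .ne (edgeEx (.reg 4) (.reg 0)) (edgeEx (.reg 4) (.reg 1)))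
    (F := fun j => (N.bit j a - N.bit j a') + (N.bit j a' - N.bit j a)) (by
      intro j t hj ht htj htr
      have h' : N.Rep t.arr := by rwa [ht]
      have f1 := h'.eval_edge (v := .reg 4) (g := .reg 0) hj (gate_lt a) htj
        ((htr 0 (by norm_num) (by norm_num)).trans ha)
      have f2 := h'.eval_edge (v := .reg 4) (g := .reg 1) hj (gate_lt a') htj
        ((htr 1 (by norm_num) (by norm_num)).trans ha')
      simp only [Ex.ne, Ex.eval, f1, f2])
  set t := (sumLoop (.ne (edgeEx (.reg 4) (.reg 0)) (edgeEx (.reg 4) (.reg 1)))).run (n + m) s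
  have e4 : (Ex.sub (.const 1) (.reg 3)).eval (n + m) t ≠ 0 ↔ ∀ v, N.edge v a = N.edge v a' := by
    rw [Ex.eval, Ex.eval, Ex.eval, r2]
    have : (1 - ∑ j ∈ Finset.range (n + m),
        ((N.bit j a - N.bit j a') + (N.bit j a' - N.bit j a)) ≠ 0) ↔
        ∑ j ∈ Finset.range (n + m),
        ((N.bit j a - N.bit j a') + (N.bit j a' - N.bit j a)) = 0 := by omega
    rw [this, Finset.sum_eq_zero_iff]
    constructor
    · intro h v
      have := h _ (Finset.mem_range.2 (code_lt v))
      rw [bit_code, bit_code] at this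
      cases h1 : N.edge v a <;> cases h2 : N.edge v a' <;> simp [h1, h2] at this ⊢
    · intro h j hj
      obtain ⟨v, rfl⟩ := exists_code (Finset.mem_range.1 hj)
      rw [bit_code, bit_code, h v]
      omega
  have ht : N.Rep t.arr := by rwa [r1]
  refine step_cond (s := t) ht hN (fun he4 => ?_) fun he4 => ?_
  · exact step_clear ht (ht.eval_gate ((r3 0 (by norm_num) (by norm_num)).trans ha))
      ((r3 2 (by norm_num) (by norm_num)).trans hb.symm) hvb
      (Refines.clear_duplicate hN (e1.1 hne) hvb hab' (e4.1 he4))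
      ⟨b, hb, e1.1 hne, hvb, hab', e4.1 he4⟩
  · rintro ⟨-, -, -, -, -, h⟩
    exact e4.2 h he4

/-! #### Gates below a literal -/

open Classical in
/-- The gate to which `g` is incoming, or `g` if there is none. -/
noncomputable def parent (N : Net (Fin n) (Fin m)) (g : Fin m) : Fin m :=
  if h : ∃ h, N.Child g h then h.choose else g

theorem Inv.parent_eq (hN : N.Inv) {g h : Fin m} (hgh : N.Child g h) : N.parent g = h := by
  have hex : ∃ h, N.Child g h := ⟨h, hgh⟩
  rw [parent, dif_pos hex]
  exact hN.child_unique hex.choose_spec hgh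

theorem parent_of_not {g : Fin m} (h : ∀ h, ¬ N.Child g h) : N.parent g = g := by
  rw [parent, dif_neg (not_exists.2 h)]

theorem reflTransGen_iterate_parent (hN : N.Inv) (b : Fin m) (i : ℕ) :
    Relation.ReflTransGen N.Child b (N.parent^[i] b) := by
  induction i with
  | zero => exact .refl
  | succ i ih =>
    rw [Function.iterate_succ_apply']
    by_cases h : ∃ h, N.Child (N.parent^[i] b) h
    · obtain ⟨h, hh⟩ := h
      rw [hN.parent_eq hh]
      exact ih.tail hh
    · rwa [parent_of_not (not_exists.1 h)]

/-- Up to the first visit of a given point the orbit has no repetition, so the first visit happens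
within the cardinality. -/
theorem exists_iterate_lt_card {α : Type*} [Fintype α] (f : α → α) (a : α) (i : ℕ) :
    ∃ j, j < Fintype.card α ∧ f^[j] a = f^[i] a := by
  classical
  have hex : ∃ j, f^[j] a = f^[i] a := ⟨i, rfl⟩
  refine ⟨Nat.find hex, ?_, Nat.find_spec hex⟩
  by_contra hlt
  have hinj : Function.Injective fun k : Fin (Fintype.card α + 1) => f^[k.val] a := by
    have key : ∀ p q : ℕ, p < q → q ≤ Nat.find hex → f^[p] a ≠ f^[q] a := by
      intro p q hpq hq heq
      -- A repetition at times `p < q` could be cut out, giving an earlier visit.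
      refine Nat.find_min hex (m := Nat.find hex - q + p) (by omega) ?_
      rw [Function.iterate_add_apply, heq, ← Function.iterate_add_apply]
      rw [show Nat.find hex - q + q = Nat.find hex by omega]
      exact Nat.find_spec hex
    intro p q hpq
    have hp := p.2
    have hq := q.2
    rcases lt_trichotomy p.val q.val with h | h | h
    · exact absurd hpq (key _ _ h (by omega))
    · exact Fin.ext h
    · exact absurd hpq.symm (key _ _ h (by omega))
  have := Fintype.card_le_of_injective _ hinj
  rw [Fintype.card_fin] at this
  omega

/-- Hence a loop of `n + m` rounds, each replacing the gate by its parent, visits everything above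
`b`. -/
theorem exists_iterate_parent (hN : N.Inv) {b g : Fin m}
    (h : Relation.ReflTransGen N.Child b g) : ∃ i, i < n + m ∧ N.parent^[i] b = g := by
  obtain ⟨i, hi⟩ : ∃ i, N.parent^[i] b = g := by
    induction h with
    | refl => exact ⟨0, rfl⟩
    | tail _ hc ih =>
      obtain ⟨i, hi⟩ := ih
      exact ⟨i + 1, by rw [Function.iterate_succ_apply', hi, hN.parent_eq hc]⟩
  obtain ⟨j, hj, hj'⟩ := exists_iterate_lt_card N.parent b i
  rw [Fintype.card_fin] at hj
  exact ⟨j, by omega, hj'.trans hi⟩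

/-- Replace the gate in the register `7` by its parent. -/
def parentSt : St :=
  .seq (.assign 9 (.reg 7)) (.seq
    (.loop 10 (.cond (edgeEx (.add nEx (.reg 7)) (.reg 10)) (.assign 9 (.reg 10))))
    (.assign 7 (.reg 9)))

theorem run_parentSt (hrep : N.Rep s.arr) (hN : N.Inv) {g : Fin m} (hg : s.reg 7 = g) :
    (parentSt.run (n + m) s).arr = s.arr ∧ (parentSt.run (n + m) s).reg 7 = N.parent g ∧
      ∀ r, r ≠ 7 → r ≠ 9 → r ≠ 10 → (parentSt.run (n + m) s).reg r = s.reg r := by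
  -- Register 9 holds `g` until the scan passes the unique parent, and stays at `g` if there is
  -- none.
  have key := iter_induction (k := n + m) (s := (St.assign 9 (.reg 7)).run (n + m) s)
    (f := fun j t => (St.cond (edgeEx (.add nEx (.reg 7)) (.reg 10))
      (.assign 9 (.reg 10))).run (n + m) (t.setReg 10 j))
    (P := fun j t => t.arr = s.arr ∧
      t.reg 9 = (if (N.parent g).val < j then N.parent g else g : Fin m) ∧
      ∀ r, r ≠ 9 → r ≠ 10 → t.reg r = s.reg r) ⟨rfl, ?_, ?_⟩ ?_
  · obtain ⟨h1, h2, h3⟩ := key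
    refine ⟨h1, ?_, fun r h7 h9 h10 => ?_⟩
    · change (State.setReg _ _ _).reg 7 = _
      rw [setReg_reg, if_pos rfl]
      refine h2.trans ?_
      rw [if_pos (gate_lt _)]
    · change (State.setReg _ _ _).reg r = _
      rw [setReg_reg, if_neg h7]
      exact h3 r h9 h10
  · simp [St.run, Ex.eval, hg]
  · intro r h9 _
    rw [St.run, setReg_reg, if_neg h9]
  · rintro j t hj ⟨h1, h2, h3⟩
    have ht : N.Rep (t.setReg 10 j).arr := by rw [setReg_arr, h1]; exact hrep
    have h7 : (Ex.reg 7).eval (n + m) (t.setReg 10 j) = g := by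
      rw [Ex.eval, setReg_reg, if_neg (by norm_num), h3 7 (by norm_num) (by norm_num), hg]
    have e := ht.eval_edge (v := .add nEx (.reg 7)) (g := .reg 10) (code_lt _) hj
      (ht.eval_gate h7) (by simp [Ex.eval])
    by_cases hb : N.bit (code (Sum.inr g : Fin n ⊕ Fin m)) j = 0
    · rw [St.run_cond_neg (e.trans hb)]
      refine ⟨h1, ?_, fun r h9 h10 => ?_⟩
      · rw [setReg_reg, if_neg (by norm_num), h2]
        by_cases hlt : (N.parent g).val < j
        · rw [if_pos hlt, if_pos (by omega)]
        · rw [if_neg hlt]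
          split_ifs with hlt'
          · by_cases hex : ∃ h, N.Child g h
            · obtain ⟨h, hh⟩ := hex
              have hp := hN.parent_eq hh
              rw [hp] at hlt hlt'
              have : j = h := by omega
              rw [this] at hb
              exact absurd hb (bit_code_ne_zero.2 hh)
            · rw [parent_of_not (not_exists.1 hex)]
          · rfl
      · rw [setReg_reg, if_neg h10, h3 r h9 h10]
    · rw [St.run_cond_pos (by rwa [e])]
      obtain ⟨v, h, hv, hh, hvh⟩ := bit_ne_zero.1 hb
      rw [code_injective hv] at hvh
      have hp := hN.parent_eq hvh
      refine ⟨h1, ?_, fun r h9 h10 => ?_⟩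
      · rw [St.run, setReg_reg, if_pos rfl, Ex.eval, setReg_reg, if_pos rfl, hp,
          if_pos (by omega), hh]
      · rw [St.run, setReg_reg, if_neg h9, setReg_reg, if_neg h10, h3 r h9 h10]

/-- The test whether the gate in the register `7` has the type of the gate `reg 2` and the input
`reg 0`, and this edge is not the edge `a → reg 2`. -/
def belowTest (a : Ex) : St :=
  .cond (edgeEx (.reg 0) (.reg 7)) (.cond (.eq (kindEx (.reg 7)) (kindEx (.reg 2)))
    (.cond (.add (.ne a (.reg 0)) (.ne (.reg 2) (.reg 7))) (.assign 6 (.const 1))))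

/-- Walk up from the gate `reg 2` and test all gates. -/
def belowSearch (a : Ex) : St :=
  .seq (.seq (.assign 6 (.const 0)) (.assign 7 (.reg 2)))
    (.loop 8 (.seq (belowTest a) parentSt))

/-- The relation tested by `belowTest`. -/
def BelowTest (N : Net (Fin n) (Fin m)) (x : Fin n) (a : Fin n ⊕ Fin m) (b g : Fin m) : Prop :=
  N.edge (Sum.inl x) g = true ∧ N.kind b = N.kind g ∧ ¬ (a = Sum.inl x ∧ b = g)

theorem run_belowTest (hrep : N.Rep s.arr) {a : Ex} {x : Fin n} {v : Fin n ⊕ Fin m} {b g : Fin m}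
    (h0 : s.reg 0 = x) (h2 : s.reg 2 = b) (h7 : s.reg 7 = g) (ha : a.eval (n + m) s = code v) :
    ((belowTest a).run (n + m) s).arr = s.arr ∧
      (((belowTest a).run (n + m) s).reg 6 ≠ 0 ↔ s.reg 6 ≠ 0 ∨ N.BelowTest x v b g) ∧
      ∀ r, r ≠ 6 → ((belowTest a).run (n + m) s).reg r = s.reg r := by
  have e1 := hrep.eval_edge (v := .reg 0) (g := .reg 7) (code_lt (Sum.inl x)) (gate_lt g) h0 h7
  have e2 : (Ex.eq (kindEx (.reg 7)) (kindEx (.reg 2))).eval (n + m) s ≠ 0 ↔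
      N.kind b = N.kind g := by
    rw [Ex.eval_eq, hrep.eval_kind (e := .reg 7) h7, hrep.eval_kind (e := .reg 2) h2,
      kindCode_injective.eq_iff, eq_comm]
  have e3 : (Ex.add (.ne a (.reg 0)) (.ne (.reg 2) (.reg 7))).eval (n + m) s ≠ 0 ↔
      ¬ (v = Sum.inl x ∧ b = g) := by
    have i1 := Ex.eval_ne (K := n + m) (s := s) (a := a) (b := .reg 0)
    have i2 := Ex.eval_ne (K := n + m) (s := s) (a := .reg 2) (b := .reg 7)
    rw [ha, Ex.eval, h0, show x.val = code (Sum.inl x : Fin n ⊕ Fin m) from rfl, Ne, Ne,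
      code_injective.eq_iff] at i1
    rw [Ex.eval, Ex.eval, h2, h7, Ne, Ne, ← Fin.ext_iff] at i2
    rw [Ex.eval]
    by_cases c1 : v = Sum.inl x <;> by_cases c2 : b = g <;> simp only [c1, c2, not_true, not_false_iff,
      iff_true, iff_false, not_not, and_true, and_false, Ne] at i1 i2 ⊢ <;> omega
  by_cases c1 : N.edge (Sum.inl x) g = true
  · rw [belowTest, St.run_cond_pos (by rw [e1]; exact bit_code_ne_zero.2 c1)]
    by_cases c2 : N.kind b = N.kind g
    · rw [St.run_cond_pos (e2.2 c2)]
      by_cases c3 : ¬ (v = Sum.inl x ∧ b = g)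
      · rw [St.run_cond_pos (e3.2 c3)]
        refine ⟨rfl, ?_, fun r hr => ?_⟩
        · simp only [St.run, setReg_reg, if_true, Ex.eval]
          exact ⟨fun _ => Or.inr ⟨c1, c2, c3⟩, fun _ => one_ne_zero⟩
        · rw [St.run, setReg_reg, if_neg hr]
      · rw [St.run_cond_neg (not_not.1 (mt e3.1 c3))]
        refine ⟨rfl, ?_, fun r hr => rfl⟩
        rw [BelowTest]
        tauto
    · rw [St.run_cond_neg (not_not.1 (mt e2.1 c2))]
      refine ⟨rfl, ?_, fun r hr => rfl⟩
      rw [BelowTest]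
      tauto
  · rw [belowTest, St.run_cond_neg (by rw [e1]; exact not_not.1 (mt bit_code_ne_zero.1 c1))]
    refine ⟨rfl, ?_, fun r hr => rfl⟩
    rw [BelowTest]
    tauto

theorem run_belowSearch (hrep : N.Rep s.arr) (hN : N.Inv) {a : Ex} {x : Fin n}
    {v : Fin n ⊕ Fin m} {b : Fin m} (h0 : s.reg 0 = x) (h2 : s.reg 2 = b)
    (ha : ∀ t : State, t.arr = s.arr → (∀ r, r < 3 → t.reg r = s.reg r) →
      a.eval (n + m) t = code v) :
    ((belowSearch a).run (n + m) s).arr = s.arr ∧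
      (((belowSearch a).run (n + m) s).reg 6 ≠ 0 ↔
        ∃ g, Relation.ReflTransGen N.Child b g ∧ N.BelowTest x v b g) ∧
      ∀ r, r < 3 → ((belowSearch a).run (n + m) s).reg r = s.reg r := by
  -- After `j` rounds register 7 holds the `j`-th iterated parent of `b`, and register 6 records
  -- whether an earlier one passed the test.
  have key := iter_induction (k := n + m)
    (s := (St.seq (.assign 6 (.const 0)) (.assign 7 (.reg 2))).run (n + m) s)
    (f := fun j t => (St.seq (belowTest a) parentSt).run (n + m) (t.setReg 8 j))
    (P := fun j t => t.arr = s.arr ∧ t.reg 7 = N.parent^[j] b ∧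
      (t.reg 6 ≠ 0 ↔ ∃ i, i < j ∧ N.BelowTest x v b (N.parent^[i] b)) ∧
      ∀ r, r < 3 → t.reg r = s.reg r) ⟨rfl, ?_, ?_, ?_⟩ ?_
  · obtain ⟨h1, -, h3, h4⟩ := key
    refine ⟨h1, h3.trans ⟨?_, ?_⟩, h4⟩
    · rintro ⟨i, -, hi⟩
      exact ⟨_, reflTransGen_iterate_parent hN b i, hi⟩
    · rintro ⟨g, hg, hT⟩
      obtain ⟨i, hi, rfl⟩ := exists_iterate_parent hN hg
      exact ⟨i, hi, hT⟩
  · simp [St.run, Ex.eval, h2]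
  · simp [St.run, Ex.eval]
  · intro r hr
    simp only [St.run, setReg_reg]
    rw [if_neg (by omega), if_neg (by omega)]
  · rintro j t hj ⟨h1, h7, h6, hr⟩
    have h1' : (t.setReg 8 j).arr = s.arr := h1
    have hr' : ∀ r, r < 3 → (t.setReg 8 j).reg r = s.reg r := by
      intro r hr3
      rw [setReg_reg, if_neg (by omega), hr r hr3]
    have hrep' : N.Rep (t.setReg 8 j).arr := by rwa [h1']
    obtain ⟨t1, t2, t3⟩ := run_belowTest (a := a) (v := v) (g := N.parent^[j] b) hrep'
      ((hr' 0 (by norm_num)).trans h0) ((hr' 2 (by norm_num)).trans h2)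
      (by rw [setReg_reg, if_neg (by norm_num), h7]) (ha _ h1' hr')
    obtain ⟨p1, p2, p3⟩ := run_parentSt (s := (belowTest a).run (n + m) (t.setReg 8 j))
      (by rwa [t1]) hN (g := N.parent^[j] b)
      (by rw [t3 7 (by norm_num), setReg_reg, if_neg (by norm_num), h7])
    refine ⟨p1.trans (t1.trans h1'), ?_, ?_, fun r hr3 => ?_⟩
    · rw [Function.iterate_succ_apply']
      exact p2
    · have : (St.run (n + m) ((belowTest a).seq parentSt) (t.setReg 8 j)).reg 6 =
          ((belowTest a).run (n + m) (t.setReg 8 j)).reg 6 :=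
        p3 6 (by norm_num) (by norm_num) (by norm_num)
      rw [this, t2, setReg_reg, if_neg (by norm_num), h6]
      constructor
      · rintro (⟨i, hi, h⟩ | h)
        · exact ⟨i, by omega, h⟩
        · exact ⟨j, by omega, h⟩
      · rintro ⟨i, hi, h⟩
        rcases Nat.lt_succ_iff_lt_or_eq.1 hi with hi | rfl
        · exact Or.inl ⟨i, hi, h⟩
        · exact Or.inr h
    · exact (p3 r (by omega) (by omega) (by omega)).trans
        ((t3 r (by omega)).trans (hr' r hr3))

/-- Remove the edge `a → reg 2` if it is superfluous because of an occurrence of the literal `reg 0`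
above. -/
def belowTail (a : Ex) : St :=
  .cond (edgeEx a (.reg 2)) (.seq (indegSt 2) (.cond (.sub (.reg 3) (.const 1))
    (.seq (belowSearch a) (.cond (.reg 6) (setSt a (.reg 2) 0)))))

/-- The edge `a → j` is superfluous because of an occurrence of the literal `x` above. -/
def BelowTailGuard (x : Fin n) (a : Fin n ⊕ Fin m) (j : ℕ) (N : Net (Fin n) (Fin m)) : Prop :=
  ∃ b, b.val = j ∧ N.edge a b = true ∧ (∃ v, v ≠ a ∧ N.edge v b = true) ∧
    ∃ g, Relation.ReflTransGen N.Child b g ∧ N.BelowTest x a b g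

/-- The expression `a` is evaluated again after computations that overwrite auxiliary registers;
therefore `ha` asks for its value in every state with the same memory and the same registers 0, 1,
2. -/
theorem step_belowTail (hrep : N.Rep s.arr) (hN : N.Inv) {a : Ex} {x : Fin n}
    {v : Fin n ⊕ Fin m} (h0 : s.reg 0 = x) (h2 : s.reg 2 < n + m)
    (hv : v = Sum.inl x ∨ ∃ c, v = Sum.inr c ∧ N.edge (Sum.inl x) c = true)
    (ha : ∀ t : State, t.arr = s.arr → (∀ r, r < 3 → t.reg r = s.reg r) →
      a.eval (n + m) t = code v) :
    Step (belowTail a) s N (BelowTailGuard x v (s.reg 2) N) := by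
  have e1 : (edgeEx a (.reg 2)).eval (n + m) s = N.bit (code v) (s.reg 2) :=
    hrep.eval_edge (code_lt v) h2 (ha s rfl fun _ _ => rfl) rfl
  refine step_cond hrep hN (fun he => ?_) fun he => ?_
  rotate_left
  · rintro ⟨b, hb, h, -⟩
    rw [e1, ← hb] at he
    exact bit_code_ne_zero.2 h he
  rw [e1] at he
  obtain ⟨v', b, hv', hb, hvb⟩ := bit_ne_zero.1 he
  rw [code_injective hv'] at hvb
  have hguard : BelowTailGuard x v (s.reg 2) N ↔ (∃ w, w ≠ v ∧ N.edge w b = true) ∧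
      ∃ g, Relation.ReflTransGen N.Child b g ∧ N.BelowTest x v b g := by
    constructor
    · rintro ⟨b', hb', -, h⟩
      rw [Fin.ext (hb'.trans hb.symm)] at h
      exact h
    · exact fun h => ⟨b, hb, hvb, h⟩
  rw [hguard]
  obtain ⟨i1, i2, i3⟩ := run_indegSt (r := 2) (by norm_num) (by norm_num) hrep h2
  rw [← hb] at i2
  set t := (indegSt 2).run (n + m) s
  have ht : N.Rep t.arr := by rwa [i1]
  have e2 : (Ex.sub (.reg 3) (.const 1)).eval (n + m) t ≠ 0 ↔ ∃ w, w ≠ v ∧ N.edge w b = true := by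
    have := sum_bit_lt_two hvb
    rw [Ex.eval, Ex.eval, Ex.eval, i2]
    rw [show (∃ w, w ≠ v ∧ N.edge w b = true) ↔ ¬ ∀ w, N.edge w b = true → w = v by
      push Not; exact exists_congr fun w => and_comm, ← this]
    omega
  have step : Step (St.cond (.sub (.reg 3) (.const 1))
      (.seq (belowSearch a) (.cond (.reg 6) (setSt a (.reg 2) 0)))) t N
      ((∃ w, w ≠ v ∧ N.edge w b = true) ∧
        ∃ g, Relation.ReflTransGen N.Child b g ∧ N.BelowTest x v b g) := by
    refine step_cond ht hN (fun he2 => ?_) fun he2 hG => e2.2 hG.1 he2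
    have ha' : ∀ t' : State, t'.arr = t.arr → (∀ r, r < 3 → t'.reg r = t.reg r) →
        a.eval (n + m) t' = code v := fun t' h1 h2 => ha t' (h1.trans i1)
          fun r hr => (h2 r hr).trans (i3 r (by omega) (by omega))
    have ht2 : t.reg 2 = b := (i3 2 (by norm_num) (by norm_num)).trans hb.symm
    obtain ⟨s1, s2, s3⟩ := run_belowSearch ht hN (a := a) (x := x) (v := v) (b := b)
      ((i3 0 (by norm_num) (by norm_num)).trans h0) ht2 ha'
    set t' := (belowSearch a).run (n + m) t
    have ht' : N.Rep t'.arr := by rwa [s1]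
    have : Step (.cond (.reg 6) (setSt a (.reg 2) 0)) t' N ((∃ w, w ≠ v ∧ N.edge w b = true) ∧
        ∃ g, Relation.ReflTransGen N.Child b g ∧ N.BelowTest x v b g) := by
      refine step_cond ht' hN (fun he3 => ?_) fun he3 hG => s2.2 hG.2 he3
      obtain ⟨g, hbg, hxg, hk, hne⟩ := s2.1 he3
      exact step_clear ht' (ha' _ s1 s3) ((s3 2 (by norm_num)).trans ht2) hvb
        (Refines.clear_below hN hxg hvb hbg hk hne hv (e2.1 he2))
        ⟨e2.1 he2, g, hbg, hxg, hk, hne⟩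
    exact this
  exact step

/-- Remove an edge to `reg 2` that is superfluous because of an occurrence of the literal `reg 0`
above and starts in this literal. -/
def belowLiteralRule : St := .cond (.sub nEx (.reg 0)) (belowTail (.reg 0))

/-- Remove an edge to `reg 2` that is superfluous because of an occurrence of the literal `reg 0`
above and starts in the gate `reg 1`, to which this literal is incoming. -/
def belowGateRule : St :=
  .cond (.sub nEx (.reg 0)) (.cond (.sub mEx (.reg 1)) (.cond (edgeEx (.reg 0) (.reg 1))
    (belowTail (.add nEx (.reg 1)))))

/-- The guard of `belowLiteralRule`. -/
def BelowLiteralGuard (i k : ℕ) (N : Net (Fin n) (Fin m)) : Prop :=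
  ∃ x : Fin n, x.val = i ∧ BelowTailGuard x (Sum.inl x) k N

/-- The guard of `belowGateRule`. -/
def BelowGateGuard (i j k : ℕ) (N : Net (Fin n) (Fin m)) : Prop :=
  ∃ (x : Fin n) (c : Fin m), x.val = i ∧ c.val = j ∧ N.edge (Sum.inl x) c = true ∧
    BelowTailGuard x (Sum.inr c) k N

theorem step_belowLiteralRule (hrep : N.Rep s.arr) (hN : N.Inv) (h2 : s.reg 2 < n + m) :
    Step belowLiteralRule s N (BelowLiteralGuard (s.reg 0) (s.reg 2) N) := by
  have en : (Ex.sub nEx (.reg 0)).eval (n + m) s = n - s.reg 0 := by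
    have := hrep.eval_n
    rw [Ex.eval, this, Ex.eval]
  refine step_cond hrep hN (fun he => ?_) fun he => ?_
  · obtain ⟨x, hx⟩ : ∃ x : Fin n, s.reg 0 = x := ⟨⟨s.reg 0, by rw [en] at he; omega⟩, rfl⟩
    have hguard : BelowLiteralGuard (s.reg 0) (s.reg 2) N ↔
        BelowTailGuard x (Sum.inl x) (s.reg 2) N := by
      constructor
      · rintro ⟨y, hy, h⟩
        rwa [Fin.ext (hy.trans hx)] at h
      · exact fun h => ⟨x, hx.symm, h⟩
    rw [hguard]
    exact step_belowTail hrep hN hx h2 (Or.inl rfl) fun t _ h => (h 0 (by norm_num)).trans hx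
  · rintro ⟨x, hx, -⟩
    rw [en, ← hx] at he
    omega

theorem step_belowGateRule (hrep : N.Rep s.arr) (hN : N.Inv) (h2 : s.reg 2 < n + m) :
    Step belowGateRule s N (BelowGateGuard (s.reg 0) (s.reg 1) (s.reg 2) N) := by
  have en : (Ex.sub nEx (.reg 0)).eval (n + m) s = n - s.reg 0 := by
    have := hrep.eval_n
    rw [Ex.eval, this, Ex.eval]
  have em : (Ex.sub mEx (.reg 1)).eval (n + m) s = m - s.reg 1 := by
    have := hrep.eval_m
    rw [Ex.eval, this, Ex.eval]
  refine step_cond hrep hN (fun he => ?_) fun he => ?_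
  rotate_left
  · rintro ⟨x, -, hx, -⟩
    rw [en, ← hx] at he
    omega
  refine step_cond hrep hN (fun he' => ?_) fun he' => ?_
  rotate_left
  · rintro ⟨-, c, -, hc, -⟩
    rw [em, ← hc] at he'
    omega
  obtain ⟨x, hx⟩ : ∃ x : Fin n, s.reg 0 = x := ⟨⟨s.reg 0, by rw [en] at he; omega⟩, rfl⟩
  obtain ⟨c, hc⟩ : ∃ c : Fin m, s.reg 1 = c := ⟨⟨s.reg 1, by rw [em] at he'; omega⟩, rfl⟩
  have hguard : BelowGateGuard (s.reg 0) (s.reg 1) (s.reg 2) N ↔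
      N.edge (Sum.inl x) c = true ∧ BelowTailGuard x (Sum.inr c) (s.reg 2) N := by
    constructor
    · rintro ⟨y, c', hy, hc', h⟩
      rwa [Fin.ext (hy.trans hx), Fin.ext (hc'.trans hc)] at h
    · exact fun h => ⟨x, c, hx.symm, hc.symm, h⟩
  rw [hguard]
  have e3 := hrep.eval_edge (v := .reg 0) (g := .reg 1) (code_lt (Sum.inl x)) (gate_lt c) hx hc
  refine step_cond hrep hN (fun hxc => ?_) fun hxc hG => ?_
  · rw [e3, bit_code_ne_zero] at hxc
    have := step_belowTail (a := .add nEx (.reg 1)) (v := Sum.inr c) hrep hN hx h2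
      (Or.inr ⟨c, rfl, hxc⟩) fun t ht h => by
        have ht' : N.Rep t.arr := by rwa [ht]
        exact ht'.eval_gate ((h 1 (by norm_num)).trans hc)
    simpa [hxc] using this
  · rw [e3] at hxc
    exact bit_code_ne_zero.2 hG.1 hxc

end Net

/-! ### Exhaustive reduction -/

namespace Net

open RAM

variable {n m : ℕ} {N : Net (Fin n) (Fin m)} {s : State}

/-- Apply all rules at the position given by the registers `0`, `1`, `2`. -/
def rulesSt : St :=
  .seq collapseRule (.seq deadRule (.seq duplicateRule (.seq belowLiteralRule belowGateRule)))

/-- Some rule applies at the position `i`, `j`, `k`. -/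
def Guard (i j k : ℕ) (N : Net (Fin n) (Fin m)) : Prop :=
  CollapseGuard i j k N ∨ DeadGuard i j N ∨ DuplicateGuard i j k N ∨ BelowLiteralGuard i k N ∨
    BelowGateGuard i j k N

theorem keeps_rulesSt {r : ℕ} (hr : r < 3) : collapseRule.Keeps r ∧ deadRule.Keeps r ∧
    duplicateRule.Keeps r ∧ belowLiteralRule.Keeps r ∧ belowGateRule.Keeps r := by
  interval_cases r <;>
    simp [St.Keeps, collapseRule, indegSt, sumLoop, collapseSt, moveSt, setSt, St.cond, deadRule,
      duplicateRule, belowLiteralRule, belowGateRule, belowTail, belowSearch, belowTest, parentSt]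

/-- No rule assigns the registers 0, 1, 2, so all rules are tried at the same position although the
net may have changed in between. -/
theorem step_rulesSt (hrep : N.Rep s.arr) (hN : N.Inv) (hs : ∀ r, r < 3 → s.reg r < n + m) :
    Step rulesSt s N (Guard (s.reg 0) (s.reg 1) (s.reg 2) N) := by
  refine step_seq (G := CollapseGuard _ _ _) (G' := fun N => DeadGuard (s.reg 0) (s.reg 1) N ∨
    DuplicateGuard (s.reg 0) (s.reg 1) (s.reg 2) N ∨ BelowLiteralGuard (s.reg 0) (s.reg 2) N ∨
    BelowGateGuard (s.reg 0) (s.reg 1) (s.reg 2) N)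
    (step_collapseRule hrep hN (hs 0 (by norm_num)) (hs 1 (by norm_num)) (hs 2 (by norm_num)))
    fun M₁ hrep₁ hM₁ => ?_
  have k₁ : ∀ r, r < 3 → (collapseRule.run (n + m) s).reg r = s.reg r := fun r hr =>
    St.run_reg _ (keeps_rulesSt hr).1 s
  set s₁ := collapseRule.run (n + m) s
  refine step_seq (G := DeadGuard _ _) (G' := fun N => DuplicateGuard (s.reg 0) (s.reg 1) (s.reg 2) N ∨
    BelowLiteralGuard (s.reg 0) (s.reg 2) N ∨ BelowGateGuard (s.reg 0) (s.reg 1) (s.reg 2) N) ?_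
    fun M₂ hrep₂ hM₂ => ?_
  · have := step_deadRule hrep₁ hM₁ (by rw [k₁ 0 (by norm_num)]; exact hs 0 (by norm_num))
      (by rw [k₁ 1 (by norm_num)]; exact hs 1 (by norm_num))
    rwa [k₁ 0 (by norm_num), k₁ 1 (by norm_num)] at this
  have k₂ : ∀ r, r < 3 → (deadRule.run (n + m) s₁).reg r = s.reg r := fun r hr =>
    (St.run_reg _ (keeps_rulesSt hr).2.1 s₁).trans (k₁ r hr)
  set s₂ := deadRule.run (n + m) s₁
  refine step_seq (G := DuplicateGuard _ _ _) (G' := fun N => BelowLiteralGuard (s.reg 0) (s.reg 2) N ∨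
    BelowGateGuard (s.reg 0) (s.reg 1) (s.reg 2) N) ?_
    fun M₃ hrep₃ hM₃ => ?_
  · have := step_duplicateRule hrep₂ hM₂ (by rw [k₂ 2 (by norm_num)]; exact hs 2 (by norm_num))
    rwa [k₂ 0 (by norm_num), k₂ 1 (by norm_num), k₂ 2 (by norm_num)] at this
  have k₃ : ∀ r, r < 3 → (duplicateRule.run (n + m) s₂).reg r = s.reg r := fun r hr =>
    (St.run_reg _ (keeps_rulesSt hr).2.2.1 s₂).trans (k₂ r hr)
  set s₃ := duplicateRule.run (n + m) s₂
  refine step_seq (G := BelowLiteralGuard _ _) (G' := BelowGateGuard _ _ _) ?_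
    fun M₄ hrep₄ hM₄ => ?_
  · have := step_belowLiteralRule hrep₃ hM₃
      (by rw [k₃ 2 (by norm_num)]; exact hs 2 (by norm_num))
    rwa [k₃ 0 (by norm_num), k₃ 2 (by norm_num)] at this
  have k₄ : ∀ r, r < 3 → (belowLiteralRule.run (n + m) s₃).reg r = s.reg r := fun r hr =>
    (St.run_reg _ (keeps_rulesSt hr).2.2.2.1 s₃).trans (k₃ r hr)
  have := step_belowGateRule hrep₄ hM₄ (by rw [k₄ 2 (by norm_num)]; exact hs 2 (by norm_num))
  rwa [k₄ 0 (by norm_num), k₄ 1 (by norm_num), k₄ 2 (by norm_num)] at this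

/-- Apply the rules once at all positions. -/
def passSt : St := .loop 0 (.loop 1 (.loop 2 rulesSt))

/-- No rule applies. -/
def Stuck (N : Net (Fin n) (Fin m)) : Prop :=
  ¬ ∃ i, i < n + m ∧ ∃ j, j < n + m ∧ ∃ k, k < n + m ∧ Guard i j k N

theorem step_passSt (hrep : N.Rep s.arr) (hN : N.Inv) : Step passSt s N (¬ N.Stuck) := by
  rw [Stuck, not_not]
  have hkeep : ∀ r, r < 3 → rulesSt.Keeps r := fun r hr =>
    ⟨(keeps_rulesSt hr).1, (keeps_rulesSt hr).2.1, (keeps_rulesSt hr).2.2.1,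
      (keeps_rulesSt hr).2.2.2.1, (keeps_rulesSt hr).2.2.2.2⟩
  have h2 : ∀ i j, i < n + m → j < n + m → ∀ t (M : Net (Fin n) (Fin m)),
      t.reg 0 = i → t.reg 1 = j → M.Rep t.arr → M.Inv →
      Step (.loop 2 rulesSt) t M (∃ k, k < n + m ∧ Guard i j k M) := by
    intro i j hi hj t M ht0 ht1 hM hM'
    refine step_loop (Q := fun t => t.reg 0 = i ∧ t.reg 1 = j) (G := fun k N => Guard i j k N)
      (fun t k hQ => ⟨?_, ?_⟩) (fun t hQ => ⟨?_, ?_⟩) (fun t M hk hQ hr hI => ?_) ⟨ht0, ht1⟩ hM hM'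
    · rw [setReg_reg, if_neg (by norm_num), hQ.1]
    · rw [setReg_reg, if_neg (by norm_num), hQ.2]
    · rw [St.run_reg _ (hkeep 0 (by norm_num)), hQ.1]
    · rw [St.run_reg _ (hkeep 1 (by norm_num)), hQ.2]
    · have := step_rulesSt (s := t) hr hI (by
        intro r hr
        interval_cases r
        · rw [hQ.1]; exact hi
        · rw [hQ.2]; exact hj
        · exact hk)
      rwa [hQ.1, hQ.2] at this
  have h1 : ∀ i, i < n + m → ∀ t (M : Net (Fin n) (Fin m)), t.reg 0 = i → M.Rep t.arr → M.Inv →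
      Step (.loop 1 (.loop 2 rulesSt)) t M
        (∃ j, j < n + m ∧ ∃ k, k < n + m ∧ Guard i j k M) := by
    intro i hi t M ht0 hM hM'
    refine step_loop (Q := fun t => t.reg 0 = i)
      (G := fun j N => ∃ k, k < n + m ∧ Guard i j k N) (fun t k hQ => ?_) (fun t hQ => ?_)
      (fun t M hj hQ hr hI => h2 i _ hi hj t M hQ rfl hr hI) ht0 hM hM'
    · rw [setReg_reg, if_neg (by norm_num), hQ]
    · rw [St.run_reg (.loop 2 rulesSt) ⟨by norm_num, hkeep 0 (by norm_num)⟩, hQ]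
  exact step_loop (Q := fun _ => True)
    (G := fun i N => ∃ j, j < n + m ∧ ∃ k, k < n + m ∧ Guard i j k N) (fun _ _ _ => trivial)
    (fun _ _ => trivial) (fun t M hi _ hr hI => h1 _ hi t M rfl hr hI) trivial hrep hN

/-- Each clause of `Reduced` is the failure of guards at all positions: collapsing gives
`two_inputs`, the two rules for literals give `below`, duplicates give `distinct`, dead gates give
`alive`. -/
theorem Stuck.reduced (h : N.Stuck) (hN : N.Inv) : N.Reduced := by
  have hG : ∀ i j k, i < n + m → j < n + m → k < n + m → ¬ Guard i j k N :=
    fun i j k hi hj hk hG => h ⟨i, hi, j, hj, k, hk, hG⟩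
  refine ⟨hN, fun u g h hug hgh => ?_, fun x g a b hxg hab hbg hk hne ha hv => ?_,
    fun a a' b hne ha ha' => ?_, fun v g hvg => ?_⟩
  · by_contra hun
    refine hG g h (code u) (gate_lt g) (gate_lt h) (code_lt u)
      (Or.inl ⟨u, g, h, rfl, rfl, rfl, hug, hgh, fun v hv => ?_⟩)
    by_contra hvu
    exact hun ⟨v, hvu, hv⟩
  · rcases ha with rfl | ⟨c, rfl, hc⟩
    · exact hG x b b (code_lt (Sum.inl x)) (gate_lt b) (gate_lt b) (Or.inr (Or.inr (Or.inr (Or.inl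
        ⟨x, rfl, b, rfl, hab, hv, g, hbg, hxg, hk, hne⟩))))
    · exact hG x c b (code_lt (Sum.inl x)) (gate_lt c) (gate_lt b) (Or.inr (Or.inr (Or.inr (Or.inr
        ⟨x, c, rfl, rfl, hc, b, rfl, hab, hv, g, hbg, hxg, hk, hne⟩))))
  · by_contra hsame
    refine hG a a' b (gate_lt a) (gate_lt a') (gate_lt b)
      (Or.inr (Or.inr (Or.inl ⟨a, a', b, rfl, rfl, rfl, hne, ha, ha', fun v => ?_⟩)))
    by_contra hva
    exact hsame ⟨v, hva⟩
  · by_contra hd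
    rw [not_or, not_exists] at hd
    exact hG (code v) g g (code_lt v) (gate_lt g) (gate_lt g)
      (Or.inr (Or.inl ⟨v, g, rfl, rfl, hvg, hd⟩))

/-- The statement `p` reduces every net, until no rule applies, or by at least `c` edges. -/
def Drops (n m c : ℕ) (p : St) : Prop :=
  ∀ (s : State) (N : Net (Fin n) (Fin m)), N.Rep s.arr → N.Inv →
    ∃ M : Net (Fin n) (Fin m), M.Rep (p.run (n + m) s).arr ∧ N.Refines M ∧
      (N.Stuck → M.Stuck) ∧ (M.Stuck ∨ M.edgeCount + c ≤ N.edgeCount)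

theorem drops_passSt : Drops n m 1 passSt := by
  intro s N hrep hN
  obtain ⟨M, h1, h2, h3⟩ := step_passSt hrep hN
  rw [not_not] at h3
  refine ⟨M, h1, h2, fun h => (h3.2 h).symm ▸ h, ?_⟩
  rcases h2.count with h | h
  · exact Or.inl (h.symm ▸ h3.1 h)
  · exact Or.inr h

/-- Savings add up over the rounds until the net is stuck, and further rounds keep it stuck. -/
theorem Drops.loop {c r : ℕ} {p : St} (hp : Drops n m c p) :
    Drops n m ((n + m) * c) (.loop r p) := by
  intro s N hrep hN
  refine iter_induction (P := fun j t => ∃ M : Net (Fin n) (Fin m), M.Rep t.arr ∧ N.Refines M ∧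
    (N.Stuck → M.Stuck) ∧ (M.Stuck ∨ M.edgeCount + j * c ≤ N.edgeCount))
    ⟨N, hrep, Refines.refl hN, id, Or.inr (by omega)⟩ ?_
  rintro j t - ⟨M, h1, h2, h3, h4⟩
  obtain ⟨M', h5, h6, h7, h8⟩ := hp (t.setReg r j) M h1 h2.inv
  refine ⟨M', h5, h2.trans h6, fun h => h7 (h3 h), ?_⟩
  rcases h4 with h4 | h4
  · exact Or.inl (h7 h4)
  · refine h8.imp id fun h8 => ?_
    rw [Nat.succ_mul]
    omega

/-- Apply the rules as long as possible. -/
def reduceSt : St := .loop 20 (.loop 21 passSt)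

/-- There are at most `(n + m)²` edges. If as many were removed, none would be left, whereas the
output always has an input; hence the net is stuck at the end. -/
theorem run_reduceSt (hrep : N.Rep s.arr) (hN : N.Inv) :
    ∃ M : Net (Fin n) (Fin m), M.Rep (reduceSt.run (n + m) s).arr ∧ N.Refines M ∧ M.Reduced := by
  obtain ⟨M, h1, h2, -, h4⟩ := (drops_passSt.loop (r := 21)).loop (r := 20) s N hrep hN
  refine ⟨M, h1, h2, Stuck.reduced (h4.resolve_right fun h => ?_) h2.inv⟩
  have hle : N.edgeCount ≤ (n + m) * ((n + m) * 1) := by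
    refine (Finset.card_filter_le _ _).trans ?_
    rw [Finset.card_univ, Fintype.card_prod, Fintype.card_sum, Fintype.card_fin, Fintype.card_fin]
    exact Nat.mul_le_mul_left _ (by omega)
  have hpos : 0 < M.edgeCount := by
    obtain ⟨v, hv⟩ := h2.inv.indegree_pos _ (Or.inl rfl)
    exact Finset.card_pos.2 ⟨(v, M.out), Finset.mem_filter.2 ⟨Finset.mem_univ _, hv⟩⟩
  omega

end Net

/-! ### Circuits and nets -/

namespace AntiCircuit

variable {n : ℕ} (C : AntiCircuit n)

/-- The circuit as a net. -/
def toNet : Net (Fin n) (Fin C.numGates) where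
  kind := C.kind
  edge := C.edge
  out := C.output

variable {C}

theorem IsPi.inv_toNet {t : ℕ} (h : C.IsPi t) : C.toNet.Inv where
  out_and := h.output_and
  child_unique := h.outdegree_le_one _ _ _
  alternating := h.alternating _ _
  acyclic := C.acyclic
  out_top g hg := by
    have := C.output_outdegree g
    rw [show C.edge (Sum.inr C.output) g = true from hg] at this
    cases this
  indegree_pos g _ := C.indegree_pos g

theorem holds_toNet {τ : Fin n → Bool} {v : C.Vertex} : C.toNet.Holds τ v ↔ C.Holds τ v := by
  constructor
  · intro h
    induction h with
    | lit i h => exact .lit i h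
    | andGate g hk _ ih => exact .andGate g hk ih
    | orGate g v hk he _ ih => exact .orGate g v hk he ih
  · intro h
    induction h with
    | lit i h => exact .lit i h
    | andGate g hk _ ih => exact .andGate g hk ih
    | orGate g v hk he _ ih => exact .orGate g v hk he ih

theorem path_toNet {k : ℕ} {v : C.Vertex} (h : C.toNet.Path k v) : C.PathToOutput k v := by
  induction h with
  | output => exact .output
  | step k v g he _ ih => exact .step k v g he ih

theorem embedsInGenus_toNet : GraphGenus.EmbedsInGenus C.toNet.graph C.genus := by
  classical
  obtain ⟨v₀, hv₀⟩ := C.indegree_pos C.output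
  have hne : ∀ {v g}, C.edge v g = true → v ≠ Sum.inr C.output := by
    rintro v g h rfl
    rw [C.output_outdegree] at h
    cases h
  refine (GraphGenus.embedsInGenus_genus
    (C.graph.induce {v : C.Vertex | v ≠ Sum.inr C.output})).minor (fun v => some v.1)
    -- In the graph of the net the output is still present as an isolated vertex. Nothing is
    -- contracted to it, so its centre `v₀` is arbitrary.
    (fun w => if h : w ≠ Sum.inr C.output then ⟨w, h⟩ else ⟨v₀, hne hv₀⟩) ?_ ?_
  · rintro v w hvw
    obtain rfl := Option.some.inj hvw
    rw [dif_pos (show v.1 ≠ Sum.inr C.output from v.2)]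
  · have key : ∀ w w', w ≠ w' → (∃ g, w' = Sum.inr g ∧ g ≠ C.toNet.out ∧ C.toNet.edge w g = true) →
        ∃ (hw : w ≠ Sum.inr C.output) (hw' : w' ≠ Sum.inr C.output),
          (C.graph.induce {v : C.Vertex | v ≠ Sum.inr C.output}).Adj ⟨w, hw⟩ ⟨w', hw'⟩ := by
      rintro w _ hww ⟨g, rfl, hg, he⟩
      exact ⟨hne he, fun h => hg (Sum.inr.inj h), hww, Or.inl ⟨g, rfl, he⟩⟩
    rintro w w' ⟨hww, h | h⟩
    · obtain ⟨hw, hw', hadj⟩ := key w w' hww h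
      exact ⟨_, _, hadj, rfl, rfl⟩
    · obtain ⟨hw, hw', hadj⟩ := key w' w hww.symm h
      exact ⟨_, _, hadj.symm, rfl, rfl⟩

end AntiCircuit

namespace Net

section Restrict

variable {n m p : ℕ} {N : Net (Fin n) (Fin m)}

/-- The gate contributes to the output. -/
def Live (N : Net (Fin n) (Fin m)) (g : Fin m) : Prop := g = N.out ∨ ∃ h, N.Child g h

/-- `e` enumerates the gates that contribute to the output. -/
structure Enumerates (N : Net (Fin n) (Fin m)) (e : Fin p → Fin m) (o : Fin p) : Prop where
  inv : N.Inv
  injective : Function.Injective e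
  live : ∀ k, N.Live (e k)
  exists_eq : ∀ g, N.Live g → ∃ k, e k = g
  out : e o = N.out

/-- The vertex of the net corresponding to a vertex of the circuit. -/
def lift (e : Fin p → Fin m) : Fin n ⊕ Fin p → Fin n ⊕ Fin m := Sum.map id e

namespace Enumerates

variable {e : Fin p → Fin m} {o : Fin p}

theorem exists_lift (he : N.Enumerates e o) {v : Fin n ⊕ Fin m} {g : Fin m}
    (h : N.edge v g = true) : ∃ w, lift e w = v := by
  cases v with
  | inl i => exact ⟨Sum.inl i, rfl⟩
  | inr c =>
    obtain ⟨k, rfl⟩ := he.exists_eq c (Or.inr ⟨g, h⟩)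
    exact ⟨Sum.inr k, rfl⟩

theorem lift_injective (he : N.Enumerates e o) :
    Function.Injective (lift e : Fin n ⊕ Fin p → Fin n ⊕ Fin m) :=
  Sum.map_injective.2 ⟨Function.injective_id, he.injective⟩

/-- The circuit of the gates that contribute to the output. -/
def circuit (he : N.Enumerates e o) : AntiCircuit n where
  numGates := p
  kind k := N.kind (e k)
  edge v k := N.edge (lift e v) (e k)
  output := o
  indegree_pos k := by
    obtain ⟨v, hv⟩ := he.inv.indegree_pos _ (he.live k)
    obtain ⟨w, rfl⟩ := he.exists_lift hv
    exact ⟨w, hv⟩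
  acyclic k hk := he.inv.acyclic (e k) (Relation.TransGen.lift e (fun _ _ h => h) _ _ hk)
  output_outdegree k := by
    have := he.inv.out_top (e k)
    rw [← he.out] at this
    exact Bool.eq_false_iff.2 this

theorem holds_circuit (he : N.Enumerates e o) {τ : Fin n → Bool} {v : he.circuit.Vertex} :
    he.circuit.Holds τ v ↔ N.Holds τ (lift e v) := by
  constructor
  · intro h
    induction h with
    | lit i h => exact .lit i h
    | andGate g hk _ ih =>
      refine .andGate (e g) hk fun v hv => ?_
      obtain ⟨w, rfl⟩ := he.exists_lift hv
      exact ih w hv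
    | orGate g v hk hvg _ ih => exact .orGate (e g) _ hk hvg ih
  · intro h
    generalize hw : lift e v = w at h
    induction h generalizing v with
    | lit i h =>
      cases v with
      | inl j =>
        obtain rfl := Sum.inl.inj hw
        exact .lit j h
      | inr k => cases hw
    | andGate g hk _ ih =>
      cases v with
      | inl j => cases hw
      | inr k =>
        obtain rfl := Sum.inr.inj hw
        exact .andGate k hk fun v hv => ih _ hv rfl
    | orGate g w hk hwg _ ih =>
      cases v with
      | inl j => cases hw
      | inr k =>
        obtain rfl := Sum.inr.inj hw
        obtain ⟨v, rfl⟩ := he.exists_lift hwg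
        exact .orGate k v hk hwg (ih rfl)

theorem satisfies_circuit (he : N.Enumerates e o) {τ : Fin n → Bool} :
    he.circuit.Satisfies τ ↔ N.Holds τ (Sum.inr N.out) := by
  rw [← he.out]
  exact he.holds_circuit (v := Sum.inr o)

theorem path_circuit (he : N.Enumerates e o) {k : ℕ} {v : he.circuit.Vertex}
    (h : he.circuit.PathToOutput k v) : N.Path k (lift e v) := by
  induction h with
  | output =>
    have : lift e (Sum.inr o) = (Sum.inr N.out : Fin n ⊕ Fin m) := congrArg Sum.inr he.out
    change N.Path 0 (lift e (Sum.inr o))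
    rw [this]
    exact .output
  | step k v g hvg _ ih => exact .step k _ (e g) hvg ih

/-- The graph of the circuit arises from that of the net by deleting the output and the gates that
are not enumerated. -/
theorem genus_circuit (he : N.Enumerates e o) {γ : ℕ}
    (h : GraphGenus.EmbedsInGenus N.graph γ) : he.circuit.genus ≤ γ := by
  classical
  refine Nat.sInf_le (h.minor
    (fun v => if h : ∃ w : {v : he.circuit.Vertex | v ≠ Sum.inr he.circuit.output},
      lift e w.1 = v then some h.choose else none) (fun w => lift e w.1) ?_ ?_)
  · intro v w hvw
    split_ifs at hvw with hex
    obtain rfl := Option.some.inj hvw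
    rw [hex.choose_spec]
  · have hq : ∀ w : {v : he.circuit.Vertex | v ≠ Sum.inr he.circuit.output},
        (if h : ∃ w' : {v : he.circuit.Vertex | v ≠ Sum.inr he.circuit.output},
          lift e w'.1 = lift e w.1 then some h.choose else none) = some w := by
      intro w
      have hex : ∃ w' : {v : he.circuit.Vertex | v ≠ Sum.inr he.circuit.output},
          lift e w'.1 = (lift e w.1 : Fin n ⊕ Fin m) := ⟨w, rfl⟩
      rw [dif_pos hex]
      exact congrArg some (Subtype.ext (he.lift_injective hex.choose_spec))
    have key : ∀ w w' : {v : he.circuit.Vertex | v ≠ Sum.inr he.circuit.output}, w.1 ≠ w'.1 →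
        (∃ k, w'.1 = Sum.inr k ∧ he.circuit.edge w.1 k = true) →
        N.graph.Adj (lift e w.1) (lift e w'.1) := by
      rintro w ⟨_, hw'⟩ hne ⟨k, rfl, hk⟩
      refine ⟨fun h => hne (he.lift_injective h), Or.inl ⟨e k, rfl, fun h => hw' ?_, hk⟩⟩
      rw [he.injective (h.trans he.out.symm)]
      rfl
    rintro w w' ⟨hne, hww | hww⟩
    · exact ⟨_, _, key w w' hne hww, hq w, hq w'⟩
    · exact ⟨_, _, (key w' w hne.symm hww).symm, hq w, hq w'⟩

theorem occurrences_circuit (he : N.Enumerates e o) : he.circuit.occurrences ≤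
    Fintype.card {q : Fin n × Fin m // N.edge (Sum.inl q.1) q.2 = true} := by
  rw [AntiCircuit.occurrences, Fintype.card_subtype]
  refine Finset.card_le_card_of_injOn (fun q => (q.1, e q.2)) (fun q hq => ?_) fun q _ q' _ h => ?_
  · have := (Finset.mem_filter.1 hq).2
    exact Finset.mem_coe.2 (Finset.mem_filter.2 ⟨Finset.mem_univ _, this⟩)
  · exact Prod.ext (Prod.ext_iff.1 h).1 (he.injective (Prod.ext_iff.1 h).2)

theorem isPi_circuit (he : N.Enumerates e o) {t : ℕ}
    (ht : ∀ i k, N.Path k (Sum.inl i) → k ≤ t) : he.circuit.IsPi t where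
  output_and := by
    have := he.inv.out_and
    rw [← he.out] at this
    exact this
  outdegree_le_one g h h' h1 h2 := he.injective (he.inv.child_unique (g := e g) h1 h2)
  alternating g h h1 := he.inv.alternating (g := e g) (h := e h) h1
  depth_le i k h := ht i k (he.path_circuit h)

theorem isSimplified_circuit (he : N.Enumerates e o) (hN : N.Reduced) :
    he.circuit.IsSimplified := by
  have hchild : ∀ g, g ≠ o → ∃ h, N.Child (e g) h := fun g hg =>
    (he.live g).resolve_left fun h => hg (he.injective (h.trans he.out.symm))
  refine ⟨fun g hg => ?_, fun g hg => ?_⟩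
  · obtain ⟨h, hh⟩ := hchild g hg
    obtain ⟨k, rfl⟩ := he.exists_eq h (hN.alive _ _ hh)
    exact ⟨k, hh⟩
  · obtain ⟨h, hh⟩ := hchild g hg
    obtain ⟨u, hu⟩ := he.inv.indegree_pos (e g) (he.live g)
    obtain ⟨v, hvu, hv⟩ := hN.two_inputs u _ h hu hh
    obtain ⟨u, rfl⟩ := he.exists_lift hu
    obtain ⟨v, rfl⟩ := he.exists_lift hv
    exact ⟨v, u, fun h => hvu (congrArg _ h), hv, hu⟩

end Enumerates

open Classical in
-- The enumeration is increasing because the machine prints the gates in the order of their old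
-- numbers.
theorem Inv.exists_enumeration (hN : N.Inv) : ∃ (p : ℕ) (e : Fin p → Fin m) (o : Fin p),
    StrictMono e ∧ N.Enumerates e o := by
  set S := Finset.univ.filter fun g => N.Live g
  have hmem : ∀ g, N.Live g → ∃ k, S.orderEmbOfFin rfl k = g := by
    intro g hg
    have : g ∈ Set.range (S.orderEmbOfFin rfl) := by
      rw [Finset.range_orderEmbOfFin]
      exact Finset.mem_coe.2 (Finset.mem_filter.2 ⟨Finset.mem_univ _, hg⟩)
    exact this
  obtain ⟨o, ho⟩ := hmem N.out (Or.inl rfl)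
  exact ⟨S.card, S.orderEmbOfFin rfl, o, (S.orderEmbOfFin rfl).strictMono, hN,
    (S.orderEmbOfFin rfl).injective,
    fun k => (Finset.mem_filter.1 (S.orderEmbOfFin_mem rfl k)).2, hmem, ho⟩

end Restrict

end Net

namespace AntiCircuit

variable {n : ℕ} {C : AntiCircuit n}

/-- The circuit obtained from a reduction of `C` has the required properties. -/
theorem reduced_circuit {t : ℕ} (hC : C.IsPi t) (hzero : ∀ i, ¬ C.IsZeroVariable i)
    (hgenus : C.genus ≤ n) {M : Net (Fin n) (Fin C.numGates)} (href : C.toNet.Refines M)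
    (hM : M.Reduced) {p : ℕ} {e : Fin p → Fin C.numGates} {o : Fin p} (he : M.Enumerates e o) :
    C.Equivalent he.circuit ∧ he.circuit.IsPi t ∧ he.circuit.IsSimplified ∧
      he.circuit.genus ≤ C.genus ∧ he.circuit.occurrences ≤ 138 * n := by
  have hemb := href.genus _ C.embedsInGenus_toNet
  have heq : ∀ τ, C.Satisfies τ ↔ M.Holds τ (Sum.inr M.out) := fun τ =>
    holds_toNet.symm.trans (href.equiv τ)
  refine ⟨fun τ => (heq τ).trans he.satisfies_circuit.symm, he.isPi_circuit fun i k hk => ?_,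
    he.isSimplified_circuit hM, he.genus_circuit hemb, he.occurrences_circuit.trans ?_⟩
  · obtain ⟨k', hkk, hk'⟩ := href.path k _ hk
    exact hkk.trans (hC.depth_le i k' (path_toNet hk'))
  -- A literal feeding the output, an AND gate, would make its variable a zero-variable.
  · have hout : ∀ x, M.edge (Sum.inl x) M.out = false := by
      intro x
      by_contra hx
      rw [Bool.not_eq_false] at hx
      refine hzero x fun τ hτ hsat => ?_
      have := (heq τ).1 hsat
      rw [Net.holds_gate, Net.GateValue, href.inv.out_and] at this
      have := M.holds_lit.1 (this _ hx)
      rw [hτ] at this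
      cases this
    have := hM.card_occurrences hout hemb (by rwa [Fintype.card_fin])
    rwa [Fintype.card_fin] at this

end AntiCircuit

/-! ### Reading the input -/

/-- Position `j * K + i` is entry `i` of block `j`; beyond the last block both sides are the default
value. -/
theorem List.getD_flatMap_of_length_eq {α : Type*} (l : List α) (f : α → List ℕ) {K : ℕ}
    (hf : ∀ a, (f a).length = K) {i : ℕ} (hi : i < K) (j : ℕ) :
    (l.flatMap f).getD (j * K + i) 0 = (l.map fun a => (f a).getD i 0).getD j 0 := by
  induction l generalizing j with
  | nil => simp
  | cons a l ih =>
    rw [List.flatMap_cons, List.map_cons]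
    cases j with
    | zero =>
      rw [List.getD_append _ _ _ _ (by rw [hf]; omega), List.getD_cons_zero]
      simp
    | succ j =>
      rw [List.getD_append_right _ _ _ _ (by rw [hf, Nat.succ_mul]; omega), List.getD_cons_succ,
        ← ih j, hf]
      congr 1
      rw [Nat.succ_mul]
      omega

namespace AntiCircuit

variable {n : ℕ} (C : AntiCircuit n)

theorem encode_eq : C.encode = [n, C.numGates, (C.output : ℕ)] ++
    List.ofFn (fun g => Net.kindCode (C.kind g)) ++
    (List.finRange C.numGates).flatMap (fun g =>
      List.ofFn (fun i : Fin n => (C.edge (Sum.inl i) g).toNat) ++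
      List.ofFn (fun h : Fin C.numGates => (C.edge (Sum.inr h) g).toNat)) := by
  have : (fun g => match C.kind g with
      | GateKind.and => 0
      | GateKind.or => 1) = fun g => Net.kindCode (C.kind g) := by
    funext g
    cases C.kind g <;> rfl
  rw [← this]
  rfl

theorem encode_kind (g : Fin C.numGates) :
    C.encode.getD (3 + g) 0 = Net.kindCode (C.kind g) := by
  have hg := g.2
  rw [encode_eq, List.getD_append _ _ _ _ (by simp; omega),
    List.getD_append_right _ _ _ _ (by simp), List.getD_eq_getElem _ _ (by simp),
    List.getElem_ofFn]
  simp

theorem encode_edge {i j : ℕ} (hi : i < n + C.numGates) :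
    C.encode.getD (3 + C.numGates + j * (n + C.numGates) + i) 0 = C.toNet.bit i j := by
  have hlen : ([n, C.numGates, C.output.val] ++
      List.ofFn fun g => Net.kindCode (C.kind g)).length = 3 + C.numGates := by
    simp
    omega
  rw [encode_eq, List.getD_append_right _ _ _ _ (by rw [hlen]; omega), hlen,
    show 3 + C.numGates + j * (n + C.numGates) + i - (3 + C.numGates) =
      j * (n + C.numGates) + i by omega, List.getD_flatMap_of_length_eq _ _ (by simp) hi]
  by_cases hj : j < C.numGates
  · rw [List.getD_eq_getElem _ _ (by simpa using hj), List.getElem_map]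
    obtain ⟨v, rfl⟩ := Net.exists_code hi
    have hb := C.toNet.bit_code v ⟨j, hj⟩
    rw [hb, List.getElem_finRange]
    cases v with
    | inl x =>
      have hx := x.2
      change List.getD _ x.val 0 = _
      rw [List.getD_append _ _ _ _ (by simp), List.getD_eq_getElem _ _ (by simp),
        List.getElem_ofFn]
      rfl
    | inr c =>
      have hc := c.2
      change List.getD _ (n + c.val) 0 = _
      rw [List.getD_append_right _ _ _ _ (by simp), List.getD_eq_getElem _ _ (by simp),
        List.getElem_ofFn]
      simp only [List.length_ofFn, add_tsub_cancel_left, Fin.eta]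
      rfl
  -- Rows beyond the last gate lie outside the word, where the default 0 agrees with the absence of
  -- edges.
  · rw [List.getD_eq_default _ _ (by simpa using hj)]
    symm
    by_contra hne
    obtain ⟨v, g, -, rfl, -⟩ := Net.bit_ne_zero.1 hne
    exact hj g.2

end AntiCircuit

namespace Net

open RAM

variable {n m : ℕ} {s : State}

/-- Compute the addresses of the rows of the adjacency matrix. -/
def setupSt : St :=
  .seq (.assign 3 (.add (.const 3) mEx))
    (.loop 4 (.seq (.store 2 (.reg 4) (.reg 3)) (.assign 3 (.add (.reg 3) .bound))))

theorem run_setupSt (hm : s.arr 0 1 = m) {K : ℕ} : (setupSt.run K s).arr 0 = s.arr 0 ∧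
    ∀ j, j < K → (setupSt.run K s).arr 2 j = 3 + m + j * K := by
  refine ⟨St.run_arr _ (by simp [setupSt, St.KeepsArr]) s, ?_⟩
  refine (iter_induction (P := fun k t => t.reg 3 = 3 + m + k * K ∧
    ∀ j, j < k → t.arr 2 j = 3 + m + j * K) ⟨?_, fun j hj => absurd hj (Nat.not_lt_zero j)⟩ ?_).2
  · simp [St.run, Ex.eval, mEx, hm]
  · rintro k t - ⟨h1, h2⟩
    refine ⟨?_, fun j hj => ?_⟩
    · simp only [St.run, Ex.eval, setReg_reg, setArr_reg, if_true]
      rw [if_neg (by norm_num), h1, Nat.succ_mul]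
      omega
    · have h3 : ¬ (3 = 4) := by norm_num
      simp only [St.run, Ex.eval, setReg_reg, setReg_arr, setArr_arr, if_true, true_and, h3,
        if_false]
      split_ifs with hjk
      · rw [hjk, h1]
      · exact h2 j (by omega)

end Net

theorem AntiCircuit.rep_init {n : ℕ} (C : AntiCircuit n) :
    C.toNet.Rep (Net.setupSt.run (n + C.numGates) (RAM.init C.encode)).arr := by
  obtain ⟨h0, h2⟩ := Net.run_setupSt (s := RAM.init C.encode) (m := C.numGates)
    (K := n + C.numGates) rfl
  have h0' : ∀ i, (Net.setupSt.run (n + C.numGates) (RAM.init C.encode)).arr 0 i =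
      C.encode.getD i 0 := fun i => by rw [h0]; rfl
  exact ⟨h0' 0, h0' 1, h0' 2, fun g => (h0' _).trans (C.encode_kind g), h2,
    fun i j hi _ => (h0' _).trans (C.encode_edge hi)⟩

/-! ### Writing the output -/

namespace Net

open RAM

variable {n m p : ℕ} {N : Net (Fin n) (Fin m)} {s : State}

/-- `j` is the number of a gate that contributes to the output. -/
def LiveNumber (N : Net (Fin n) (Fin m)) (j : ℕ) : Prop := ∃ g : Fin m, g.val = j ∧ N.Live g

/-- Mark the gates that contribute to the output in the array `3`. -/
def liveSt : St :=
  .loop 5 (.ite (.sub mEx (.reg 5))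
    (.seq (sumLoop (edgeEx (.add nEx (.reg 5)) (.reg 4)))
      (.store 3 (.reg 5) (.add (.reg 3) (.eq (.reg 5) outEx))))
    (.store 3 (.reg 5) (.const 0)))

/-- The mark of a gate is its outdegree, plus one for the output. Numbers from `m` on belong to no
gate and are marked 0. -/
theorem run_liveSt (hrep : N.Rep s.arr) : N.Rep (liveSt.run (n + m) s).arr ∧
    ∀ j, j < n + m → ((liveSt.run (n + m) s).arr 3 j ≠ 0 ↔ N.LiveNumber j) := by
  refine iter_induction (P := fun k t => N.Rep t.arr ∧
    ∀ j, j < k → (t.arr 3 j ≠ 0 ↔ N.LiveNumber j))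
    ⟨hrep, fun j hj => absurd hj (Nat.not_lt_zero j)⟩ ?_
  rintro k t hk ⟨ht, hmark⟩
  have ht' : N.Rep (t.setReg 5 k).arr := ht
  have hstore : ∀ (t' : State) (x : ℕ), t'.arr = t.arr → (x ≠ 0 ↔ N.LiveNumber k) →
      N.Rep (t'.setArr 3 k x).arr ∧
      ∀ j, j < k + 1 → ((t'.setArr 3 k x).arr 3 j ≠ 0 ↔ N.LiveNumber j) := by
    intro t' x harr hx
    refine ⟨ht.congr ?_ ?_, fun j hj => ?_⟩
    · funext j
      rw [setArr_arr, if_neg (by simp), harr]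
    · funext j
      rw [setArr_arr, if_neg (by simp), harr]
    · rw [setArr_arr]
      by_cases hjk : j = k
      · rw [if_pos ⟨rfl, hjk⟩, hjk]
        exact hx
      · rw [if_neg fun h => hjk h.2, harr]
        exact hmark j (by omega)
  have em : (Ex.sub mEx (.reg 5)).eval (n + m) (t.setReg 5 k) = m - k := by
    have := ht'.eval_m
    rw [Ex.eval, this, Ex.eval, setReg_reg, if_pos rfl]
  rw [St.run, em]
  split_ifs with hkm
  · obtain ⟨g, hg⟩ : ∃ g : Fin m, g.val = k := ⟨⟨k, by omega⟩, rfl⟩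
    obtain ⟨r1, r2, r3⟩ := run_outdegree (r := 5) (g := g) (by norm_num) (by norm_num) ht'
      (by rw [setReg_reg, if_pos rfl, hg])
    rw [St.run]
    set t' := (sumLoop (edgeEx (.add nEx (.reg 5)) (.reg 4))).run (n + m) (t.setReg 5 k)
    have h5 : t'.reg 5 = k := by
      rw [r3 5 (by norm_num) (by norm_num), setReg_reg, if_pos rfl]
    have hrun : (St.store 3 (.reg 5) (.add (.reg 3) (.eq (.reg 5) outEx))).run (n + m) t' =
        t'.setArr 3 k (t'.reg 3 + (Ex.eq (.reg 5) outEx).eval (n + m) t') := by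
      simp only [St.run, Ex.eval, h5]
    rw [hrun]
    refine hstore t' _ r1 ?_
    have hrep' : N.Rep t'.arr := by rw [r1]; exact ht
    have e2 : (Ex.eq (.reg 5) outEx).eval (n + m) t' ≠ 0 ↔ g = N.out := by
      rw [Ex.eval_eq, hrep'.eval_out, Ex.eval, h5, ← hg]
      exact Fin.ext_iff.symm
    have e3 := sum_bit_eq_zero (N := N) (g := g)
    rw [← r2] at e3
    have : N.LiveNumber k ↔ N.Live g := by
      constructor
      · rintro ⟨g', hg', h⟩
        rwa [Fin.ext (hg'.trans hg.symm)] at h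
      · exact fun h => ⟨g, hg, h⟩
    rw [this, Live, ← e2, show (∃ h, N.Child g h) ↔ t'.reg 3 ≠ 0 by rw [Ne, e3]; push Not; rfl]
    omega
  · have hrun : (St.store 3 (.reg 5) (.const 0)).run (n + m) (t.setReg 5 k) =
        (t.setReg 5 k).setArr 3 k 0 := by
      simp only [St.run, Ex.eval, setReg_reg, if_true]
    rw [hrun]
    refine hstore _ 0 rfl ⟨fun h => absurd rfl h, ?_⟩
    rintro ⟨g, hg, -⟩
    omega

/-- The net `N` and the marks of its gates are in memory, and the word `L` has been written. -/
structure Printed (N : Net (Fin n) (Fin m)) (L : List ℕ) (t : State) : Prop where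
  rep : N.Rep t.arr
  marks : ∀ j, j < n + m → (t.arr 3 j ≠ 0 ↔ N.LiveNumber j)
  length : t.reg 30 = L.length
  out : ∀ i, i < L.length → t.arr 1 i = L.getD i 0

theorem Printed.congr {L : List ℕ} {t : State} (h : Printed N L s) (harr : t.arr = s.arr)
    (hreg : t.reg 30 = s.reg 30) : Printed N L t where
  rep := by rw [harr]; exact h.rep
  marks := by rw [harr]; exact h.marks
  length := hreg.trans h.length
  out := by rw [harr]; exact h.out

/-- Append the value of `e` to the output. -/
def printSt (e : Ex) : St := .seq (.store 1 (.reg 30) e) (.assign 30 (.add (.reg 30) (.const 1)))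

theorem Printed.print {L : List ℕ} (h : Printed N L s) {e : Ex} {x : ℕ}
    (he : e.eval (n + m) s = x) : Printed N (L ++ [x]) ((printSt e).run (n + m) s) := by
  have harr : ∀ B j, ((printSt e).run (n + m) s).arr B j =
      if B = 1 ∧ j = L.length then x else s.arr B j := by
    intro B j
    simp only [printSt, St.run, setReg_arr, setArr_arr, Ex.eval, he, h.length]
  refine ⟨h.rep.congr ?_ ?_, fun j hj => ?_, ?_, fun i hi => ?_⟩
  · funext j
    rw [harr, if_neg (by simp)]
  · funext j
    rw [harr, if_neg (by simp)]
  · rw [harr, if_neg (by simp)]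
    exact h.marks j hj
  · simp [printSt, St.run, Ex.eval, h.length]
  · rw [List.length_append, List.length_singleton] at hi
    rw [harr]
    by_cases hiL : i = L.length
    · rw [if_pos ⟨rfl, hiL⟩, List.getD_append_right _ _ _ _ hiL.ge, hiL, Nat.sub_self,
        List.getD_cons_zero]
    · rw [if_neg fun h => hiL h.2, List.getD_append _ _ _ _ (by omega)]
      exact h.out i (by omega)

theorem Printed.printIf {L : List ℕ} (h : Printed N L s) {e e' : Ex} {P : Prop} [Decidable P]
    {x : ℕ}
    (he : e.eval (n + m) s ≠ 0 ↔ P) (he' : P → e'.eval (n + m) s = x) :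
    Printed N (L ++ if P then [x] else []) ((St.cond e (printSt e')).run (n + m) s) := by
  split_ifs with hP
  · rw [St.run_cond_pos (he.2 hP)]
    exact h.print (he' hP)
  · rw [St.run_cond_neg (not_not.1 (mt he.1 hP)), List.append_nil]
    exact h

theorem Printed.loop {L : List ℕ} (h : Printed N L s) {r : ℕ} {q : St} {F : ℕ → List ℕ}
    {Q : State → Prop} (hr : r ≠ 30) (hset : ∀ t j, Q t → Q (t.setReg r j))
    (hq : ∀ t L, t.reg r < n + m → Q t → Printed N L t →
      Q (q.run (n + m) t) ∧ Printed N (L ++ F (t.reg r)) (q.run (n + m) t)) (hQ : Q s) :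
    Q ((St.loop r q).run (n + m) s) ∧
      Printed N (L ++ (List.range (n + m)).flatMap F) ((St.loop r q).run (n + m) s) := by
  refine iter_induction (P := fun k t => Q t ∧ Printed N (L ++ (List.range k).flatMap F) t)
    ⟨hQ, by simpa using h⟩ ?_
  rintro k t hk ⟨h1, h2⟩
  have h3 := hq (t.setReg r k) _ (by simpa using hk) (hset t k h1)
    (h2.congr rfl (by rw [setReg_reg, if_neg hr.symm]))
  rw [List.range_succ, List.flatMap_append, List.flatMap_singleton, ← List.append_assoc]
  simpa using h3

/-- The number of the type of the gate number `j`. -/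
def kindNumber (N : Net (Fin n) (Fin m)) (j : ℕ) : ℕ :=
  if h : j < m then kindCode (N.kind ⟨j, h⟩) else 0

/-- The number of marked gates. -/
def countSt : St := .seq (sumLoop (.sub (.const 1) (.sub (.const 1) (.load 3 (.reg 4)))))
  (printSt (.reg 3))

/-- The number of marked gates before the output gate. -/
def indexSt : St := .seq (sumLoop (.sub (.const 1) (.add (.sub (.const 1) (.load 3 (.reg 4)))
  (.sub (.const 1) (.sub outEx (.reg 4)))))) (printSt (.reg 3))

/-- Print the types of the marked gates. -/
def kindsSt : St := .loop 5 (.cond (.load 3 (.reg 5)) (printSt (kindEx (.reg 5))))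

/-- Print the rows of the adjacency matrix that belong to marked gates. -/
def rowsSt : St := .loop 5 (.cond (.load 3 (.reg 5))
  (.seq (.loop 6 (.cond (.sub nEx (.reg 6)) (printSt (edgeEx (.reg 6) (.reg 5)))))
    (.loop 6 (.cond (.load 3 (.reg 6)) (printSt (edgeEx (.add nEx (.reg 6)) (.reg 5)))))))

open Classical in
-- The marks are outdegrees; the doubly truncated `1 - (1 - x)` turns them into indicators before
-- they are summed.
theorem Printed.countSt {L : List ℕ} (h : Printed N L s) :
    Printed N (L ++ [∑ j ∈ Finset.range (n + m), if N.LiveNumber j then 1 else 0])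
      (countSt.run (n + m) s) := by
  obtain ⟨r1, r2, r3⟩ := run_sumLoop (K := n + m) (s := s)
    (e := .sub (.const 1) (.sub (.const 1) (.load 3 (.reg 4))))
    (F := fun j => if N.LiveNumber j then 1 else 0) (by
      intro j t hj ht htj _
      have := h.marks j hj
      rw [← ht] at this
      simp only [Ex.eval, htj]
      split_ifs with hl
      · have := this.2 hl
        omega
      · have := mt this.1 hl
        omega)
  exact (h.congr r1 (r3 30 (by norm_num) (by norm_num))).print r2

open Classical in
-- The enumeration is increasing, so the new index of the output is the number of live gates before
-- it.
theorem Printed.indexSt {L : List ℕ} (h : Printed N L s) :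
    Printed N (L ++ [∑ j ∈ Finset.range (n + m), if N.LiveNumber j ∧ j < N.out then 1 else 0])
      (indexSt.run (n + m) s) := by
  obtain ⟨r1, r2, r3⟩ := run_sumLoop (K := n + m) (s := s)
    (e := .sub (.const 1) (.add (.sub (.const 1) (.load 3 (.reg 4)))
      (.sub (.const 1) (.sub outEx (.reg 4)))))
    (F := fun j => if N.LiveNumber j ∧ j < N.out then 1 else 0) (by
      intro j t hj ht htj _
      have := h.marks j hj
      rw [← ht] at this
      have ho : outEx.eval (n + m) t = N.out := Rep.eval_out (by rw [ht]; exact h.rep)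
      simp only [Ex.eval, htj, ho]
      split_ifs with hl
      · have := this.2 hl.1
        omega
      · by_cases hlive : N.LiveNumber j
        · have : ¬ j < N.out := fun h => hl ⟨hlive, h⟩
          omega
        · have := mt this.1 hlive
          omega)
  exact (h.congr r1 (r3 30 (by norm_num) (by norm_num))).print r2

open Classical in
theorem Printed.kindsSt {L : List ℕ} (h : Printed N L s) :
    Printed N (L ++ (List.range (n + m)).flatMap fun j =>
      if N.LiveNumber j then [N.kindNumber j] else []) (kindsSt.run (n + m) s) := by
  refine (h.loop (r := 5) (Q := fun _ => True) (by norm_num) (fun _ _ _ => trivial)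
    (fun t L hj _ ht => ⟨trivial, ht.printIf (e := .load 3 (.reg 5))
      (e' := kindEx (.reg 5)) (ht.marks _ hj) fun hl => ?_⟩) trivial).2
  obtain ⟨g, hg, -⟩ := hl
  have hg' : g.val = t.reg 5 := hg
  rw [ht.rep.eval_kind (e := .reg 5) (g := g) hg.symm, kindNumber, ← hg', dif_pos g.2]

open Classical in
theorem Printed.rowsSt {L : List ℕ} (h : Printed N L s) :
    Printed N (L ++ (List.range (n + m)).flatMap fun j => if N.LiveNumber j then
      ((List.range (n + m)).flatMap fun i => if i < n then [N.bit i j] else []) ++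
      ((List.range (n + m)).flatMap fun i => if N.LiveNumber i then [N.bit (n + i) j] else [])
      else []) (rowsSt.run (n + m) s) := by
  refine (h.loop (r := 5) (Q := fun _ => True) (by norm_num) (fun _ _ _ => trivial)
    (fun t L hj _ ht => ⟨trivial, ?_⟩) trivial).2
  have hcond : (Ex.load 3 (.reg 5)).eval (n + m) t ≠ 0 ↔ N.LiveNumber (t.reg 5) := ht.marks _ hj
  split_ifs with hl
  · rw [St.run_cond_pos (hcond.2 hl), ← List.append_assoc]
    have hset : ∀ t' k, State.reg t' 5 = t.reg 5 → (t'.setReg 6 k).reg 5 = t.reg 5 := by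
      intro t' k h5
      rw [setReg_reg, if_neg (by norm_num), h5]
    have hrun : ∀ (t' : State) e e', t'.reg 5 = t.reg 5 →
        ((St.cond e (printSt e')).run (n + m) t').reg 5 = t.reg 5 := by
      intro t' e e' h5
      rw [St.run_reg (St.cond e (printSt e')) (by simp [St.cond, printSt, St.Keeps]), h5]
    obtain ⟨q1, h1⟩ := ht.loop (r := 6) (Q := fun t' => t'.reg 5 = t.reg 5)
      (q := .cond (.sub nEx (.reg 6)) (printSt (edgeEx (.reg 6) (.reg 5))))
      (F := fun i => if i < n then [N.bit i (t.reg 5)] else []) (by norm_num) hset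
      (fun t' L hi h5 ht' => ⟨hrun t' _ _ h5, ht'.printIf (e := .sub nEx (.reg 6))
        (e' := edgeEx (.reg 6) (.reg 5)) (P := t'.reg 6 < n) (x := N.bit (t'.reg 6) (t.reg 5)) (by
        have := ht'.rep.eval_n
        rw [Ex.eval, this, Ex.eval]
        omega) fun _ => ht'.rep.eval_edge hi hj rfl h5⟩) rfl
    exact (h1.loop (r := 6) (Q := fun t' => t'.reg 5 = t.reg 5)
      (q := .cond (.load 3 (.reg 6)) (printSt (edgeEx (.add nEx (.reg 6)) (.reg 5))))
      (F := fun i => if N.LiveNumber i then [N.bit (n + i) (t.reg 5)] else []) (by norm_num) hset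
      (fun t' L hi h5 ht' => ⟨hrun t' _ _ h5, ht'.printIf (e := .load 3 (.reg 6))
        (e' := edgeEx (.add nEx (.reg 6)) (.reg 5)) (ht'.marks _ hi) fun hl => by
        obtain ⟨g, hg, -⟩ := hl
        rw [← hg]
        exact ht'.rep.eval_edge (code_lt (Sum.inr g)) hj (ht'.rep.eval_gate hg.symm) h5⟩) q1).2
  · rw [St.run_cond_neg (not_not.1 (mt hcond.1 hl)), List.append_nil]
    exact ht

/-- Print the circuit. -/
def outputSt : St :=
  .seq liveSt (.seq (.assign 30 (.const 0)) (.seq (printSt nEx) (.seq countSt (.seq indexSt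
    (.seq kindsSt rowsSt)))))

open Classical in
theorem run_outputSt (hrep : N.Rep s.arr) : Printed N
    ([n] ++ [∑ j ∈ Finset.range (n + m), if N.LiveNumber j then 1 else 0] ++
      [∑ j ∈ Finset.range (n + m), if N.LiveNumber j ∧ j < N.out then 1 else 0] ++
      ((List.range (n + m)).flatMap fun j =>
        if N.LiveNumber j then [N.kindNumber j] else []) ++
      (List.range (n + m)).flatMap fun j => if N.LiveNumber j then
        ((List.range (n + m)).flatMap fun i => if i < n then [N.bit i j] else []) ++
        ((List.range (n + m)).flatMap fun i => if N.LiveNumber i then [N.bit (n + i) j] else [])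
        else []) (outputSt.run (n + m) s) := by
  obtain ⟨h1, h2⟩ := run_liveSt hrep
  have h3 : Printed N [] ((St.assign 30 (.const 0)).run (n + m) (liveSt.run (n + m) s)) :=
    ⟨h1, h2, by simp [St.run, Ex.eval], fun i hi => absurd hi (Nat.not_lt_zero i)⟩
  exact (h3.print (e := nEx) h1.eval_n).countSt.indexSt.kindsSt.rowsSt

/-! ### The printed word as the encoding of the new circuit -/

theorem flatMap_range_ite {K : ℕ} {P : ℕ → Prop} [DecidablePred P] {e : Fin p → ℕ}
    (he : StrictMono e) (hP : ∀ j, j < K ∧ P j ↔ ∃ k, e k = j) (F : ℕ → List ℕ) :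
    ((List.range K).flatMap fun j => if P j then F j else []) =
      (List.finRange p).flatMap fun k => F (e k) := by
  have h1 : ∀ l : List ℕ, (l.flatMap fun j => if P j then F j else []) =
      (l.filter fun j => P j).flatMap F := by
    intro l
    induction l with
    | nil => rfl
    | cons a l ih => by_cases ha : P a <;> simp [ha, ih]
  -- Both lists are strictly increasing and have the same members, hence they are equal.
  have h2 : (List.range K).filter (fun j => P j) = (List.finRange p).map e := by
    refine List.SortedLT.eq_of_mem_iff ?_ ?_ fun j => ?_
    · exact (List.pairwise_lt_range.filter _).sortedLT
    · exact (List.pairwise_map.2 ((List.pairwise_lt_finRange p).imp fun h => he h)).sortedLT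
    · simp [hP]
  rw [h1, h2, List.flatMap_map]

theorem ofFn_eq_flatMap {α : Type*} (f : Fin p → α) :
    List.ofFn f = (List.finRange p).flatMap fun k => [f k] := by
  rw [List.ofFn_eq_map, List.map_eq_flatMap]

open Classical in
theorem Enumerates.encode_circuit {e : Fin p → Fin m} {o : Fin p} (he : N.Enumerates e o)
    (hmono : StrictMono e) : he.circuit.encode =
    [n] ++ [∑ j ∈ Finset.range (n + m), if N.LiveNumber j then 1 else 0] ++
      [∑ j ∈ Finset.range (n + m), if N.LiveNumber j ∧ j < N.out then 1 else 0] ++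
      ((List.range (n + m)).flatMap fun j =>
        if N.LiveNumber j then [N.kindNumber j] else []) ++
      (List.range (n + m)).flatMap fun j => if N.LiveNumber j then
        ((List.range (n + m)).flatMap fun i => if i < n then [N.bit i j] else []) ++
        ((List.range (n + m)).flatMap fun i => if N.LiveNumber i then [N.bit (n + i) j] else [])
        else [] := by
  have hmono' : StrictMono fun k => (e k).val := fun a b h => hmono h
  have hlive : ∀ j, N.LiveNumber j ↔ ∃ k, (e k).val = j := by
    intro j
    constructor
    · rintro ⟨g, rfl, hg⟩
      obtain ⟨k, rfl⟩ := he.exists_eq g hg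
      exact ⟨k, rfl⟩
    · rintro ⟨k, rfl⟩
      exact ⟨e k, rfl, he.live k⟩
  have hlive' : ∀ j, j < n + m ∧ N.LiveNumber j ↔ ∃ k, (e k).val = j := by
    intro j
    rw [hlive, and_iff_right_iff_imp]
    rintro ⟨k, rfl⟩
    exact gate_lt _
  have hlit : ∀ j, j < n + m ∧ j < n ↔ ∃ k : Fin n, k.val = j := fun j =>
    ⟨fun h => ⟨⟨j, h.2⟩, rfl⟩, by rintro ⟨k, rfl⟩; have := k.2; omega⟩
  have hcount : ∑ j ∈ Finset.range (n + m), (if N.LiveNumber j then 1 else 0) = p := by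
    rw [Finset.sum_boole, Nat.cast_id]
    have : (Finset.range (n + m)).filter N.LiveNumber = Finset.univ.image fun k => (e k).val := by
      ext j
      rw [Finset.mem_filter, Finset.mem_range, hlive']
      simp
    rw [this, Finset.card_image_of_injective _ hmono'.injective, Finset.card_univ, Fintype.card_fin]
  have hindex : ∑ j ∈ Finset.range (n + m), (if N.LiveNumber j ∧ j < N.out then 1 else 0) =
      o.val := by
    rw [Finset.sum_boole, Nat.cast_id]
    have : (Finset.range (n + m)).filter (fun j => N.LiveNumber j ∧ j < N.out) =
        (Finset.Iio o).image fun k => (e k).val := by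
      ext j
      rw [Finset.mem_filter, Finset.mem_range, ← and_assoc, hlive', ← he.out, Finset.mem_image]
      constructor
      · rintro ⟨⟨k, rfl⟩, hk⟩
        exact ⟨k, Finset.mem_Iio.2 (hmono.lt_iff_lt.1 hk), rfl⟩
      · rintro ⟨k, hk, rfl⟩
        exact ⟨⟨k, rfl⟩, hmono (Finset.mem_Iio.1 hk)⟩
    rw [this, Finset.card_image_of_injective _ hmono'.injective, Fin.card_Iio]
  rw [hcount, hindex, flatMap_range_ite hmono' hlive', flatMap_range_ite hmono' hlive',
    AntiCircuit.encode_eq]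
  congr 1
  · congr 1
    rw [ofFn_eq_flatMap]
    refine List.flatMap_congr fun k _ => ?_
    rw [kindNumber, dif_pos (e k).2]
    rfl
  · refine List.flatMap_congr fun k _ => ?_
    rw [flatMap_range_ite hmono' hlive', flatMap_range_ite Fin.val_strictMono hlit,
      ofFn_eq_flatMap, ofFn_eq_flatMap]
    congr 1
    · refine List.flatMap_congr fun i _ => ?_
      exact congrArg (fun x => [x]) (N.bit_code (Sum.inl i) (e k)).symm
    · refine List.flatMap_congr fun i _ => ?_
      exact congrArg (fun x => [x]) (N.bit_code (Sum.inr (e i)) (e k)).symm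

end Net

/-! ### The theorem -/

theorem mainTheorem8 :
    ∃ (P : RAM.Prog) (p : Polynomial ℕ) (c : ℕ),
      ∀ (t : ℕ), 2 ≤ t → ∀ (n : ℕ) (C : AntiCircuit n),
        C.IsPi t → (∀ i, ¬ C.IsZeroVariable i) → C.genus ≤ n →
        ∃ (C' : AntiCircuit n) (steps : ℕ) (s : RAM.State),
          RAM.Exec P (RAM.init C.encode) steps s ∧
          steps ≤ p.eval C.size ∧
          RAM.HasOutput s C'.encode ∧
          C.Equivalent C' ∧
          C'.IsPi t ∧
          C'.IsSimplified ∧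
          C'.genus ≤ C.genus ∧
          C'.occurrences ≤ c * n := by
  obtain ⟨P, q, hP⟩ := RAM.exists_prog (.seq (.seq Net.setupSt Net.reduceSt) Net.outputSt)
  refine ⟨P, q, 138, fun t _ n C hC hzero hgenus => ?_⟩
  obtain ⟨k, σ, hexec, hk, hσ⟩ := hP C.encode
  -- The encoding begins with the numbers of variables and gates, whose sum is the bound of all
  -- loops.
  have hbound : C.encode.getD 0 0 + C.encode.getD 1 0 = n + C.numGates := rfl
  rw [hbound] at hk hσ
  obtain ⟨M, hrep, href, hM⟩ := Net.run_reduceSt C.rep_init hC.inv_toNet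
  obtain ⟨p, e, o, hmono, he⟩ := hM.inv.exists_enumeration
  refine ⟨he.circuit, k, σ, hexec, hk.trans ?_, ?_, C.reduced_circuit hC hzero hgenus href hM he⟩
  -- A polynomial with natural coefficients is monotone, and the size is at least the number of
  -- vertices.
  · rw [Polynomial.eval_eq_sum, Polynomial.eval_eq_sum]
    refine Finset.sum_le_sum fun i _ => Nat.mul_le_mul_left _ (Nat.pow_le_pow_left ?_ i)
    exact Nat.le_add_right _ _
  · intro i hi
    rw [hσ]
    rw [he.encode_circuit hmono] at hi ⊢
    exact (Net.run_outputSt hrep).out i hi
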